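/- **Setting.** Let $H\subset V$ be complex Hilbert spaces with norms $|||\cdot|||_H$, $|||\cdot|||_V$, with $H$ continuously and densely included in $V$; $H^*$, $V^*$ denote the spaces of bounded antilinear functionals, so that $V^*\subset H^*$. Let $P=D-E:H\to H^*$ with $D:H\to H^*$ and $E:V\to V^*$ bounded, $\operatorname{Ker}D^*=\operatorname{Ker}D$, and, for some constants $c_E,c_1,c_2>0$, $$\operatorname{Re}\langle Ev,v\rangle\ge c_E|||v|||_V^2\quad(v\in V),\qquad \operatorname{Re}\langle Dv,v\rangle\ge c_1|||v|||_H^2-c_2|||v|||_V^2\quad(v\in H).$$ Use from now on the norms $\|v\|_V=\sqrt{c_2}\,|||v|||_V$ and $\|v\|_H^2=\operatorname{Re}\langle Dv,v\rangle+c_2|||v|||_V^2$, with inner products $(\cdot,\cdot)_V$, $(\cdot,\cdot)_H$, and let $\iota:V\to V^*$ be the Riesz map of $(\cdot,\cdot)_V$. $\operatorname{Ker}D$ is closed in $V$; let $\Pi_0^V$ be the $V$-orthogonal projection onto it, let $E^{00}=\Pi_0^V\iota^{-1}E|_{\operatorname{Ker}D}$, which is invertible on $\operatorname{Ker}D$,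 and let $$\Pi_0=(E^{00})^{-1}\Pi_0^V\iota^{-1}E,\qquad \Pi_1=I-\Pi_0 .$$ All this applies to $P^*=D^*-E^*$ as well (with the same norms, and with $E^*$ in place of $E$ in $\Pi_0,\Pi_1$). **Regularity assumptions** for $P$ with $m\ge1$, spaces $Z^0=V$, $Z^1=H$ and normed spaces $Z^j\subset Z^{j-1}$ ($2\le j\le m+1$), continuously included with norm at most $C$, $V$ being dense in $(Z^j)^*$ via $\iota$ for $j\ge1$, and a constant $C>0$ (a bound includes the claim that its left-hand side is defined whenever its right-hand side is finite): (i) $\|\Pi_0^V\|_{Z^j\to Z^j}\le C$ for $1\le j\le m+1$; (ii) for $\mathsf D\in\{D,D^*,\operatorname{Re}D\}$, $2\le j\le m+1$ and $u\in H$, $$\|\Pi_1u\|_{Z^j}\le C\Big(\|\Pi_1u\|_V+\sup_{v\in H,\ \|\iota v\|_{(Z^{j-2})^*}=1}|\langle\mathsf D\Pi_1u,\Pi_1v\rangle|\Big);$$ (iii) $\|\iota^{-1}\mathsf E\|_{Z^j\to Z^j}\le C$ for $\mathsf E\in\{E,E^*,\operatorname{Re}E\}$ and $1\le j\le m+1$;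 (iv) $\|\Pi_0^Vu\|_{Z^j}\le C\big(\|\Pi_0^V\iota^{-1}\mathsf E\,\Pi_0^Vu\|_{Z^j}+\|\Pi_0^Vu\|_V\big)$ for $\mathsf E\in\{E,E^*\}$, $1\le j\le m+1$ and $u\in V$. **Galerkin method.** Let $H_h\subset H$ be a closed subspace and $\Pi_h:H\to H_h$ the $(\cdot,\cdot)_H$-orthogonal projection. For $u\in H$, a Galerkin solution is a $u_h\in H_h$ with $\langle P(u-u_h),v_h\rangle=0$ for all $v_h\in H_h$. Let $$\gamma_{\rm dv}(P)=\sup\Big\{\tfrac{\|\Pi_0w_h\|_V}{\|w_h\|_H}:\ 0\ne w_h\in H_h,\ \langle Ew_h,v_h\rangle=0\ \ \forall v_h\in H_h\cap\operatorname{Ker}D\Big\}$$ (with supremum $0$ if there is no such $w_h$), and write $\delta=\|I-\Pi_h\|_{Z^{m+1}\to H}$ and $\rho=\|(P^*)^{-1}\Pi_1^*\|_{V^*\to V}$. **Theorem.** Suppose that the setting above holds, that the regularity assumptions hold for both $P$ and $P^*$, and that for each $f\in H^*$ the equation $Pu=f$ has a unique solution $u\in H$. Then there are $C_1,C_2,C_3>0$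 such that, for every closed $H_h\subset H$ with $$\max\{\gamma_{\rm dv}(P),\gamma_{\rm dv}(P^*)\}\le C_1\quad\text{and}\quad \delta^2(1+\rho)\le C_2,\tag{1}$$ and every $f\in H^*$ with $Pu=f$, the Galerkin solution $u_h$ exists, is unique, and satisfies $$\|u-u_h\|_H\le C_3\big(1+\delta(1+\rho)\big)\|(I-\Pi_h)u\|_H .$$ In addition, given $C_{\rm osc}>0$ there is $C_4>0$ such that, if (1) holds, $f\in V^*$ and $\|\iota^{-1}f\|_{Z^{m+1}}\le C_{\rm osc}\|f\|_{H^*}$, then $$\frac{\|u-u_h\|_H}{\|u\|_H}\le C_4\big(1+\delta(1+\rho)\big)\,\delta\qquad(u\neq0).\tag{2}$$ Furthermore, given also $\widetilde C>0$ there is $C_5>0$ such that, if (1) holds, $f\in V^*$, $\Pi_0^*f=\widetilde\Pi_0^*f$ for some bounded linear $\widetilde\Pi_0:V\to V$ with $\Pi_0\widetilde\Pi_0=\widetilde\Pi_0$ and $\|\iota^{-1}\widetilde\Pi_0^*\iota\|_{Z^{m-1}\to Z^{m+1}}\le\widetilde C$, and $\|\iota^{-1}f\|_{Z^{m-1}}\le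 C_{\rm osc}\|f\|_{H^*}$, then (2) holds with $C_5$ in place of $C_4$. The constants depend only on $m$, on upper bounds for $\|P\|_{H\to H^*}$ and $\|E\|_{V\to V^*}$, on $c_E,c_1,c_2$ and $C$, and $C_4$ (respectively $C_5$) also on $C_{\rm osc}$ (respectively on $C_{\rm osc}$ and $\widetilde C$); in particular they do not depend on the spaces, on $H_h$ or on $f$. -/

import Mathlib

open scoped ENNReal

universe u v

namespace AbsGalerkin

/-- The space of bounded antilinear functionals on `X`. The pairing `⟨φ, v⟩ = φ v` is then linear in
`φ` and antilinear in `v`, like an inner product `(u, v)` that is linear in its first argument. -/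
abbrev AntiDual (X : Type*) [NormedAddCommGroup X] [NormedSpace ℂ X] := X →L⋆[ℂ] ℂ

noncomputable section

section Forms

variable {X Y : Type*} [NormedAddCommGroup X] [NormedSpace ℂ X]
  [NormedAddCommGroup Y] [NormedSpace ℂ Y]

/-- The adjoint `A^* : X → X^*` of `A : X → X^*`, that is `⟨A^* u, v⟩ = conj ⟨A v, u⟩`. -/
def sesqAdj (A : X →L[ℂ] AntiDual X) : X →L[ℂ] AntiDual X :=
  LinearMap.mkContinuous₂
    (LinearMap.mk₂'ₛₗ (RingHom.id ℂ) (starRingEnd ℂ) (fun u v => starRingEnd ℂ (A v u))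
      (by intros; simp) (by intros; simp) (by intros; simp) (by intros; simp))
    ‖A‖ (fun u v => by
      have h := A.le_opNorm₂ v u
      simp only [LinearMap.mk₂'ₛₗ_apply, RCLike.norm_conj]
      linarith [mul_right_comm ‖A‖ ‖v‖ ‖u‖])

@[simp] lemma sesqAdj_apply (A : X →L[ℂ] AntiDual X) (u v : X) :
    sesqAdj A u v = starRingEnd ℂ (A v u) := rfl

lemma sesqAdj_sesqAdj (A : X →L[ℂ] AntiDual X) : sesqAdj (sesqAdj A) = A := by
  ext u v; simp

/-- The real part `Re A = (A + A^*) / 2`. -/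
def rePart (A : X →L[ℂ] AntiDual X) : X →L[ℂ] AntiDual X := (1 / 2 : ℂ) • (A + sesqAdj A)

/-- The adjoint `T^* : Y^* → X^*`, `⟨T^* φ, x⟩ = ⟨φ, T x⟩`, of a bounded operator `T : X → Y`. -/
def dualMap (T : X →L[ℂ] Y) : AntiDual Y →L[ℂ] AntiDual X :=
  LinearMap.mkContinuous
    { toFun := fun φ => φ.comp T
      map_add' := fun _ _ => rfl
      map_smul' := fun _ _ => rfl }
    ‖T‖ (fun φ => by
      have h := ContinuousLinearMap.opNorm_comp_le φ T
      rw [mul_comm]; exact h)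

@[simp] lemma dualMap_apply (T : X →L[ℂ] Y) (φ : AntiDual Y) (x : X) :
    dualMap T φ x = φ (T x) := rfl

end Forms

/-- The Riesz map `X → X^*` of the inner product of `X`. Mathlib's inner product is antilinear in its
first argument, so `(u, v)` is `inner ℂ v u`. -/
def riesz₀ (X : Type*) [NormedAddCommGroup X] [InnerProductSpace ℂ X] : X →L[ℂ] AntiDual X :=
  (innerSL ℂ).flip

section LaxMilgram

variable {X : Type*} [NormedAddCommGroup X] [InnerProductSpace ℂ X]

@[simp] lemma riesz₀_apply (u v : X) : riesz₀ X u v = inner ℂ v u := rfl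

variable [CompleteSpace X]

/-- Lax--Milgram for operators. -/
lemma isInvertible_of_coercive (T : X →L[ℂ] X) {c : ℝ} (hc : 0 < c)
    (h : ∀ v, c * ‖v‖ ^ 2 ≤ (inner ℂ v (T v) : ℂ).re) : T.IsInvertible := by
  have hb : ∀ v, c * ‖v‖ ≤ ‖T v‖ := by
    intro v
    rcases eq_or_ne v 0 with rfl | hv
    · simp
    have hv' : 0 < ‖v‖ := norm_pos_iff.2 hv
    have h1 : (inner ℂ v (T v) : ℂ).re ≤ ‖v‖ * ‖T v‖ :=
      (Complex.re_le_norm _).trans (norm_inner_le_norm v (T v))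
    have h2 := (h v).trans h1
    nlinarith
  have hanti : AntilipschitzWith (Real.toNNReal c⁻¹) T := by
    refine ContinuousLinearMap.antilipschitz_of_bound T fun v => ?_
    rw [Real.coe_toNNReal _ (inv_nonneg.2 hc.le), ← div_eq_inv_mul, le_div_iff₀ hc, mul_comm]
    exact hb v
  have hker : T.ker = ⊥ := LinearMap.ker_eq_bot.2 hanti.injective
  have hclosed : IsClosed (T.range : Set X) := by
    exact hanti.isClosed_range T.uniformContinuous
  have hrange : T.range = ⊤ := by
    have : CompleteSpace T.range := hclosed.completeSpace_coe
    rw [← Submodule.orthogonal_eq_bot_iff, Submodule.eq_bot_iff]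
    intro w hw
    have h0 : inner ℂ (T w) w = (0 : ℂ) := (Submodule.mem_orthogonal _ _).1 hw _ ⟨w, rfl⟩
    have h1 : (inner ℂ w (T w) : ℂ) = 0 := by rw [← inner_conj_symm, h0]; simp
    have h2 := h w
    rw [h1] at h2
    have h3 : ‖w‖ ^ 2 ≤ 0 := by
      simp only [Complex.zero_re] at h2
      nlinarith [sq_nonneg ‖w‖]
    simpa using le_antisymm h3 (sq_nonneg _)
  exact ⟨ContinuousLinearEquiv.ofBijective T hker hrange, rfl⟩

lemma riesz₀_isInvertible : (riesz₀ X).IsInvertible := by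
  have hinj : (riesz₀ X).ker = ⊥ := by
    rw [Submodule.eq_bot_iff]
    intro u hu
    have h : riesz₀ X u u = 0 := by
      have h' : riesz₀ X u = 0 := hu
      rw [h']; rfl
    simpa using h
  have hsurj : (riesz₀ X).range = ⊤ := by
    rw [LinearMap.range_eq_top]
    intro φ
    let ψ : StrongDual ℂ X :=
      LinearMap.mkContinuous
        { toFun := fun v => starRingEnd ℂ (φ v)
          map_add' := by intros; simp
          map_smul' := by intros; simp } ‖φ‖ (fun v => by simpa using φ.le_opNorm v)
    refine ⟨(InnerProductSpace.toDual ℂ X).symm ψ, ?_⟩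
    ext v
    have h1 : inner ℂ ((InnerProductSpace.toDual ℂ X).symm ψ) v = starRingEnd ℂ (φ v) :=
      InnerProductSpace.toDual_symm_apply
    change inner ℂ v ((InnerProductSpace.toDual ℂ X).symm ψ) = φ v
    rw [← inner_conj_symm, h1]; simp
  exact ⟨ContinuousLinearEquiv.ofBijective _ hinj hsurj, rfl⟩

/-- Lax--Milgram for sesquilinear forms. -/
lemma form_isInvertible_of_coercive (A : X →L[ℂ] AntiDual X) {c : ℝ} (hc : 0 < c)
    (h : ∀ v, c * ‖v‖ ^ 2 ≤ (A v v).re) : A.IsInvertible := by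
  obtain ⟨R, hR⟩ := riesz₀_isInvertible (X := X)
  have hRi : ∀ v φ, inner ℂ v (R.symm φ) = φ v := fun v φ => by
    have h1 : riesz₀ X (R.symm φ) v = φ v := by
      rw [← hR]; exact congrArg (fun ψ : AntiDual X => ψ v) (R.apply_symm_apply φ)
    exact h1
  have hT := isInvertible_of_coercive ((R.symm : AntiDual X →L[ℂ] X) ∘L A) hc (fun v => by
    have := h v
    simpa [hRi] using this)
  have : A = riesz₀ X ∘L ((R.symm : AntiDual X →L[ℂ] X) ∘L A) := by
    rw [← hR]; ext u v; simp
  rw [this]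
  exact ContinuousLinearMap.IsInvertible.comp riesz₀_isInvertible hT

end LaxMilgram

section ENorms

/-- Operator norm `‖T‖_{X → Y} = sup {‖T x‖_Y : ‖x‖_X ≤ 1}` with respect to two
`[0,∞]`-valued norms; it is at most `C` exactly when `T` maps `{‖x‖_X < ∞}` to `{‖y‖_Y < ∞}` with
norm at most `C`. -/
def opENorm {X Y : Type*} (N : X → ℝ≥0∞) (M : Y → ℝ≥0∞) (T : X → Y) : ℝ≥0∞ :=
  ⨆ x : X, ⨆ _ : N x ≤ 1, M (T x)

/-- Dual norm of a functional with respect to a `[0,∞]`-valued norm. -/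
def dualENorm {X : Type*} (N : X → ℝ≥0∞) (φ : X → ℂ) : ℝ≥0∞ := opENorm N (fun a => ‖a‖ₑ) φ

/-- A normed space `Z ⊂ V`, given by the extended norm `‖·‖_Z : V → [0,∞]` with the convention
`‖v‖_Z = ∞` for `v ∉ Z`. -/
structure SubNorm (V : Type*) [AddCommGroup V] [Module ℂ V] where
  toFun : V → ℝ≥0∞
  eq_zero_iff' : ∀ v, toFun v = 0 ↔ v = 0
  smul' : ∀ (a : ℂ) v, toFun (a • v) = ‖a‖ₑ * toFun v
  add_le' : ∀ v w, toFun (v + w) ≤ toFun v + toFun w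

instance {V : Type*} [AddCommGroup V] [Module ℂ V] : CoeFun (SubNorm V) (fun _ => V → ℝ≥0∞) :=
  ⟨SubNorm.toFun⟩

/-- The underlying space `Z ⊂ V`. -/
def SubNorm.carrier {V : Type*} [AddCommGroup V] [Module ℂ V] (N : SubNorm V) :
    Submodule ℂ V where
  carrier := {v | N v < ∞}
  add_mem' := fun {v w} hv hw => lt_of_le_of_lt (N.add_le' v w) (ENNReal.add_lt_top.2 ⟨hv, hw⟩)
  zero_mem' := by simp [(N.eq_zero_iff' 0).2 rfl]
  smul_mem' := fun a v hv => by
    simp only [Set.mem_ofPred_eq, N.smul']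
    exact ENNReal.mul_lt_top (by simp) hv

end ENorms

/-- Hilbert spaces `H ⊂ V` (the inclusion is `incl`) with `H` dense in `V`, and `P = D - E` with
`D : H → H^*` and `E : V → V^*` bounded, `E` coercive on `V` with constant `cE`, `Ker D^* = Ker D`, and
`D` satisfying a Gårding inequality with constants `c₁` and `c₂`. The norms of the types `H` and `V` are
the original norms of the two spaces. -/
structure Setting (H V : Type*) [NormedAddCommGroup H] [InnerProductSpace ℂ H] [CompleteSpace H]
    [NormedAddCommGroup V] [InnerProductSpace ℂ V] [CompleteSpace V] (cE c₁ c₂ : ℝ) where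
  incl : H →L[ℂ] V
  incl_injective : Function.Injective incl
  incl_dense : DenseRange incl
  D : H →L[ℂ] AntiDual H
  E : V →L[ℂ] AntiDual V
  cE_pos : 0 < cE
  c₁_pos : 0 < c₁
  c₂_pos : 0 < c₂
  coercive : ∀ v, cE * ‖v‖ ^ 2 ≤ (E v v).re
  ker_adj : (sesqAdj D).ker = D.ker
  garding : ∀ v, c₁ * ‖v‖ ^ 2 - c₂ * ‖incl v‖ ^ 2 ≤ (D v v).re

namespace Setting

variable {H V : Type*} [NormedAddCommGroup H] [InnerProductSpace ℂ H] [CompleteSpace H]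
  [NormedAddCommGroup V] [InnerProductSpace ℂ V] [CompleteSpace V] {cE c₁ c₂ : ℝ}

/-- `‖v‖_V = √c₂ |||v|||_V`. -/
def normV (_F : Setting H V cE c₁ c₂) (v : V) : ℝ≥0∞ := ENNReal.ofReal (√c₂ * ‖v‖)

/-- The Riesz map `ι : V → V^*` of the scaled inner product `(u, v)_V` that induces `‖·‖_V`. -/
def ι (_F : Setting H V cE c₁ c₂) : V →L[ℂ] AntiDual V := (c₂ : ℂ) • riesz₀ V

variable (F : Setting H V cE c₁ c₂)

/-- The operator `P = D - E : H → H^*`, where `V^* ⊂ H^*` by restriction of functionals. -/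
def P : H →L[ℂ] AntiDual H := F.D - dualMap F.incl ∘L F.E ∘L F.incl

/-- The setting of `P^* = D^* - E^*`. -/
def adjoint : Setting H V cE c₁ c₂ where
  incl := F.incl
  incl_injective := F.incl_injective
  incl_dense := F.incl_dense
  D := sesqAdj F.D
  E := sesqAdj F.E
  cE_pos := F.cE_pos
  c₁_pos := F.c₁_pos
  c₂_pos := F.c₂_pos
  coercive := fun v => by simpa using F.coercive v
  ker_adj := by rw [sesqAdj_sesqAdj]; exact F.ker_adj.symm
  garding := fun v => by simpa using F.garding v

lemma adjoint_P : F.adjoint.P = sesqAdj F.P := by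
  ext u v
  simp [P, adjoint]

/-- `‖v‖_H ^ 2 = Re ⟨D v, v⟩ + c₂ |||v|||_V ^ 2`. -/
def normH (v : H) : ℝ≥0∞ := ENNReal.ofReal √((F.D v v).re + c₂ * ‖F.incl v‖ ^ 2)

/-- The inner product `(u, v)_H = ⟨(Re D) u, v⟩ + (u, v)_V` that induces `‖·‖_H`. -/
def innerH : H →L[ℂ] AntiDual H := rePart F.D + dualMap F.incl ∘L F.ι ∘L F.incl

/-- The operator `ι⁻¹ A : V → V` for `A : V → V^*`. -/
def ιInv (A : V →L[ℂ] AntiDual V) : V →L[ℂ] V := F.ι.inverse ∘L A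

/-- `Ker D` as a subspace of `V`. -/
def K : Submodule ℂ V := F.D.ker.map (F.incl : H →ₗ[ℂ] V)

lemma isClosed_K : IsClosed (F.K : Set V) := by
  have hb : ∀ v : F.D.ker, ‖v‖ ≤ √(c₂ / c₁) * ‖F.incl v‖ := by
    intro v
    have h0 : F.D (v : H) = 0 := v.2
    have h1 := F.garding v
    rw [h0] at h1
    have h2 : ‖(v : H)‖ ^ 2 ≤ c₂ / c₁ * ‖F.incl v‖ ^ 2 := by
      rw [div_mul_eq_mul_div, le_div_iff₀ F.c₁_pos]
      have h3 : ((0 : AntiDual H) (v : H)).re = 0 := by simp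
      rw [h3] at h1
      linarith
    have h4 := Real.sqrt_le_sqrt h2
    rwa [Real.sqrt_sq (norm_nonneg _), Real.sqrt_mul (div_pos F.c₂_pos F.c₁_pos).le,
      Real.sqrt_sq (norm_nonneg _)] at h4
  have hanti : AntilipschitzWith (Real.toNNReal √(c₂ / c₁)) (F.incl ∘L F.D.ker.subtypeL) := by
    refine ContinuousLinearMap.antilipschitz_of_bound _ fun v => ?_
    rw [Real.coe_toNNReal _ (Real.sqrt_nonneg _)]
    exact hb v
  have : CompleteSpace F.D.ker := F.D.isClosed_ker.completeSpace_coe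
  have h := hanti.isClosed_range (F.incl ∘L F.D.ker.subtypeL).uniformContinuous
  have hr : Set.range (F.incl ∘L F.D.ker.subtypeL) = (F.K : Set V) := by
    ext x
    simp [K]
  rwa [hr] at h

instance : CompleteSpace F.K := F.isClosed_K.completeSpace_coe

/-- The `V`-orthogonal projection `Π₀^V` onto `Ker D`. -/
def kerProj : V →L[ℂ] V := F.K.starProjection

/-- `E⁰⁰ = Π₀^V (ι⁻¹ E) Π₀^V` as an operator on `Ker D`. -/
def E00 : F.K →L[ℂ] F.K :=
  F.K.orthogonalProjectionOnto ∘L F.ιInv F.E ∘L F.K.subtypeL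

/-- `Π₀ = (E⁰⁰)⁻¹ Π₀^V ι⁻¹ E`, with values in `Ker D`. -/
def Pi0K : V →L[ℂ] F.K := F.E00.inverse ∘L F.K.orthogonalProjectionOnto ∘L F.ιInv F.E

/-- `Π₀ : V → V`. -/
def Pi0 : V →L[ℂ] V := F.K.subtypeL ∘L F.Pi0K

/-- `Π₁ = I - Π₀ : V → V`. -/
def Pi1 : V →L[ℂ] V := ContinuousLinearMap.id ℂ V - F.Pi0

/-- `Π₁ = I - Π₀` as a map `H → H`; recall that `Π₀` takes values in `Ker D ⊂ H`. -/
def Pi1H (u : H) : H :=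
  u - (F.D.ker.equivMapOfInjective (F.incl : H →ₗ[ℂ] V) F.incl_injective).symm
    (F.Pi0K (F.incl u))

lemma incl_Pi1H (u : H) : F.incl (F.Pi1H u) = F.Pi1 (F.incl u) := by
  have h := congrArg Subtype.val
    ((F.D.ker.equivMapOfInjective (F.incl : H →ₗ[ℂ] V) F.incl_injective).apply_symm_apply
      (F.Pi0K (F.incl u)))
  rw [Submodule.coe_equivMapOfInjective_apply] at h
  simp only [Pi1H, Pi1, Pi0, map_sub]
  exact congrArg (fun x => F.incl u - x) h

/-! The inverses in these definitions exist. -/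

lemma ι_isInvertible : F.ι.IsInvertible :=
  form_isInvertible_of_coercive _ F.c₂_pos fun v => by
    have h : F.ι v v = ((c₂ * ‖v‖ ^ 2 : ℝ) : ℂ) := by
      simp [ι, inner_self_eq_norm_sq_to_K]
    rw [h, Complex.ofReal_re]

lemma ι_ιInv (A : V →L[ℂ] AntiDual V) (u : V) : F.ι (F.ιInv A u) = A u := by
  obtain ⟨R, hR⟩ := F.ι_isInvertible
  rw [ιInv, ← hR]
  simp

lemma E00_isInvertible : F.E00.IsInvertible := by
  refine isInvertible_of_coercive _ (div_pos F.cE_pos F.c₂_pos) fun v => ?_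
  have h1 : inner ℂ v (F.E00 v) = inner ℂ (v : V) (F.ιInv F.E v) := by
    simp [E00]
  have h2 := congrArg (fun φ : AntiDual V => φ (v : V)) (F.ι_ιInv F.E v)
  have h3 : (c₂ : ℂ) * inner ℂ (v : V) (F.ιInv F.E v) = F.E v v := h2
  have h4 := F.coercive v
  rw [← h3, Complex.re_ofReal_mul] at h4
  rw [h1, div_mul_eq_mul_div, div_le_iff₀ F.c₂_pos, mul_comm _ c₂]
  exact h4

section Galerkin

variable (Hh : Submodule ℂ H)

/-- The orthogonal projection `Π_h : H → H_h` for the inner product `(·,·)_H`: the composition of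
`u ↦ (u, ·)_H` restricted to `H_h` and of the inverse of the Riesz map of `H_h`; see `projH_orth`. -/
def projH : H →L[ℂ] Hh :=
  (dualMap Hh.subtypeL ∘L F.innerH ∘L Hh.subtypeL).inverse ∘L dualMap Hh.subtypeL ∘L F.innerH

lemma innerH_self (v : H) : F.innerH v v = (((F.D v v).re + c₂ * ‖F.incl v‖ ^ 2 : ℝ) : ℂ) := by
  have h : (1 / 2 : ℂ) * (F.D v v + starRingEnd ℂ (F.D v v)) = ((F.D v v).re : ℂ) := by
    rw [Complex.add_conj]; push_cast; ring
  have h1 : F.innerH v v = (1 / 2 : ℂ) * (F.D v v + starRingEnd ℂ (F.D v v))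
      + (c₂ : ℂ) * inner ℂ (F.incl v) (F.incl v) := by
    simp [innerH, rePart, ι, mul_add]
  rw [h1, h, inner_self_eq_norm_sq_to_K]
  push_cast
  rfl

lemma projH_orth (hHh : IsClosed (Hh : Set H)) (u v : H) (hv : v ∈ Hh) :
    F.innerH (u - F.projH Hh u) v = 0 := by
  have : CompleteSpace Hh := hHh.completeSpace_coe
  have hinv : (dualMap Hh.subtypeL ∘L F.innerH ∘L Hh.subtypeL).IsInvertible :=
    form_isInvertible_of_coercive _ F.c₁_pos fun w => by
      have h1 : (dualMap Hh.subtypeL ∘L F.innerH ∘L Hh.subtypeL) w w = F.innerH (w : H) (w : H) := rfl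
      have h2 := F.garding w
      rw [h1, innerH_self, Complex.ofReal_re]
      change c₁ * ‖(w : H)‖ ^ 2 ≤ _
      linarith
  obtain ⟨R, hR⟩ := hinv
  have h3 : (R (F.projH Hh u)) = dualMap Hh.subtypeL (F.innerH u) := by
    rw [projH, ← hR]; simp
  have h4 : R (F.projH Hh u) = dualMap Hh.subtypeL (F.innerH (F.projH Hh u)) :=
    congrArg (fun T : Hh →L[ℂ] AntiDual Hh => T (F.projH Hh u)) hR
  have h5 := congrArg (fun φ : AntiDual Hh => φ ⟨v, hv⟩) (h3.symm.trans h4)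
  have h6 : F.innerH u v = F.innerH (F.projH Hh u) v := h5
  rw [map_sub, sub_apply, h6, sub_self]

/-- `u_h ∈ H_h` is a Galerkin approximation of `u`: `⟨P (u - u_h), v_h⟩ = 0` for all `v_h ∈ H_h`. -/
def IsGalerkin (u uh : H) : Prop := uh ∈ Hh ∧ ∀ vh ∈ Hh, F.P (u - uh) vh = 0

/-- `γ_dv(P)`, the supremum of `‖Π₀ w_h‖_V / ‖w_h‖_H` over the `w_h ∈ H_h` with
`⟨E w_h, v_h⟩ = 0` for all `v_h ∈ H_h ∩ Ker D`. (In `[0,∞]`, `0 / 0 = 0`.) -/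
def gammaDv : ℝ≥0∞ :=
  ⨆ w : H, ⨆ _ : w ∈ Hh ∧ ∀ v ∈ Hh ⊓ F.D.ker, F.E (F.incl w) (F.incl v) = 0,
    F.normV (F.Pi0 (F.incl w)) / F.normH w

/-- `‖I - Π_h‖_{Z → H}` for a space `Z ⊂ H`. -/
def projErr (Z : SubNorm V) : ℝ≥0∞ :=
  opENorm (fun v : H => Z (F.incl v)) F.normH (fun v => v - (F.projH Hh v : H))

end Galerkin

/-- `‖(P^*)⁻¹ Π₁^*‖_{V^* → V}`, where `Π₁` is the projection of `P`. -/
def solNorm : ℝ≥0∞ :=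
  opENorm (fun φ : AntiDual V => dualENorm F.normV φ) F.normV
    (fun φ => F.incl (F.adjoint.P.inverse (dualMap F.incl (dualMap F.Pi1 φ))))

/-- `‖P‖_{H → H^*}`. -/
def normP : ℝ≥0∞ := opENorm F.normH (fun φ : AntiDual H => dualENorm F.normH φ) F.P

/-- `‖E‖_{V → V^*}`. -/
def normE : ℝ≥0∞ := opENorm F.normV (fun φ : AntiDual V => dualENorm F.normV φ) F.E

/-- The abstract regularity assumptions on `P` with spaces `Z 0 = V`, `Z 1 = H`, `Z 2`, …, `Z (m + 1)`
and constant `C`. The bounds are between extended norms, so that each of them includes the assertion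
that the quantity on its left is in the space in question if its right-hand side is finite. -/
structure Regularity (m : ℕ) (Z : ℕ → SubNorm V) (C : ℝ) : Prop where
  zero : ∀ v, Z 0 v = F.normV v
  one : ∀ v, Z 1 (F.incl v) = F.normH v
  one_top : ∀ v, v ∉ Set.range F.incl → Z 1 v = ∞
  /-- `Z (j + 1) ⊂ Z j`, continuously. -/
  nested : ∀ j, 1 ≤ j → j ≤ m → ∀ v, Z j v ≤ ENNReal.ofReal C * Z (j + 1) v
  /-- `V` is dense in the (anti)dual space of `Z j`, where `v ∈ V` acts as `ι v`. -/
  dense : ∀ j, 1 ≤ j → j ≤ m + 1 → ∀ φ : (Z j).carrier →ₗ⋆[ℂ] ℂ,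
    dualENorm (fun z : (Z j).carrier => Z j z) φ < ∞ → ∀ ε : ℝ≥0∞, 0 < ε →
      ∃ v : V, dualENorm (fun z : (Z j).carrier => Z j z) (fun z => φ z - F.ι v z) < ε
  proj_reg : ∀ j, 1 ≤ j → j ≤ m + 1 → opENorm (Z j) (Z j) F.kerProj ≤ ENNReal.ofReal C
  ell_reg : ∀ A ∈ ({F.D, sesqAdj F.D, rePart F.D} : Set (H →L[ℂ] AntiDual H)),
    ∀ j, 2 ≤ j → j ≤ m + 1 → ∀ u : H,
      Z j (F.Pi1 (F.incl u)) ≤ ENNReal.ofReal C * (F.normV (F.Pi1 (F.incl u)) +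
        ⨆ v : H, ⨆ _ : dualENorm (Z (j - 2)) (F.ι (F.incl v)) = 1, ‖A (F.Pi1H u) (F.Pi1H v)‖ₑ)
  E_reg : ∀ A ∈ ({F.E, sesqAdj F.E, rePart F.E} : Set (V →L[ℂ] AntiDual V)),
    ∀ j, 1 ≤ j → j ≤ m + 1 → opENorm (Z j) (Z j) (F.ιInv A) ≤ ENNReal.ofReal C
  E00_reg : ∀ A ∈ ({F.E, sesqAdj F.E} : Set (V →L[ℂ] AntiDual V)),
    ∀ j, 1 ≤ j → j ≤ m + 1 → ∀ u : V,
      Z j (F.kerProj u) ≤ ENNReal.ofReal C *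
        (Z j (F.kerProj (F.ιInv A (F.kerProj u))) + F.normV (F.kerProj u))

end Setting

end

end AbsGalerkin

/-!
The proof is an elliptic-projection (Schatz) argument in which the infinite-dimensional kernel of `D` is
split off by `Π₀` and `Π₁ = 1 - Π₀`.

All norms are normalised to `nH` and `nV`, and one constant `B ≥ 1` bounds `E`, `P` and the embedding
`H ⊂ V`. The embedding bound is not a hypothesis: it follows from `Re D ≥ Re P` and the identity
`‖v‖_H² = Re ⟨D v, v⟩ + ‖v‖_V²` (`bounds_of_norm_le`).

*Smoothing operator.* Let `R` be the resolvent of `Re D`, that is `(R f, v)_H = (f, v)_V`, restricted to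
the `V`-orthogonal complement of `Ker D`. A multiple `S` of `R ^ (m + 1)` is self-adjoint, vanishes on
`Ker D`, and maps `V` into `Z (m + 1)` by elliptic regularity. Logarithmic convexity of
`j ↦ ‖R ^ j w‖_V` shows that `‖S w‖_V²` compensates any fixed multiple of `‖w‖_V²` up to `‖w‖_H²`, so
that no functional calculus is needed (`smoothStep_pow_coercive`, `Regularity.exists_smoother`). Hence
the regularised operator `P + S^* ι S` is coercive on `Ran Π₁` (`Smoother.energy`), while on `Ker D` it
equals `-E`.

*Discrete stability.* On `H_h`, subtracting from `w` its projections `q` and `q'` onto `H_h ∩ Ker D` for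
the form of `E` in its two arguments gives a test function `w - q' - q` for which the regularised form is
coercive, with a constant that does not depend on `H_h`, provided that `γ_dv` is small
(`Smoother.discrete_coercive`). So the regularised Galerkin problem is well posed, and `H_h = H` gives
the well-posedness of the regularised equation itself.

*Duality.* For a Galerkin error `e` one has `‖e‖_H ≲ ‖(1 - Π_h) u‖_H + ‖S e‖_V`
(`Smoother.nH_error_le`). The term `‖S e‖_V` is tested against the solution `z` of `P^* z = ι S² e`, for
which `‖z‖_{Z (m + 1)} ≲ (1 + ρ) ‖S e‖_V`; if `z_h` is the Galerkin projection of `z` for the adjoint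
regularised operator, then `‖S e‖_V² = ⟨(P + S^* ι S) (1 - Π_h) u, z - z_h⟩ - (S e, S (z - z_h))_V`. A second
duality argument, for the regularised operator, whose inverse is bounded by a constant, gains a factor
`δ` in the last term (`Smoother.elliptic_duality`), which is absorbed if `δ² (1 + ρ)` is small
(`Smoother.duality`). This is quasi-optimality, first for any Galerkin solution. It bounds the discrete
operator from below, and since `ρ` is the same for `P` and `P^*` (`SolBound.adjoint`) it also shows that
the discrete adjoint is injective; together these give existence (`Smoother.exists_galerkin`).

*Oscillatory data.* Elliptic regularity for `P u = f` bounds `‖u‖_{Z (m + 1)}` by `‖u‖_H` if `f` is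
oscillatory (`Regularity.Z_osc_le`); in the estimate of `Π₀ u` only the action of `f` on `Ker D`
matters, which is why the relaxed oscillation condition suffices.
-/

/-! ### Forms, norms, and the projections of the setting -/

namespace AbsGalerkin

section Forms

variable {X : Type*} [NormedAddCommGroup X] [NormedSpace ℂ X]

lemma form_add_left (A : X →L[ℂ] AntiDual X) (u v w : X) : A (u + v) w = A u w + A v w := by
  rw [map_add]; rfl

lemma form_sub_left (A : X →L[ℂ] AntiDual X) (u v w : X) : A (u - v) w = A u w - A v w := by
  rw [map_sub]; rfl

lemma form_smul_left (A : X →L[ℂ] AntiDual X) (c : ℂ) (u v : X) : A (c • u) v = c * A u v := by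
  rw [map_smul]; rfl

/-- Cauchy--Schwarz for a positive semidefinite Hermitian form. -/
lemma norm_form_sq_le (A : X →L[ℂ] AntiDual X) (hsymm : ∀ u v, starRingEnd ℂ (A u v) = A v u)
    (hpos : ∀ v, 0 ≤ (A v v).re) (u v : X) : ‖A u v‖ ^ 2 ≤ (A u u).re * (A v v).re := by
  let c : PreInnerProductSpace.Core ℂ X :=
    { inner := fun x y => A y x
      conj_inner_symm := fun x y => hsymm x y
      re_inner_nonneg := fun x => hpos x
      add_left := fun x y z => by simp
      smul_left := fun x y r => by simp }
  have h := @InnerProductSpace.Core.inner_mul_inner_self_le ℂ X _ _ _ c v u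
  change ‖A u v‖ * ‖A v u‖ ≤ (A v v).re * (A u u).re at h
  rw [← hsymm u v, RCLike.norm_conj] at h
  nlinarith

/-- A bound for a form with respect to a norm `N`, from the bound of the associated operator between
`(X, N)` and its dual space. -/
lemma norm_form_le_of_opENorm_le {N : X → ℝ} (hN : ∀ (c : ℂ) v, N (c • v) = ‖c‖ * N v)
    (h0 : ∀ v, N v = 0 → v = 0) (hpos : ∀ v, 0 ≤ N v) {A : X →L[ℂ] AntiDual X} {M : ℝ} (hM : 0 ≤ M)
    (h : opENorm (fun v => ENNReal.ofReal (N v))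
      (fun φ : AntiDual X => dualENorm (fun v => ENNReal.ofReal (N v)) φ) A ≤ ENNReal.ofReal M)
    (u v : X) : ‖A u v‖ ≤ M * N u * N v := by
  have key : ∀ u v, N u ≤ 1 → N v ≤ 1 → ‖A u v‖ ≤ M := by
    intro u v hu hv
    have h1 : ‖A u v‖ₑ ≤ ENNReal.ofReal M := by
      refine le_trans ?_ h
      unfold opENorm
      refine le_iSup₂_of_le u (ENNReal.ofReal_le_one.2 hu) ?_
      unfold dualENorm opENorm
      exact le_iSup₂_of_le v (ENNReal.ofReal_le_one.2 hv) le_rfl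
    rw [← ofReal_norm] at h1
    exact (ENNReal.ofReal_le_ofReal_iff hM).1 h1
  rcases (hpos u).eq_or_lt with hu | hu
  · rw [h0 u hu.symm]; simp; have := hpos 0; have := hpos v; positivity
  rcases (hpos v).eq_or_lt with hv | hv
  · rw [h0 v hv.symm]; simp; have := hpos 0; positivity
  have h2 := key (((N u)⁻¹ : ℝ) • u) (((N v)⁻¹ : ℝ) • v)
  simp only [← Complex.coe_smul, hN, map_smul, ContinuousLinearMap.map_smulₛₗ, smul_apply,
    norm_smul, Complex.norm_real, Real.norm_eq_abs, RCLike.norm_conj,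
    abs_of_pos (inv_pos.2 hu), abs_of_pos (inv_pos.2 hv)] at h2
  have h3 := h2 (inv_mul_cancel₀ hu.ne').le (inv_mul_cancel₀ hv.ne').le
  have h4 : (N v)⁻¹ * ((N u)⁻¹ * ‖A u v‖) = ‖A u v‖ / (N u * N v) := by
    field_simp
  have h5 : ‖A u v‖ / (N u * N v) ≤ M := by
    rw [← h4]
    first
      | exact h3
      | linarith [mul_left_comm (N v)⁻¹ (N u)⁻¹ ‖A u v‖]
  rw [div_le_iff₀ (by positivity)] at h5
  linarith

end Forms

/-- A form that is bounded below and whose adjoint is injective defines a surjective operator. -/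
lemma form_surjective {X : Type*} [NormedAddCommGroup X] [InnerProductSpace ℂ X] [CompleteSpace X]
    (A : X →L[ℂ] AntiDual X) {c : ℝ} (hc : 0 < c) (h : ∀ v, c * ‖v‖ ≤ ‖A v‖)
    (hadj : ∀ v, (∀ w, A w v = 0) → v = 0) (φ : AntiDual X) : ∃ v, A v = φ := by
  obtain ⟨R, hR⟩ := riesz₀_isInvertible (X := X)
  have hRi : ∀ v φ, inner ℂ v (R.symm φ) = φ v := fun v φ => by
    have h1 : riesz₀ X (R.symm φ) v = φ v := by
      rw [← hR]; exact congrArg (fun ψ : AntiDual X => ψ v) (R.apply_symm_apply φ)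
    exact h1
  have hanti : AntilipschitzWith (Real.toNNReal c⁻¹) A := by
    refine ContinuousLinearMap.antilipschitz_of_bound A fun v => ?_
    rw [Real.coe_toNNReal _ (inv_nonneg.2 hc.le), ← div_eq_inv_mul, le_div_iff₀ hc, mul_comm]
    exact h v
  let T : X →L[ℂ] X := (R.symm : AntiDual X →L[ℂ] X) ∘L A
  have hclosed : IsClosed (T.range : Set X) := by
    have h1 := hanti.isClosed_range A.uniformContinuous
    have h2 : (T.range : Set X) = R.symm.toHomeomorph '' Set.range A := by
      ext x; simp [T]
    rw [h2]
    exact R.symm.toHomeomorph.isClosedMap _ h1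
  have hrange : T.range = ⊤ := by
    have : CompleteSpace T.range := hclosed.completeSpace_coe
    rw [← Submodule.orthogonal_eq_bot_iff, Submodule.eq_bot_iff]
    intro w hw
    refine hadj w fun x => ?_
    have h0 : inner ℂ (T x) w = (0 : ℂ) := (Submodule.mem_orthogonal _ _).1 hw _ ⟨x, rfl⟩
    rw [← hRi, ← inner_conj_symm]
    change starRingEnd ℂ (inner ℂ (T x) w) = 0
    rw [h0, map_zero]
  obtain ⟨v, hv⟩ := (LinearMap.range_eq_top.1 hrange) (R.symm φ)
  exact ⟨v, R.symm.injective hv⟩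

namespace Setting

noncomputable section

variable {H : Type u} {V : Type v} [NormedAddCommGroup H] [InnerProductSpace ℂ H] [CompleteSpace H]
  [NormedAddCommGroup V] [InnerProductSpace ℂ V] [CompleteSpace V] {cE c₁ c₂ : ℝ}

/-- The real-valued version of the norm `normV`. -/
def nV (_F : Setting H V cE c₁ c₂) (v : V) : ℝ := √c₂ * ‖v‖

/-- The real-valued version of the norm `normH`. -/
def nH (F : Setting H V cE c₁ c₂) (v : H) : ℝ := √((F.D v v).re + c₂ * ‖F.incl v‖ ^ 2)

variable (F : Setting H V cE c₁ c₂)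

lemma normV_eq (v : V) : F.normV v = ENNReal.ofReal (F.nV v) := rfl

lemma normH_eq (v : H) : F.normH v = ENNReal.ofReal (F.nH v) := rfl

lemma nV_nonneg (v : V) : 0 ≤ F.nV v := by unfold nV; positivity

lemma nH_nonneg (v : H) : 0 ≤ F.nH v := Real.sqrt_nonneg _

lemma nV_sq (v : V) : F.nV v ^ 2 = c₂ * ‖v‖ ^ 2 := by
  rw [nV, mul_pow, Real.sq_sqrt F.c₂_pos.le]

lemma c₁_norm_sq_le (v : H) : c₁ * ‖v‖ ^ 2 ≤ (F.D v v).re + c₂ * ‖F.incl v‖ ^ 2 := by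
  linarith [F.garding v]

lemma nH_sq (v : H) : F.nH v ^ 2 = (F.D v v).re + F.nV (F.incl v) ^ 2 := by
  rw [nV_sq, nH, Real.sq_sqrt]
  have := F.c₁_norm_sq_le v
  have := F.c₁_pos
  nlinarith [sq_nonneg ‖v‖]

lemma c₁_norm_sq_le_nH_sq (v : H) : c₁ * ‖v‖ ^ 2 ≤ F.nH v ^ 2 := by
  rw [nH_sq, nV_sq]; exact F.c₁_norm_sq_le v

lemma eq_zero_of_nH (v : H) (h : F.nH v = 0) : v = 0 := by
  have h1 := F.c₁_norm_sq_le_nH_sq v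
  rw [h] at h1
  have := F.c₁_pos
  have h2 : ‖v‖ ^ 2 ≤ 0 := by
    by_contra! hh
    nlinarith
  simpa using le_antisymm h2 (sq_nonneg _)

lemma eq_zero_of_nV (v : V) (h : F.nV v = 0) : v = 0 := by
  have h1 := F.nV_sq v
  rw [h] at h1
  have := F.c₂_pos
  have h2 : ‖v‖ ^ 2 ≤ 0 := by
    by_contra! hh
    nlinarith
  simpa using le_antisymm h2 (sq_nonneg _)

lemma nV_smul (c : ℂ) (v : V) : F.nV (c • v) = ‖c‖ * F.nV v := by
  rw [nV, norm_smul, nV]; ring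

lemma nV_add_le (v w : V) : F.nV (v + w) ≤ F.nV v + F.nV w := by
  rw [nV, nV, nV, ← mul_add]
  exact mul_le_mul_of_nonneg_left (norm_add_le v w) (Real.sqrt_nonneg _)

lemma nV_sub_le (v w : V) : F.nV (v - w) ≤ F.nV v + F.nV w := by
  rw [nV, nV, nV, ← mul_add]
  exact mul_le_mul_of_nonneg_left (norm_sub_le v w) (Real.sqrt_nonneg _)

@[simp] lemma nV_zero : F.nV 0 = 0 := by simp [nV]

lemma ι_apply (v w : V) : F.ι v w = c₂ * inner ℂ w v := rfl

lemma ι_self (v : V) : F.ι v v = ((F.nV v ^ 2 : ℝ) : ℂ) := by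
  rw [nV_sq, ι_apply, inner_self_eq_norm_sq_to_K]; push_cast; rfl

lemma ι_conj (v w : V) : starRingEnd ℂ (F.ι v w) = F.ι w v := by
  simp [ι_apply]

lemma norm_ι_le (v w : V) : ‖F.ι v w‖ ≤ F.nV v * F.nV w := by
  have h := norm_inner_le_norm (𝕜 := ℂ) w v
  have h2 : √c₂ * √c₂ = c₂ := Real.mul_self_sqrt F.c₂_pos.le
  rw [ι_apply, norm_mul, Complex.norm_real, Real.norm_eq_abs, abs_of_pos F.c₂_pos, nV, nV]
  calc c₂ * ‖inner ℂ w v‖ ≤ c₂ * (‖w‖ * ‖v‖) := mul_le_mul_of_nonneg_left h F.c₂_pos.le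
    _ = (√c₂ * √c₂) * (‖w‖ * ‖v‖) := by rw [h2]
    _ = _ := by ring

lemma innerH_apply (u v : H) :
    F.innerH u v = rePart F.D u v + F.ι (F.incl u) (F.incl v) := rfl

lemma rePart_apply {X : Type*} [NormedAddCommGroup X] [NormedSpace ℂ X] (A : X →L[ℂ] AntiDual X)
    (u v : X) : rePart A u v = (1 / 2 : ℂ) * (A u v + starRingEnd ℂ (A v u)) := rfl

lemma innerH_conj (u v : H) : starRingEnd ℂ (F.innerH u v) = F.innerH v u := by
  rw [innerH_apply, innerH_apply, map_add, ι_conj, rePart_apply, rePart_apply]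
  have h2 : (starRingEnd ℂ) 2 = 2 := Complex.conj_ofNat 2
  simp [add_comm, h2]

lemma innerH_self_eq (v : H) : F.innerH v v = ((F.nH v ^ 2 : ℝ) : ℂ) := by
  rw [innerH_self, nH_sq, nV_sq]

lemma norm_innerH_le (u v : H) : ‖F.innerH u v‖ ≤ F.nH u * F.nH v := by
  have h := norm_form_sq_le F.innerH F.innerH_conj
    (fun v => by rw [innerH_self_eq, Complex.ofReal_re]; positivity) u v
  rw [innerH_self_eq, innerH_self_eq, Complex.ofReal_re, Complex.ofReal_re, ← mul_pow] at h
  exact (sq_le_sq₀ (norm_nonneg _) (mul_nonneg (F.nH_nonneg u) (F.nH_nonneg v))).1 h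

lemma nH_smul (c : ℂ) (v : H) : F.nH (c • v) = ‖c‖ * F.nH v := by
  have h : F.nH (c • v) ^ 2 = (‖c‖ * F.nH v) ^ 2 := by
    have h1 : ((F.nH (c • v) ^ 2 : ℝ) : ℂ) = (((‖c‖ * F.nH v) ^ 2 : ℝ) : ℂ) := by
      rw [← innerH_self_eq, form_smul_left, ContinuousLinearMap.map_smulₛₗ, innerH_self_eq,
        smul_eq_mul, ← mul_assoc, Complex.mul_conj, Complex.normSq_eq_norm_sq]
      push_cast; ring
    exact_mod_cast h1
  exact (sq_eq_sq₀ (F.nH_nonneg _) (mul_nonneg (norm_nonneg _) (F.nH_nonneg v))).1 h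

@[simp] lemma nH_zero : F.nH 0 = 0 := by simp [nH]

@[simp] lemma nH_neg (v : H) : F.nH (-v) = F.nH v := by simp [nH]

lemma nH_add_le (u v : H) : F.nH (u + v) ≤ F.nH u + F.nH v := by
  have h : F.nH (u + v) ^ 2 = F.nH u ^ 2 + 2 * (F.innerH u v).re + F.nH v ^ 2 := by
    have h1 := congrArg Complex.re (F.innerH_self_eq (u + v))
    rw [map_add, map_add, add_apply, add_apply, innerH_self_eq, innerH_self_eq,
      ← F.innerH_conj u v] at h1
    simp only [Complex.add_re, Complex.ofReal_re, Complex.conj_re] at h1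
    linarith
  have h2 := (Complex.re_le_norm _).trans (F.norm_innerH_le u v)
  have := F.nH_nonneg u
  have := F.nH_nonneg v
  exact (sq_le_sq₀ (F.nH_nonneg _) (by positivity)).1 (by nlinarith)

lemma nH_sub_le (u v : H) : F.nH (u - v) ≤ F.nH u + F.nH v := by
  rw [sub_eq_add_neg]; simpa using F.nH_add_le u (-v)

/-- `‖·‖_H` is dominated by the original norm of `H` (with a constant that is not controlled). -/
lemma exists_nH_le : ∃ c : ℝ, 0 < c ∧ ∀ v, F.nH v ≤ c * ‖v‖ := by
  refine ⟨√(‖F.innerH‖ + 1), by positivity, fun v => ?_⟩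
  have h1 : F.nH v ^ 2 ≤ (‖F.innerH‖ + 1) * ‖v‖ ^ 2 := by
    have h := F.innerH.le_opNorm₂ v v
    rw [innerH_self_eq, Complex.norm_real, Real.norm_eq_abs] at h
    nlinarith [le_abs_self (F.nH v ^ 2), sq_nonneg ‖v‖]
  refine (sq_le_sq₀ (F.nH_nonneg _) (by positivity)).1 ?_
  rw [mul_pow, Real.sq_sqrt (by positivity)]
  exact h1

lemma norm_le_nH (v : H) : √c₁ * ‖v‖ ≤ F.nH v := by
  refine (sq_le_sq₀ (by positivity) (F.nH_nonneg _)).1 ?_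
  rw [mul_pow, Real.sq_sqrt F.c₁_pos.le]
  exact F.c₁_norm_sq_le_nH_sq v

/-! The kernel of `D` and the projections `Π₀`, `Π₁`. -/

lemma D_adj_ker {k : H} (hk : F.D k = 0) (u : H) : F.D u k = 0 := by
  have h : k ∈ (sesqAdj F.D).ker := by rw [F.ker_adj]; exact hk
  have h1 : sesqAdj F.D k = 0 := h
  have h2 := congrArg (fun φ : AntiDual H => starRingEnd ℂ (φ u)) h1
  simpa using h2

lemma mem_K {x : V} : x ∈ F.K ↔ ∃ k : H, F.D k = 0 ∧ F.incl k = x := by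
  simp [K]

lemma incl_mem_K {k : H} (hk : F.D k = 0) : F.incl k ∈ F.K := F.mem_K.2 ⟨k, hk, rfl⟩

lemma nH_ker {k : H} (hk : F.D k = 0) : F.nH k = F.nV (F.incl k) := by
  have h := F.nH_sq k
  rw [hk] at h
  simp only [zero_apply, Complex.zero_re, zero_add] at h
  exact (sq_eq_sq₀ (F.nH_nonneg _) (F.nV_nonneg _)).1 h

lemma kerProj_mem (v : V) : F.kerProj v ∈ F.K := F.K.starProjection_apply_mem v

lemma kerProj_of_mem {v : V} (hv : v ∈ F.K) : F.kerProj v = v :=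
  Submodule.starProjection_eq_self_iff.2 hv

lemma ι_sub_kerProj (v : V) {k : V} (hk : k ∈ F.K) : F.ι (v - F.kerProj v) k = 0 := by
  have h := F.K.starProjection_inner_eq_zero v k hk
  rw [ι_apply, ← inner_conj_symm]
  erw [h]; simp

lemma eq_kerProj {v w : V} (hw : w ∈ F.K) (h : ∀ k ∈ F.K, F.ι (v - w) k = 0) :
    F.kerProj v = w := by
  refine Submodule.eq_starProjection_of_mem_of_inner_eq_zero hw fun k hk => ?_
  have h1 := h k hk
  rw [ι_apply] at h1
  have h2 : (inner ℂ k (v - w) : ℂ) = 0 := by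
    rcases mul_eq_zero.1 h1 with h3 | h3
    · exact absurd (by exact_mod_cast h3) F.c₂_pos.ne'
    · exact h3
  rw [← inner_conj_symm, h2, map_zero]

lemma kerProj_eq_zero {v : V} (h : ∀ k ∈ F.K, F.ι v k = 0) : F.kerProj v = 0 :=
  F.eq_kerProj F.K.zero_mem (by simpa using h)

lemma nV_kerProj_le (v : V) : F.nV (F.kerProj v) ≤ F.nV v :=
  mul_le_mul_of_nonneg_left (F.K.norm_starProjection_apply_le v) (Real.sqrt_nonneg _)

lemma nV_sub_kerProj_le (v : V) : F.nV (v - F.kerProj v) ≤ F.nV v := by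
  have h := F.norm_ι_le (v - F.kerProj v) v
  have h1 : F.ι (v - F.kerProj v) v = ((F.nV (v - F.kerProj v) ^ 2 : ℝ) : ℂ) := by
    rw [← ι_self, map_sub (F.ι (v - F.kerProj v)), F.ι_sub_kerProj v (F.kerProj_mem v), sub_zero]
  rw [h1, Complex.norm_real, Real.norm_eq_abs, abs_of_nonneg (sq_nonneg _)] at h
  have := F.nV_nonneg (v - F.kerProj v)
  have := F.nV_nonneg v
  nlinarith

lemma Pi0_mem (v : V) : F.Pi0 v ∈ F.K := (F.Pi0K v).2

/-- `Π₀` is the projection onto `Ker D` for the form of `E`. -/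
lemma E_Pi0 (v : V) {k : V} (hk : k ∈ F.K) : F.E (F.Pi0 v) k = F.E v k := by
  have h1 : F.E00 (F.Pi0K v) = F.K.orthogonalProjectionOnto (F.ιInv F.E v) := by
    have hi := F.E00_isInvertible
    unfold Pi0K
    generalize F.E00 = T at hi ⊢
    obtain ⟨R, rfl⟩ := hi
    simp
  have h2 : F.kerProj (F.ιInv F.E (F.Pi0 v)) = F.kerProj (F.ιInv F.E v) := congrArg Subtype.val h1
  rw [← F.ι_ιInv F.E (F.Pi0 v), ← F.ι_ιInv F.E v]
  have h3 := F.ι_sub_kerProj (F.ιInv F.E (F.Pi0 v)) hk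
  have h4 := F.ι_sub_kerProj (F.ιInv F.E v) hk
  rw [form_sub_left, sub_eq_zero] at h3 h4
  rw [h3, h4, h2]

lemma eq_Pi0 {v w : V} (hw : w ∈ F.K) (h : ∀ k ∈ F.K, F.E w k = F.E v k) : F.Pi0 v = w := by
  have hm : F.Pi0 v - w ∈ F.K := F.K.sub_mem (F.Pi0_mem v) hw
  have h1 : F.E (F.Pi0 v - w) (F.Pi0 v - w) = 0 := by
    rw [form_sub_left, F.E_Pi0 v hm, h _ hm, sub_self]
  have h2 := F.coercive (F.Pi0 v - w)
  rw [h1, Complex.zero_re] at h2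
  have h3 : ‖F.Pi0 v - w‖ ^ 2 ≤ 0 := by
    have := F.cE_pos
    by_contra! hh
    nlinarith
  exact sub_eq_zero.1 (by simpa using le_antisymm h3 (sq_nonneg _))

lemma Pi0_of_mem {v : V} (hv : v ∈ F.K) : F.Pi0 v = v := F.eq_Pi0 hv fun _ _ => rfl

lemma Pi1_apply (v : V) : F.Pi1 v = v - F.Pi0 v := rfl

lemma E_Pi1 (v : V) {k : V} (hk : k ∈ F.K) : F.E (F.Pi1 v) k = 0 := by
  rw [Pi1_apply, form_sub_left, F.E_Pi0 v hk, sub_self]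

/-- `Π₀ u` as an element of `H`. -/
def Pi0H (u : H) : H := u - F.Pi1H u

lemma incl_Pi0H (u : H) : F.incl (F.Pi0H u) = F.Pi0 (F.incl u) := by
  rw [Pi0H, map_sub, incl_Pi1H, Pi1_apply, sub_sub_cancel]

lemma D_Pi0H (u : H) : F.D (F.Pi0H u) = 0 := by
  obtain ⟨k, hk, h⟩ := F.mem_K.1 (F.Pi0_mem (F.incl u))
  rw [← incl_Pi0H] at h
  rw [← F.incl_injective h, hk]

lemma Pi1H_eq (u : H) : F.Pi1H u = u - F.Pi0H u := by rw [Pi0H, sub_sub_cancel]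

lemma D_Pi1H (u v : H) : F.D (F.Pi1H u) v = F.D u v := by
  rw [Pi1H_eq, map_sub, D_Pi0H, sub_zero]

lemma D_Pi1H_right (u v : H) : F.D u (F.Pi1H v) = F.D u v := by
  rw [Pi1H_eq, map_sub, F.D_adj_ker (F.D_Pi0H v), sub_zero]

lemma P_apply (u v : H) : F.P u v = F.D u v - F.E (F.incl u) (F.incl v) := rfl

/-! Passing to the adjoint. -/

lemma adjoint_adjoint : F.adjoint.adjoint = F := by
  cases F; simp [adjoint, sesqAdj_sesqAdj]

lemma adjoint_nV : F.adjoint.nV = F.nV := rfl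

lemma adjoint_nH : F.adjoint.nH = F.nH := by
  funext v; simp [nH, adjoint]

lemma adjoint_incl : F.adjoint.incl = F.incl := rfl

lemma adjoint_E_apply (u v : V) : F.adjoint.E u v = starRingEnd ℂ (F.E v u) := rfl

lemma adjoint_D_apply (u v : H) : F.adjoint.D u v = starRingEnd ℂ (F.D v u) := rfl

lemma adjoint_P_apply (u v : H) : F.adjoint.P u v = starRingEnd ℂ (F.P v u) := by
  rw [adjoint_P]; rfl

lemma adjoint_D_eq_zero {k : H} : F.adjoint.D k = 0 ↔ F.D k = 0 := by
  have h : k ∈ (sesqAdj F.D).ker ↔ k ∈ F.D.ker := by rw [F.ker_adj]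
  exact h

lemma adjoint_K : F.adjoint.K = F.K := by
  ext x
  rw [mem_K, mem_K]
  simp only [adjoint_D_eq_zero]
  rfl

lemma adjoint_kerProj : F.adjoint.kerProj = F.kerProj := by
  ext v
  exact F.adjoint.eq_kerProj (by rw [adjoint_K]; exact F.kerProj_mem v) fun k hk =>
    F.ι_sub_kerProj v (by rwa [adjoint_K] at hk)

end

end Setting

end AbsGalerkin

/-! ### Regularity of solutions -/

namespace AbsGalerkin

section ENorms

/-- A homogeneous map is bounded by its operator norm; the points of norm `0` and `∞`, where the
inequality does not follow by scaling, are excluded by hypotheses. -/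
lemma le_opENorm_mul {X Y : Type*} [AddCommGroup X] [Module ℂ X] {N : X → ℝ≥0∞} {M : Y → ℝ≥0∞}
    {T : X → Y} (hN : ∀ (a : ℂ) x, N (a • x) = ‖a‖ₑ * N x)
    (hM : ∀ (a : ℂ) x, M (T (a • x)) = ‖a‖ₑ * M (T x)) {x : X} (h0 : N x = 0 → M (T x) = 0)
    (htop : N x ≠ ∞) : M (T x) ≤ opENorm N M T * N x := by
  rcases eq_or_ne (N x) 0 with hx | hx
  · rw [h0 hx]; exact zero_le
  have ha : ‖(((N x).toReal⁻¹ : ℝ) : ℂ)‖ₑ = (N x)⁻¹ := by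
    rw [← ofReal_norm, Complex.norm_real, Real.norm_eq_abs,
      abs_of_nonneg (inv_nonneg.2 ENNReal.toReal_nonneg),
      ENNReal.ofReal_inv_of_pos (ENNReal.toReal_pos hx htop), ENNReal.ofReal_toReal htop]
  have h1 : M (T ((((N x).toReal⁻¹ : ℝ) : ℂ) • x)) ≤ opENorm N M T := by
    unfold opENorm
    refine le_iSup₂_of_le _ ?_ le_rfl
    rw [hN, ha, ENNReal.inv_mul_cancel hx htop]
  rw [hM, ha] at h1
  calc M (T x) = N x * ((N x)⁻¹ * M (T x)) := by
        rw [← mul_assoc, ENNReal.mul_inv_cancel hx htop, one_mul]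
    _ ≤ N x * opENorm N M T := by gcongr
    _ = _ := mul_comm _ _

variable {V : Type*} [AddCommGroup V] [Module ℂ V]

@[simp] lemma SubNorm.map_zero (N : SubNorm V) : N 0 = 0 := (N.eq_zero_iff' 0).2 rfl

lemma SubNorm.map_neg (N : SubNorm V) (v : V) : N (-v) = N v := by
  have h := N.smul' (-1) v
  simpa using h

lemma SubNorm.sub_le (N : SubNorm V) (v w : V) : N (v - w) ≤ N v + N w := by
  rw [sub_eq_add_neg]
  exact (N.add_le' _ _).trans (by rw [N.map_neg])

lemma SubNorm.le_of_opENorm_le {N M : SubNorm V} {T : V →ₗ[ℂ] V} {C : ℝ} (hC : 0 < C)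
    (h : opENorm N M T ≤ ENNReal.ofReal C) (v : V) : M (T v) ≤ ENNReal.ofReal C * N v := by
  rcases eq_or_ne (N v) ∞ with hv | hv
  · rw [hv, ENNReal.mul_top (by simpa using hC)]; exact le_top
  refine (le_opENorm_mul (M := M) (T := T) N.smul' (fun a x => ?_) (fun h0 => ?_) hv).trans ?_
  · rw [_root_.map_smul, M.smul']
  · rw [(N.eq_zero_iff' v).1 h0]; simp
  · gcongr

end ENorms

namespace Setting

noncomputable section

variable {H : Type u} {V : Type v} [NormedAddCommGroup H] [InnerProductSpace ℂ H] [CompleteSpace H]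
  [NormedAddCommGroup V] [InnerProductSpace ℂ V] [CompleteSpace V] {cE c₁ c₂ : ℝ}

/-- All the bounds on `E`, `P` and the embedding `H ⊂ V`, with one constant `B ≥ 1`. -/
structure Bounds (F : Setting H V cE c₁ c₂) (B : ℝ) : Prop where
  one_le : 1 ≤ B
  nV_le : ∀ v, F.nV (F.incl v) ≤ B * F.nH v
  E_le : ∀ u v, ‖F.E u v‖ ≤ B * F.nV u * F.nV v
  P_le : ∀ u v, ‖F.P u v‖ ≤ B * F.nH u * F.nH v
  coer : ∀ v, F.nV v ^ 2 ≤ B * (F.E v v).re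

variable {F : Setting H V cE c₁ c₂} {B : ℝ}

namespace Bounds

lemma adjoint (hB : F.Bounds B) : F.adjoint.Bounds B where
  one_le := hB.one_le
  nV_le v := by rw [adjoint_nH]; exact hB.nV_le v
  E_le u v := by
    rw [adjoint_E_apply, RCLike.norm_conj, adjoint_nV]; linarith [hB.E_le v u]
  P_le u v := by
    rw [adjoint_P_apply, RCLike.norm_conj, adjoint_nH]; linarith [hB.P_le v u]
  coer v := by
    rw [adjoint_E_apply, Complex.conj_re, adjoint_nV]; exact hB.coer v

lemma pos (hB : F.Bounds B) : 0 < B := zero_lt_one.trans_le hB.one_le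

lemma nV_Pi0_le (hB : F.Bounds B) (v : V) : F.nV (F.Pi0 v) ≤ B ^ 2 * F.nV v := by
  have h1 := hB.coer (F.Pi0 v)
  rw [F.E_Pi0 v (F.Pi0_mem v)] at h1
  have h2 := (Complex.re_le_norm _).trans (hB.E_le v (F.Pi0 v))
  have h3 := mul_le_mul_of_nonneg_left h2 hB.pos.le
  rcases (F.nV_nonneg (F.Pi0 v)).eq_or_lt with h | h
  · rw [← h]; have := F.nV_nonneg v; positivity
  · refine le_of_mul_le_mul_right ?_ h
    linarith

lemma nV_Pi1_le (hB : F.Bounds B) (v : V) : F.nV (F.Pi1 v) ≤ 2 * B ^ 2 * F.nV v := by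
  have h1 := F.nV_sub_le v (F.Pi0 v)
  have h2 := hB.nV_Pi0_le v
  have h3 : F.nV v ≤ B ^ 2 * F.nV v :=
    le_mul_of_one_le_left (F.nV_nonneg v) (one_le_pow₀ hB.one_le)
  rw [Pi1_apply]
  linarith

lemma nV_ιInv_E_le (hB : F.Bounds B) (v : V) : F.nV (F.ιInv F.E v) ≤ B * F.nV v := by
  have h1 := F.ι_self (F.ιInv F.E v)
  rw [ι_ιInv] at h1
  have h2 := hB.E_le v (F.ιInv F.E v)
  rw [h1, Complex.norm_real, Real.norm_eq_abs, abs_of_nonneg (sq_nonneg _)] at h2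
  rcases (F.nV_nonneg (F.ιInv F.E v)).eq_or_lt with h | h
  · rw [← h]; have := F.nV_nonneg v; have := hB.pos; positivity
  · refine le_of_mul_le_mul_right ?_ h
    linarith

/-- A solution of `P y = ι g` is controlled in `H` by its norm in `V`. -/
lemma nH_sol_le (hB : F.Bounds B) {y : H} {g : V} (hy : ∀ v, F.P y v = F.ι g (F.incl v)) :
    F.nH y ≤ 2 * B * (F.nV (F.incl y) + F.nV g) := by
  have h1 : F.D y y = F.ι g (F.incl y) + F.E (F.incl y) (F.incl y) := by
    rw [← hy, P_apply]; ring
  have h2 := F.nH_sq y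
  rw [h1, Complex.add_re] at h2
  have h3 := (Complex.re_le_norm _).trans (F.norm_ι_le g (F.incl y))
  have h4 := (Complex.re_le_norm _).trans (hB.E_le (F.incl y) (F.incl y))
  have h5 := F.nV_nonneg (F.incl y)
  have h6 := F.nV_nonneg g
  have h7 := hB.one_le
  refine (sq_le_sq₀ (F.nH_nonneg _) (by positivity)).1 ?_
  generalize F.nV (F.incl y) = a at *
  generalize F.nV g = b at *
  have h8 : B ≤ B ^ 2 := by nlinarith
  have h9 : a ^ 2 ≤ B ^ 2 * a ^ 2 := le_mul_of_one_le_left (sq_nonneg _) (by nlinarith)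
  have h10 : B * a ^ 2 ≤ B ^ 2 * a ^ 2 := by gcongr
  have h11 : b * a ≤ B ^ 2 * (b * a) := le_mul_of_one_le_left (by positivity) (by nlinarith)
  nlinarith [mul_nonneg (sq_nonneg B) (mul_nonneg h5 h6), sq_nonneg (B * b), sq_nonneg (B * a)]

end Bounds

section Regularity

variable {m : ℕ} {Z : ℕ → SubNorm V} {C : ℝ}

lemma norm_ι_le_mul_dualENorm (N : SubNorm V) (q v : V)
    (h : dualENorm N (F.ι v) = 1) : ‖F.ι q v‖ₑ ≤ N q := by
  rcases eq_or_ne (N q) ∞ with hq | hq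
  · rw [hq]; exact le_top
  have h1 := le_opENorm_mul (N := N) (M := fun a : ℂ => ‖a‖ₑ) (T := F.ι v) (x := q) N.smul'
    (fun a x => by
      rw [ContinuousLinearMap.map_smulₛₗ, smul_eq_mul, enorm_mul]
      congr 1
      rw [← ofReal_norm, ← ofReal_norm, RCLike.norm_conj])
    (fun h0 => by rw [(N.eq_zero_iff' q).1 h0]; simp) hq
  change ‖F.ι v q‖ₑ ≤ dualENorm N (F.ι v) * N q at h1
  rw [h, one_mul, ← ofReal_norm, ← ι_conj, RCLike.norm_conj, ofReal_norm] at h1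
  exact h1

namespace Regularity

lemma Z_le (hR : F.Regularity m Z C) (hB : F.Bounds B) (hCB : C ≤ B) {i j : ℕ} (hij : i ≤ j)
    (hj : j ≤ m + 1) (v : V) : Z i v ≤ ENNReal.ofReal B ^ (m + 1) * Z j v := by
  have hb : 1 ≤ ENNReal.ofReal B := by simpa using ENNReal.ofReal_le_ofReal hB.one_le
  have hstep : ∀ k, k ≤ m → Z k v ≤ ENNReal.ofReal B * Z (k + 1) v := by
    intro k hk
    rcases Nat.eq_zero_or_pos k with rfl | hk0
    · by_cases hv : v ∈ Set.range F.incl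
      · obtain ⟨w, rfl⟩ := hv
        rw [hR.zero, hR.one, normV_eq, normH_eq, ← ENNReal.ofReal_mul hB.pos.le]
        exact ENNReal.ofReal_le_ofReal (hB.nV_le w)
      · rw [hR.one_top v hv, ENNReal.mul_top (by simpa using hB.pos)]; exact le_top
    · exact (hR.nested k hk0 hk v).trans (by gcongr)
  have h : ∀ d, i + d ≤ m + 1 → Z i v ≤ ENNReal.ofReal B ^ d * Z (i + d) v := by
    intro d
    induction d with
    | zero => simp
    | succ d ih =>
      intro hd
      calc Z i v ≤ ENNReal.ofReal B ^ d * Z (i + d) v := ih (by omega)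
        _ ≤ ENNReal.ofReal B ^ d * (ENNReal.ofReal B * Z (i + d + 1) v) := by
          gcongr; exact hstep _ (by omega)
        _ = _ := by rw [pow_succ, mul_assoc]; rfl
  obtain ⟨d, rfl⟩ := Nat.exists_eq_add_of_le hij
  refine (h d hj).trans ?_
  gcongr
  omega

lemma Z_kerProj_le (hR : F.Regularity m Z C) (hB : F.Bounds B) (hC : 0 < C) (hCB : C ≤ B) {j : ℕ}
    (hj : j ≤ m + 1) (v : V) : Z j (F.kerProj v) ≤ ENNReal.ofReal B * Z j v := by
  rcases Nat.eq_zero_or_pos j with rfl | hj0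
  · rw [hR.zero, hR.zero, normV_eq, normV_eq, ← ENNReal.ofReal_mul hB.pos.le]
    refine ENNReal.ofReal_le_ofReal ((F.nV_kerProj_le v).trans ?_)
    exact le_mul_of_one_le_left (F.nV_nonneg v) hB.one_le
  · refine (SubNorm.le_of_opENorm_le (T := (F.kerProj : V →ₗ[ℂ] V)) hC
      (hR.proj_reg j hj0 hj) v).trans ?_
    gcongr

lemma Z_E_le (hR : F.Regularity m Z C) (hB : F.Bounds B) (hC : 0 < C) (hCB : C ≤ B) {j : ℕ}
    (hj : j ≤ m + 1) (v : V) : Z j (F.ιInv F.E v) ≤ ENNReal.ofReal B * Z j v := by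
  rcases Nat.eq_zero_or_pos j with rfl | hj0
  · rw [hR.zero, hR.zero, normV_eq, normV_eq, ← ENNReal.ofReal_mul hB.pos.le]
    exact ENNReal.ofReal_le_ofReal (hB.nV_ιInv_E_le v)
  · refine (SubNorm.le_of_opENorm_le (T := (F.ιInv F.E : V →ₗ[ℂ] V)) hC
      (hR.E_reg F.E (by simp) j hj0 hj) v).trans ?_
    gcongr

lemma ofReal_four_mul_pow {x : ℝ} (hx : 0 ≤ x) (k : ℕ) :
    ENNReal.ofReal ((4 * x ^ 3) ^ k) = (4 * ENNReal.ofReal x ^ 3) ^ k := by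
  rw [ENNReal.ofReal_pow (by positivity), ENNReal.ofReal_mul (by positivity),
    ENNReal.ofReal_pow hx, ENNReal.ofReal_ofNat]

/-- The elliptic regularity assumption for an equation `A y = ι q`. -/
lemma Z_Pi1_le (hR : F.Regularity m Z C) (hCB : C ≤ B)
    {A : H →L[ℂ] AntiDual H} (hA : A ∈ ({F.D, sesqAdj F.D, rePart F.D} : Set (H →L[ℂ] AntiDual H)))
    {j : ℕ} (hj : j + 2 ≤ m + 1) {y : H} {q : V} (hy : ∀ v, A y v = F.ι q (F.incl v)) :
    Z (j + 2) (F.Pi1 (F.incl y)) ≤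
      ENNReal.ofReal B * (F.normV (F.Pi1 (F.incl y)) + Z j q) := by
  have hD : ∀ u v, F.D (F.Pi1H u) (F.Pi1H v) = F.D u v := fun u v => by
    rw [D_Pi1H, D_Pi1H_right]
  have hA1 : ∀ u v, A (F.Pi1H u) (F.Pi1H v) = A u v := by
    intro u v
    rcases hA with rfl | rfl | rfl
    · exact hD u v
    · rw [sesqAdj_apply, sesqAdj_apply, hD]
    · rw [rePart_apply, rePart_apply, hD, hD]
  refine (hR.ell_reg A hA (j + 2) (by omega) hj y).trans ?_
  gcongr
  refine iSup₂_le fun v hv => ?_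
  rw [hA1, hy]
  exact norm_ι_le_mul_dualENorm _ _ _ hv

/-- Elliptic regularity for an equation `A y = ι (L y + g)` with `L` bounded on the spaces `Z j`, by
steps of two derivatives. -/
lemma Z_le_of_eq (hR : F.Regularity m Z C) (hB : F.Bounds B) (hCB : C ≤ B)
    {A : H →L[ℂ] AntiDual H} (hA : A ∈ ({F.D, sesqAdj F.D, rePart F.D} : Set (H →L[ℂ] AntiDual H)))
    {n : ℕ} (hn : n ≤ m + 1) {y : H} {L : V → V} {g : V} {G b : ℝ≥0∞}
    (hb : ENNReal.ofReal (2 * B ^ 2) ≤ b)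
    (hy : ∀ v, A y v = F.ι (L (F.incl y) + g) (F.incl v))
    (hL : ∀ j, j + 2 ≤ n → Z j (L (F.incl y)) ≤ b * Z j (F.incl y))
    (hg : ∀ j, j + 2 ≤ n → Z j g ≤ G) (h0 : F.normV (F.incl y) ≤ G) (h1 : F.normH y ≤ G)
    (hPi : ∀ j, 2 ≤ j → j ≤ n → Z j (F.incl y) ≤ G + b * Z j (F.Pi1 (F.incl y))) (j : ℕ)
    (hj : j ≤ n) : Z j (F.incl y) ≤ (4 * b ^ 3) ^ j * G := by
  have hB1 := hB.one_le
  have hb1 : 1 ≤ b := by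
    refine le_trans ?_ hb
    simpa using ENNReal.ofReal_le_ofReal (show (1 : ℝ) ≤ 2 * B ^ 2 by nlinarith)
  have hBb : ENNReal.ofReal B ≤ b := (ENNReal.ofReal_le_ofReal (by nlinarith)).trans hb
  have hb3 : 1 ≤ b ^ 3 := one_le_pow₀ hb1
  have h4 : 1 ≤ 4 * b ^ 3 := by
    calc (1 : ℝ≥0∞) ≤ 4 * 1 := by norm_num
      _ ≤ 4 * b ^ 3 := by gcongr
  induction j using Nat.twoStepInduction with
  | zero => simpa [hR.zero] using h0
  | one =>
    rw [hR.one, pow_one]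
    exact h1.trans (le_mul_of_one_le_left zero_le h4)
  | more j ih _ =>
    have ih := ih (by omega)
    have hc : 1 ≤ (4 * b ^ 3) ^ j := one_le_pow₀ h4
    rw [pow_add]
    generalize (4 * b ^ 3) ^ j = c at ih hc ⊢
    have hP1 : F.normV (F.Pi1 (F.incl y)) ≤ b * G := by
      refine le_trans ?_ (mul_le_mul' hb h0)
      rw [normV_eq, normV_eq, ← ENNReal.ofReal_mul (by positivity)]
      exact ENNReal.ofReal_le_ofReal (hB.nV_Pi1_le _)
    have e1 : G ≤ b ^ 3 * c * G := le_mul_of_one_le_left zero_le (one_le_mul hb3 hc)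
    calc Z (j + 2) (F.incl y) ≤ G + b * Z (j + 2) (F.Pi1 (F.incl y)) := hPi _ (by omega) hj
      _ ≤ G + b * (b * (b * G + (b * (c * G) + G))) := by
        gcongr
        refine (hR.Z_Pi1_le hCB hA (hj.trans hn) hy).trans ?_
        gcongr
        refine ((Z j).add_le' _ _).trans ?_
        gcongr
        · exact (hL j hj).trans (by gcongr)
        · exact hg j hj
      _ ≤ b ^ 3 * c * G + b * (b * (b * (c * G) + (b * (c * G) + b * (c * G)))) := by
        have e2 : G ≤ c * G := le_mul_of_one_le_left zero_le hc
        have e3 : G ≤ b * (c * G) := e2.trans (le_mul_of_one_le_left zero_le hb1)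
        gcongr
      _ = 4 * b ^ 3 * (c * G) := by ring
      _ ≤ (4 * b ^ 3) * (4 * b ^ 3) * (c * G) := by
        gcongr ?_ * _
        exact le_mul_of_one_le_left zero_le h4
      _ = _ := by ring

end Regularity

/-- The constant of the regularity estimate for `P`. -/
def regConst (B : ℝ) (m : ℕ) : ℝ := (4 * (2 * B ^ 2) ^ 3) ^ (m + 1) * (4 * B ^ 3)

/-- Regularity of the solutions of `P y = ι g`. Only the action of `g` on `Ker D` enters the estimate of
`Π₀ y`, so that there `g` may be replaced by a smoother `g'`. -/
lemma Regularity.Z_sol_le (hR : F.Regularity m Z C) (hB : F.Bounds B) (hm : 1 ≤ m) (hC : 0 < C)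
    (hCB : C ≤ B) {y : H} {g g' : V} (hy : ∀ v, F.P y v = F.ι g (F.incl v))
    (hg' : ∀ k ∈ F.K, F.ι g k = F.ι g' k) {M : ℝ} (hM : 0 ≤ M)
    (h0 : F.nV (F.incl y) ≤ M) (h1 : ∀ j, j + 2 ≤ m + 1 → Z j g ≤ ENNReal.ofReal M)
    (h2 : ∀ j, 1 ≤ j → j ≤ m + 1 → Z j g' ≤ ENNReal.ofReal M) :
    Z (m + 1) (F.incl y) ≤ ENNReal.ofReal (regConst B m * M) := by
  have hB1 := hB.one_le
  have hB0 := hB.pos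
  have hB2 : B ≤ B ^ 2 := by nlinarith
  have hB3 : B ^ 2 ≤ B ^ 3 := by nlinarith [sq_nonneg B]
  have hgV : F.nV g ≤ M := by
    have h := h1 0 (by omega)
    rw [hR.zero, normV_eq] at h
    exact (ENNReal.ofReal_le_ofReal_iff hM).1 h
  have hK : F.kerProj (F.ιInv F.E (F.Pi0 (F.incl y))) = -F.kerProj g' := by
    refine F.eq_kerProj (F.K.neg_mem (F.kerProj_mem _)) fun k hk => ?_
    obtain ⟨k, hk0, rfl⟩ := F.mem_K.1 hk
    have e1 := F.ι_sub_kerProj g' hk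
    have e2 := hy k
    rw [P_apply, F.D_adj_ker hk0, hg' _ hk] at e2
    rw [form_sub_left] at e1
    rw [sub_neg_eq_add, form_add_left, ι_ιInv, F.E_Pi0 _ hk]
    linear_combination -e1 - e2
  have hPi0 : ∀ j, 1 ≤ j → j ≤ m + 1 → Z j (F.Pi0 (F.incl y)) ≤ ENNReal.ofReal (4 * B ^ 3 * M) := by
    intro j hj1 hj
    have e1 := hR.E00_reg F.E (by simp) j hj1 hj (F.Pi0 (F.incl y))
    rw [F.kerProj_of_mem (F.Pi0_mem _), hK, SubNorm.map_neg] at e1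
    refine e1.trans ?_
    calc ENNReal.ofReal C * (Z j (F.kerProj g') + F.normV (F.Pi0 (F.incl y)))
        ≤ ENNReal.ofReal B * (ENNReal.ofReal B * ENNReal.ofReal M + ENNReal.ofReal (B ^ 2 * M)) := by
          gcongr
          · exact (hR.Z_kerProj_le hB hC hCB hj g').trans (by gcongr; exact h2 j hj1 hj)
          · rw [normV_eq]
            refine ENNReal.ofReal_le_ofReal ((hB.nV_Pi0_le _).trans ?_)
            gcongr
      _ = ENNReal.ofReal (B * (B * M + B ^ 2 * M)) := by
          rw [← ENNReal.ofReal_mul hB0.le, ← ENNReal.ofReal_add (by positivity) (by positivity),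
            ← ENNReal.ofReal_mul hB0.le]
      _ ≤ _ := by
          refine ENNReal.ofReal_le_ofReal ?_
          nlinarith [mul_le_mul_of_nonneg_right hB3 hM, mul_nonneg (pow_nonneg hB0.le 3) hM]
  have hM4 : M ≤ 4 * B ^ 3 * M := le_mul_of_one_le_left hM (by linarith)
  have key := hR.Z_le_of_eq hB hCB (A := F.D) (by simp) le_rfl (y := y) (L := F.ιInv F.E) (g := g)
    (G := ENNReal.ofReal (4 * B ^ 3 * M)) (b := ENNReal.ofReal (2 * B ^ 2)) le_rfl
    (fun v => by rw [form_add_left, ι_ιInv, ← hy, P_apply]; ring)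
    (fun j hj => (hR.Z_E_le hB hC hCB (by omega) _).trans (by
      gcongr; linarith))
    (fun j hj => (h1 j hj).trans (ENNReal.ofReal_le_ofReal hM4))
    (by rw [normV_eq]; exact ENNReal.ofReal_le_ofReal (h0.trans hM4))
    (by
      rw [normH_eq]
      refine ENNReal.ofReal_le_ofReal ((hB.nH_sol_le hy).trans ?_)
      calc 2 * B * (F.nV (F.incl y) + F.nV g) ≤ 2 * B ^ 3 * (M + M) := by
            have := F.nV_nonneg (F.incl y)
            have := F.nV_nonneg g
            have : B ≤ B ^ 3 := by linarith
            gcongr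
        _ = _ := by ring)
    (fun j hj1 hj => by
      have e : F.incl y = F.Pi0 (F.incl y) + F.Pi1 (F.incl y) := by rw [Pi1_apply]; abel
      nth_rewrite 1 [e]
      refine ((Z j).add_le' _ _).trans ?_
      gcongr
      · exact hPi0 j (by omega) hj
      · refine le_mul_of_one_le_left zero_le ?_
        simpa using ENNReal.ofReal_le_ofReal (show (1 : ℝ) ≤ 2 * B ^ 2 by nlinarith))
    (m + 1) le_rfl
  refine key.trans (le_of_eq ?_)
  rw [regConst, mul_assoc _ (4 * B ^ 3) M, ← ofReal_four_mul_pow (by positivity),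
    ← ENNReal.ofReal_mul (by positivity)]

end Regularity

end

end Setting

end AbsGalerkin

/-! ### The smoothing operator -/

namespace AbsGalerkin

namespace Setting

noncomputable section

variable {H : Type u} {V : Type v} [NormedAddCommGroup H] [InnerProductSpace ℂ H] [CompleteSpace H]
  [NormedAddCommGroup V] [InnerProductSpace ℂ V] [CompleteSpace V] {cE c₁ c₂ : ℝ}

/-- A smoothing operator `S : V → Z (m + 1)` that is self-adjoint for `(·,·)_V`, vanishes on `Ker D`, and
is such that `S²` compensates the negative part of `Re P` on the `V`-orthogonal complement of
`Ker D`. -/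
structure Smoother (F : Setting H V cE c₁ c₂) (Z : ℕ → SubNorm V) (m : ℕ) (B σ : ℝ)
    (S : V →L[ℂ] V) : Prop where
  one_le : 1 ≤ σ
  symm : ∀ u v, F.ι (S u) v = F.ι u (S v)
  ker : ∀ k ∈ F.K, S k = 0
  nV_le : ∀ u, F.nV (S u) ≤ σ * F.nV u
  reg : ∀ u, Z (m + 1) (S u) ≤ ENNReal.ofReal (σ * F.nV u)
  coer : ∀ u : H, 12 * B ^ 5 * F.nV (F.incl u - F.kerProj (F.incl u)) ^ 2 ≤
    (F.D u u).re + F.nV (S (F.incl u)) ^ 2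

lemma Smoother.adjoint {F : Setting H V cE c₁ c₂} {Z : ℕ → SubNorm V} {m : ℕ} {B σ : ℝ}
    {S : V →L[ℂ] V} (hS : F.Smoother Z m B σ S) : F.adjoint.Smoother Z m B σ S where
  one_le := hS.one_le
  symm := hS.symm
  ker := by rw [adjoint_K]; exact hS.ker
  nV_le := hS.nV_le
  reg := hS.reg
  coer u := by
    rw [adjoint_kerProj, adjoint_D_apply, Complex.conj_re]; exact hS.coer u

variable (F : Setting H V cE c₁ c₂)

/-- The resolvent of `Re D`: `(F.resolvent f, v)_H = (f, v)_V` for all `v ∈ H`. -/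
def resolvent : V →L[ℂ] H := F.innerH.inverse ∘L dualMap F.incl ∘L F.ι

lemma innerH_resolvent (f : V) (v : H) : F.innerH (F.resolvent f) v = F.ι f (F.incl v) := by
  have hi : F.innerH.IsInvertible := form_isInvertible_of_coercive _ F.c₁_pos fun v => by
    rw [innerH_self_eq, Complex.ofReal_re]; exact F.c₁_norm_sq_le_nH_sq v
  have h : F.innerH (F.resolvent f) = dualMap F.incl (F.ι f) := by
    unfold resolvent
    generalize F.innerH = T at hi ⊢
    obtain ⟨R, rfl⟩ := hi
    simp
  rw [h]; rfl

lemma ι_resolvent_symm (f g : V) :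
    F.ι (F.incl (F.resolvent f)) g = F.ι f (F.incl (F.resolvent g)) := by
  rw [← innerH_resolvent, ← innerH_conj, innerH_resolvent, ι_conj]

lemma ι_resolvent_ker {f : V} (hf : ∀ k ∈ F.K, F.ι f k = 0) {k : V} (hk : k ∈ F.K) :
    F.ι (F.incl (F.resolvent f)) k = 0 := by
  have hf' := hf k hk
  obtain ⟨k, hk0, rfl⟩ := F.mem_K.1 hk
  rw [← innerH_resolvent, innerH_apply, rePart_apply, F.D_adj_ker hk0, hk0] at hf'
  simpa using hf'

/-- The resolvent of `Re D` on the `V`-orthogonal complement of `Ker D`, extended by zero. -/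
def smoothStep : V →L[ℂ] V := F.incl ∘L F.resolvent ∘L (ContinuousLinearMap.id ℂ V - F.kerProj)

lemma smoothStep_apply (v : V) :
    F.smoothStep v = F.incl (F.resolvent (v - F.kerProj v)) := rfl

lemma ι_smoothStep_ker (v : V) {k : V} (hk : k ∈ F.K) : F.ι (F.smoothStep v) k = 0 :=
  F.ι_resolvent_ker (fun _ hk => F.ι_sub_kerProj v hk) hk

lemma smoothStep_sub_kerProj (v : V) : F.smoothStep (v - F.kerProj v) = F.smoothStep v := by
  have h : F.kerProj (v - F.kerProj v) = 0 := F.kerProj_eq_zero fun k hk => F.ι_sub_kerProj v hk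
  rw [smoothStep_apply, h, sub_zero, smoothStep_apply]

lemma smoothStep_of_mem {v : V} (hv : v ∈ F.K) : F.smoothStep v = 0 := by
  rw [smoothStep_apply, F.kerProj_of_mem hv, sub_self, map_zero, map_zero]

lemma smoothStep_symm (u v : V) : F.ι (F.smoothStep u) v = F.ι u (F.smoothStep v) := by
  have h : ∀ u v, F.ι (F.smoothStep u) v =
      F.ι (F.incl (F.resolvent (u - F.kerProj u))) (v - F.kerProj v) := by
    intro u v
    rw [map_sub (F.ι (F.incl (F.resolvent (u - F.kerProj u)))), ← smoothStep_apply,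
      F.ι_smoothStep_ker u (F.kerProj_mem v), sub_zero]
  rw [h, ι_resolvent_symm, ← ι_conj, ← h, ι_conj]

lemma smoothStep_pow_symm (k : ℕ) (u v : V) :
    F.ι ((F.smoothStep ^ k) u) v = F.ι u ((F.smoothStep ^ k) v) := by
  induction k generalizing u v with
  | zero => simp
  | succ k ih =>
    nth_rewrite 1 [pow_succ]
    rw [pow_succ', mul_apply_eq_comp, mul_apply_eq_comp, ih,
      smoothStep_symm]

variable {F} {B : ℝ}

lemma Bounds.nH_resolvent_le (hB : F.Bounds B) (f : V) : F.nH (F.resolvent f) ≤ B * F.nV f := by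
  have h := F.innerH_resolvent f (F.resolvent f)
  rw [innerH_self_eq] at h
  have h1 := F.norm_ι_le f (F.incl (F.resolvent f))
  rw [← h, Complex.norm_real, Real.norm_eq_abs, abs_of_nonneg (sq_nonneg _)] at h1
  have h2 := hB.nV_le (F.resolvent f)
  rcases (F.nH_nonneg (F.resolvent f)).eq_or_lt with h3 | h3
  · rw [← h3]; have := F.nV_nonneg f; have := hB.pos; positivity
  · refine le_of_mul_le_mul_right ?_ h3
    nlinarith [F.nV_nonneg f]

lemma Bounds.nV_smoothStep_le (hB : F.Bounds B) (v : V) :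
    F.nV (F.smoothStep v) ≤ B ^ 2 * F.nV v := by
  rw [smoothStep_apply]
  have h1 := hB.nV_le (F.resolvent (v - F.kerProj v))
  have h2 := hB.nH_resolvent_le (v - F.kerProj v)
  have h3 := F.nV_sub_kerProj_le v
  have := hB.pos
  calc _ ≤ B * (B * F.nV v) := h1.trans (by gcongr; exact h2.trans (by gcongr))
    _ = _ := by ring

/-- The bound of `smoothStep : Z i → Z (i + 1)`. -/
def stepConst (B : ℝ) (m : ℕ) : ℝ := (4 * (2 * B ^ 2) ^ 3) ^ (m + 1) * B ^ (m + 3) * (2 * B ^ 2)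

lemma one_le_stepConst (hB : 1 ≤ B) (m : ℕ) : B ^ 2 ≤ stepConst B m := by
  have h1 : 1 ≤ 2 * B ^ 2 := by nlinarith
  have h2 : 1 ≤ 4 * (2 * B ^ 2) ^ 3 := by have := one_le_pow₀ h1 (n := 3); linarith
  have h3 : 1 ≤ (4 * (2 * B ^ 2) ^ 3) ^ (m + 1) * B ^ (m + 3) :=
    one_le_mul_of_one_le_of_one_le (one_le_pow₀ h2) (one_le_pow₀ hB)
  unfold stepConst
  nlinarith [sq_nonneg B]

section Regularity

variable {m : ℕ} {Z : ℕ → SubNorm V} {C : ℝ}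

lemma Regularity.Z_smoothStep_le (hR : F.Regularity m Z C) (hB : F.Bounds B) (hC : 0 < C)
    (hCB : C ≤ B) {i : ℕ} (hi : i ≤ m) (v : V) :
    Z (i + 1) (F.smoothStep v) ≤ ENNReal.ofReal (stepConst B m) * Z i v := by
  have hB1 := hB.one_le
  have hB0 := hB.pos
  have hb1 : 1 ≤ ENNReal.ofReal B := by simpa using ENNReal.ofReal_le_ofReal hB1
  have h2b : 1 + ENNReal.ofReal B ≤ ENNReal.ofReal (2 * B ^ 2) := by
    rw [← ENNReal.ofReal_one, ← ENNReal.ofReal_add zero_le_one hB0.le]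
    exact ENNReal.ofReal_le_ofReal (by nlinarith)
  have hcomp : ∀ j ≤ m + 1, ∀ w, Z j (w - F.kerProj w) ≤ ENNReal.ofReal (2 * B ^ 2) * Z j w := by
    intro j hj w
    refine ((Z j).sub_le _ _).trans ?_
    refine le_trans ?_ (mul_le_mul_left h2b _)
    rw [add_mul, one_mul]
    gcongr
    exact hR.Z_kerProj_le hB hC hCB hj w
  set f := v - F.kerProj v with hf
  set y := F.resolvent f with hy
  have hfK : ∀ k ∈ F.K, F.ι f k = 0 := fun k hk => F.ι_sub_kerProj v hk
  have hyK : F.kerProj (F.incl y) = 0 := F.kerProj_eq_zero fun k hk => F.ι_resolvent_ker hfK hk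
  have hlow : ∀ j ≤ i, Z j f ≤ ENNReal.ofReal B ^ (m + 1) * Z i f := fun j hj =>
    hR.Z_le hB hCB hj (by omega) f
  have h0 : ENNReal.ofReal B ^ 2 * F.normV f ≤ ENNReal.ofReal B ^ (m + 3) * Z i f := by
    rw [← hR.zero, show m + 3 = 2 + (m + 1) by ring, pow_add, mul_assoc]
    gcongr
    exact hlow 0 (by omega)
  have key := hR.Z_le_of_eq hB hCB (A := rePart F.D) (by simp) (n := i + 1) (by omega) (y := y)
    (L := fun w => -w) (g := f) (G := ENNReal.ofReal B ^ (m + 3) * Z i f)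
    (b := ENNReal.ofReal (2 * B ^ 2)) le_rfl
    (fun w => by
      have h := F.innerH_resolvent f w
      rw [innerH_apply] at h
      rw [form_add_left, map_neg, neg_apply, ← h]
      ring)
    (fun j hj => by
      rw [SubNorm.map_neg]
      refine le_mul_of_one_le_left zero_le (le_trans ?_ h2b)
      simp)
    (fun j hj => (hlow j (by omega)).trans (by
      gcongr
      norm_num))
    (by
      refine le_trans ?_ h0
      rw [normV_eq, normV_eq, ← ENNReal.ofReal_pow hB0.le, ← ENNReal.ofReal_mul (by positivity)]
      refine ENNReal.ofReal_le_ofReal ((hB.nV_le y).trans ?_)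
      rw [pow_two, mul_assoc]
      gcongr
      exact hB.nH_resolvent_le f)
    (by
      refine le_trans ?_ h0
      rw [normV_eq, normH_eq, ← ENNReal.ofReal_pow hB0.le, ← ENNReal.ofReal_mul (by positivity)]
      refine ENNReal.ofReal_le_ofReal ((hB.nH_resolvent_le f).trans ?_)
      have := F.nV_nonneg f
      gcongr
      nlinarith)
    (fun j hj1 hj => by
      have e : F.incl y = F.Pi1 (F.incl y) - F.kerProj (F.Pi1 (F.incl y)) := by
        rw [Pi1_apply, map_sub, hyK, F.kerProj_of_mem (F.Pi0_mem _)]; abel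
      nth_rewrite 1 [e]
      exact (hcomp j (by omega) _).trans le_add_self)
    (i + 1) le_rfl
  rw [← smoothStep_apply] at key
  have hb2 : 1 ≤ 4 * ENNReal.ofReal (2 * B ^ 2) ^ 3 := by
    have h1 : 1 ≤ ENNReal.ofReal (2 * B ^ 2) := le_trans (by simp) h2b
    calc (1 : ℝ≥0∞) ≤ 4 * 1 := by norm_num
      _ ≤ _ := by gcongr; exact one_le_pow₀ h1
  refine key.trans ?_
  calc (4 * ENNReal.ofReal (2 * B ^ 2) ^ 3) ^ (i + 1) * (ENNReal.ofReal B ^ (m + 3) * Z i f)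
      ≤ (4 * ENNReal.ofReal (2 * B ^ 2) ^ 3) ^ (m + 1) *
          (ENNReal.ofReal B ^ (m + 3) * (ENNReal.ofReal (2 * B ^ 2) * Z i v)) := by
        gcongr
        exact hcomp i (by omega) v
    _ = _ := by
        rw [stepConst, ENNReal.ofReal_mul (p := (4 * (2 * B ^ 2) ^ 3) ^ (m + 1) * B ^ (m + 3))
          (by positivity), ENNReal.ofReal_mul (p := (4 * (2 * B ^ 2) ^ 3) ^ (m + 1)) (by positivity),
          ofReal_four_mul_pow (by positivity), ENNReal.ofReal_pow hB0.le]
        ring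

lemma Regularity.Z_smoothStep_pow_le (hR : F.Regularity m Z C) (hB : F.Bounds B) (hC : 0 < C)
    (hCB : C ≤ B) {i : ℕ} (hi : i ≤ m + 1) (v : V) :
    Z i ((F.smoothStep ^ i) v) ≤ ENNReal.ofReal (stepConst B m) ^ i * F.normV v := by
  induction i with
  | zero => simp [hR.zero]
  | succ i ih =>
    rw [pow_succ', mul_apply_eq_comp]
    refine (hR.Z_smoothStep_le hB hC hCB (by omega) _).trans ?_
    rw [pow_succ', mul_assoc]
    gcongr
    exact ih (by omega)

end Regularity

lemma Bounds.nV_smoothStep_pow_le (hB : F.Bounds B) (m k : ℕ) (v : V) :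
    F.nV ((F.smoothStep ^ k) v) ≤ stepConst B m ^ k * F.nV v := by
  have hc := one_le_stepConst hB.one_le m
  have hc0 : 0 ≤ stepConst B m := (sq_nonneg B).trans hc
  induction k with
  | zero => simp
  | succ k ih =>
    rw [pow_succ', mul_apply_eq_comp]
    have h1 := hB.nV_smoothStep_le ((F.smoothStep ^ k) v)
    have h2 := F.nV_nonneg ((F.smoothStep ^ k) v)
    calc _ ≤ B ^ 2 * F.nV ((F.smoothStep ^ k) v) := h1
      _ ≤ stepConst B m * (stepConst B m ^ k * F.nV v) := by gcongr
      _ = _ := by ring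

/-- Powers of the resolvent compensate a large multiple of the `V`-norm: if
`‖w‖_H² ≤ t ‖w‖_V²` for `w ∈ H` orthogonal to `Ker D`, then the logarithmic convexity of the sequence
`j ↦ ‖(Re D + 1)^{-j} w‖_V` bounds `‖w‖_V` by `t ^ k ‖(Re D + 1)^{-k} w‖_V`. -/
lemma smoothStep_pow_coercive {w : H} (hw : ∀ k ∈ F.K, F.ι (F.incl w) k = 0) {t : ℝ} (ht : 1 ≤ t)
    (k : ℕ) : t * F.nV (F.incl w) ^ 2 ≤
      F.nH w ^ 2 + t ^ (2 * k + 1) * F.nV ((F.smoothStep ^ k) (F.incl w)) ^ 2 := by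
  have ht0 : 0 < t := zero_lt_one.trans_le ht
  rcases le_or_gt (t * F.nV (F.incl w) ^ 2) (F.nH w ^ 2) with h | h
  · have : 0 ≤ t ^ (2 * k + 1) * F.nV ((F.smoothStep ^ k) (F.incl w)) ^ 2 := by positivity
    linarith
  have hst : F.smoothStep (F.incl w) = F.incl (F.resolvent (F.incl w)) := by
    rw [smoothStep_apply, F.kerProj_eq_zero hw, sub_zero]
  let b : ℕ → ℝ := fun j => F.nV ((F.smoothStep ^ j) (F.incl w))
  have hb : ∀ j, 0 ≤ b j := fun j => F.nV_nonneg _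
  have hb0 : b 0 = F.nV (F.incl w) := by simp [b]
  have hconv : ∀ j, b (j + 1) ^ 2 ≤ b j * b (j + 2) := by
    intro j
    have h1 := F.norm_ι_le ((F.smoothStep ^ j) (F.incl w)) ((F.smoothStep ^ (j + 2)) (F.incl w))
    have h2 : F.ι ((F.smoothStep ^ j) (F.incl w)) ((F.smoothStep ^ (j + 2)) (F.incl w)) =
        ((b (j + 1) ^ 2 : ℝ) : ℂ) := by
      rw [← ι_self, pow_succ' _ (j + 1), mul_apply_eq_comp, ← smoothStep_symm,
        ← mul_apply_eq_comp, ← pow_succ']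
    rwa [h2, Complex.norm_real, Real.norm_eq_abs, abs_of_nonneg (sq_nonneg _)] at h1
  have hstart : b 0 ≤ t * b 1 := by
    have h1 : b 0 ^ 2 ≤ F.nH (F.resolvent (F.incl w)) * F.nH w := by
      have h2 := F.norm_innerH_le (F.resolvent (F.incl w)) w
      rwa [innerH_resolvent, ι_self, Complex.norm_real, Real.norm_eq_abs,
        abs_of_nonneg (sq_nonneg _), ← hb0] at h2
    have h3 : F.nH (F.resolvent (F.incl w)) ^ 2 ≤ b 0 * b 1 := by
      have h4 := F.norm_ι_le (F.incl w) (F.smoothStep (F.incl w))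
      rw [hst, ← innerH_resolvent, innerH_self_eq, Complex.norm_real, Real.norm_eq_abs,
        abs_of_nonneg (sq_nonneg _), ← hst, ← hb0] at h4
      simpa [b] using h4
    rcases (hb 0).eq_or_lt with h5 | h5
    · rw [← h5]; have := hb 1; positivity
    rw [← hb0] at h
    have h6 : (b 0 ^ 2) ^ 2 ≤ (b 0 * b 1) * (t * b 0 ^ 2) := by
      calc (b 0 ^ 2) ^ 2 ≤ (F.nH (F.resolvent (F.incl w)) * F.nH w) ^ 2 := by gcongr
        _ = F.nH (F.resolvent (F.incl w)) ^ 2 * F.nH w ^ 2 := by ring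
        _ ≤ _ := by
          have := hb 1
          gcongr
    refine le_of_mul_le_mul_right (a := b 0 ^ 3) ?_ (by positivity)
    linarith
  have hstep : ∀ j, b j ≤ t * b (j + 1) := by
    intro j
    induction j with
    | zero => exact hstart
    | succ j ih =>
      rcases (hb (j + 1)).eq_or_lt with h5 | h5
      · rw [← h5]; have := hb (j + 1 + 1); positivity
      · refine le_of_mul_le_mul_right (a := b (j + 1)) ?_ h5
        have h6 := mul_le_mul_of_nonneg_right ih (hb (j + 2))
        have h7 := hconv j
        change b (j + 1) * b (j + 1) ≤ t * b (j + 2) * b (j + 1)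
        nlinarith
  have hall : ∀ j, b 0 ≤ t ^ j * b j := by
    intro j
    induction j with
    | zero => simp
    | succ j ih =>
      calc b 0 ≤ t ^ j * b j := ih
        _ ≤ t ^ j * (t * b (j + 1)) := by gcongr; exact hstep j
        _ = _ := by ring
  have hfin : t * b 0 ^ 2 ≤ t ^ (2 * k + 1) * b k ^ 2 := by
    calc t * b 0 ^ 2 ≤ t * (t ^ k * b k) ^ 2 := by
          have := hb 0
          gcongr
          exact hall k
      _ = _ := by ring
  rw [← hb0]
  have := sq_nonneg (F.nH w)
  exact hfin.trans (by simpa [b] using this)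

/-- The factor `Λ` in the definition `S² = Λ (Re D + 1)^{-2(m + 1)}` of the smoothing operator. -/
def smoothFactor (B : ℝ) (m : ℕ) : ℝ := (12 * B ^ 5 + 1) ^ (2 * (m + 1) + 1)

/-- The bound of the smoothing operator. -/
def smoothConst (B : ℝ) (m : ℕ) : ℝ := √(smoothFactor B m) * stepConst B m ^ (m + 1)

lemma Regularity.exists_smoother {m : ℕ} {Z : ℕ → SubNorm V} {C : ℝ} (hR : F.Regularity m Z C)
    (hB : F.Bounds B) (hC : 0 < C) (hCB : C ≤ B) :
    ∃ S, F.Smoother Z m B (smoothConst B m) S := by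
  have hB1 := hB.one_le
  have hB0 := hB.pos
  have ht : 1 ≤ 12 * B ^ 5 + 1 := by have := pow_pos hB0 5; linarith
  have hΛ : 1 ≤ smoothFactor B m := one_le_pow₀ ht
  have hc := one_le_stepConst hB.one_le m
  have hc1 : 1 ≤ stepConst B m := (by nlinarith : 1 ≤ B ^ 2).trans hc
  have hc0 : 0 ≤ stepConst B m := zero_le_one.trans hc1
  have hsq : √(smoothFactor B m) ^ 2 = smoothFactor B m := Real.sq_sqrt (by linarith)
  have happ : ∀ v, ((√(smoothFactor B m) : ℂ) • F.smoothStep ^ (m + 1)) v =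
      (√(smoothFactor B m) : ℂ) • (F.smoothStep ^ (m + 1)) v := fun v => rfl
  have hnorm : ‖(√(smoothFactor B m) : ℂ)‖ = √(smoothFactor B m) := by
    rw [Complex.norm_real, Real.norm_eq_abs, abs_of_nonneg (Real.sqrt_nonneg _)]
  refine ⟨(√(smoothFactor B m) : ℂ) • F.smoothStep ^ (m + 1), ?_, ?_, ?_, ?_, ?_, ?_⟩
  · exact one_le_mul_of_one_le_of_one_le (Real.one_le_sqrt.2 hΛ) (one_le_pow₀ hc1)
  · intro u v
    rw [happ, happ, form_smul_left, smoothStep_pow_symm, ContinuousLinearMap.map_smulₛₗ,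
      Complex.conj_ofReal, smul_eq_mul]
  · intro k hk
    rw [happ, pow_succ, mul_apply_eq_comp, F.smoothStep_of_mem hk, map_zero, smul_zero]
  · intro u
    rw [happ, nV_smul, hnorm, smoothConst, mul_assoc]
    gcongr
    exact hB.nV_smoothStep_pow_le m (m + 1) u
  · intro u
    rw [happ, (Z (m + 1)).smul', ← ofReal_norm, hnorm, smoothConst, mul_assoc,
      ENNReal.ofReal_mul (Real.sqrt_nonneg _), ENNReal.ofReal_mul (by positivity),
      ENNReal.ofReal_pow hc0]
    gcongr
    exact hR.Z_smoothStep_pow_le hB hC hCB le_rfl u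
  · intro u
    obtain ⟨k, hk0, hk⟩ := F.mem_K.1 (F.kerProj_mem (F.incl u))
    have hw : F.incl (u - k) = F.incl u - F.kerProj (F.incl u) := by rw [map_sub, hk]
    have h := smoothStep_pow_coercive (F := F) (w := u - k)
      (fun k' hk' => by rw [hw]; exact F.ι_sub_kerProj _ hk') ht (m + 1)
    have hD : F.D (u - k) (u - k) = F.D u u := by
      rw [form_sub_left, hk0, map_sub, F.D_adj_ker hk0]; simp
    have hpow : (F.smoothStep ^ (m + 1)) (F.incl (u - k)) = (F.smoothStep ^ (m + 1)) (F.incl u) := by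
      rw [hw, pow_succ, mul_apply_eq_comp, smoothStep_sub_kerProj,
        mul_apply_eq_comp]
    rw [nH_sq, hD, hpow, hw] at h
    rw [happ, nV_smul, hnorm, mul_pow, hsq, smoothFactor]
    linarith

end

end Setting

end AbsGalerkin

/-! ### The regularised operator and its Galerkin equations -/

namespace AbsGalerkin

namespace Setting

noncomputable section

variable {H : Type u} {V : Type v} [NormedAddCommGroup H] [InnerProductSpace ℂ H] [CompleteSpace H]
  [NormedAddCommGroup V] [InnerProductSpace ℂ V] [CompleteSpace V] {cE c₁ c₂ : ℝ}

variable (F : Setting H V cE c₁ c₂)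

/-- The regularised operator `P + S^* ι S`, which is elliptic modulo the splitting of `H` by `Π₀` and
`Π₁`. -/
def ellipticP (S : V →L[ℂ] V) : H →L[ℂ] AntiDual H :=
  F.P + dualMap F.incl ∘L dualMap S ∘L F.ι ∘L S ∘L F.incl

variable {F} {B σ : ℝ} {m : ℕ} {Z : ℕ → SubNorm V} {S : V →L[ℂ] V}

lemma ellipticP_apply (u v : H) :
    F.ellipticP S u v = F.P u v + F.ι (S (F.incl u)) (S (F.incl v)) := rfl

lemma adjoint_ellipticP_apply (u v : H) :
    F.adjoint.ellipticP S u v = starRingEnd ℂ (F.ellipticP S v u) := by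
  rw [ellipticP_apply, ellipticP_apply, adjoint_P_apply, map_add, ι_conj]; rfl

lemma Smoother.ellipticP_ker_left (hS : F.Smoother Z m B σ S) {k : H} (hk : F.D k = 0) (v : H) :
    F.ellipticP S k v = -F.E (F.incl k) (F.incl v) := by
  rw [ellipticP_apply, P_apply, hk, hS.ker _ (F.incl_mem_K hk)]; simp

lemma Smoother.ellipticP_ker_right (hS : F.Smoother Z m B σ S) {k : H} (hk : F.D k = 0) (u : H) :
    F.ellipticP S u k = -F.E (F.incl u) (F.incl k) := by
  rw [ellipticP_apply, P_apply, F.D_adj_ker hk, hS.ker _ (F.incl_mem_K hk)]; simp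

lemma Smoother.norm_ellipticP_le (hS : F.Smoother Z m B σ S) (hB : F.Bounds B) (u v : H) :
    ‖F.ellipticP S u v‖ ≤ 2 * σ ^ 2 * B ^ 2 * F.nH u * F.nH v := by
  have hB1 := hB.one_le
  have hσ := hS.one_le
  have h1 : ∀ w : H, F.nV (S (F.incl w)) ≤ σ * (B * F.nH w) := fun w =>
    (hS.nV_le _).trans (by gcongr; exact hB.nV_le w)
  have hu := F.nH_nonneg u
  have hv := F.nH_nonneg v
  have h2 : ‖F.ι (S (F.incl u)) (S (F.incl v))‖ ≤ σ * (B * F.nH u) * (σ * (B * F.nH v)) :=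
    (F.norm_ι_le _ _).trans (mul_le_mul (h1 u) (h1 v) (F.nV_nonneg _) (by positivity))
  have h3 : B ≤ σ ^ 2 * B ^ 2 := by
    have : 1 ≤ σ ^ 2 := one_le_pow₀ hσ
    nlinarith
  have h4 := mul_le_mul_of_nonneg_right h3 (mul_nonneg hu hv)
  rw [ellipticP_apply]
  refine (norm_add_le _ _).trans ?_
  nlinarith [hB.P_le u v]

/-- The Gårding-type inequality for the regularised operator: on `Ran Π₁` it is coercive, and the
contribution of `Π₀ r` is kept on the right. -/
lemma Smoother.energy (hS : F.Smoother Z m B σ S) (hB : F.Bounds B) (r : H) :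
    1 / 2 * F.nH (F.Pi1H r) ^ 2 ≤
      (F.ellipticP S r r).re + B ^ 2 * F.nV (F.Pi0 (F.incl r)) * F.nH r := by
  have hB1 := hB.one_le
  have hB0 := hB.pos
  have hc := hS.coer r
  set r' := F.incl r - F.kerProj (F.incl r) with hr'
  have e1 : F.Pi1 (F.incl r) = F.Pi1 r' := by
    rw [Pi1_apply, Pi1_apply, hr', map_sub, F.Pi0_of_mem (F.kerProj_mem _)]; abel
  have h1 : F.nV (F.Pi1 (F.incl r)) ≤ 2 * B ^ 2 * F.nV r' := by
    rw [e1]; exact hB.nV_Pi1_le r'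
  have h1' : F.nV (F.Pi1 (F.incl r)) ^ 2 ≤ 4 * B ^ 4 * F.nV r' ^ 2 := by
    calc _ ≤ (2 * B ^ 2 * F.nV r') ^ 2 := by
          have := F.nV_nonneg (F.Pi1 (F.incl r)); gcongr
      _ = _ := by ring
  have e2 : F.E (F.incl r) (F.incl r) = F.E (F.Pi0 (F.incl r)) (F.incl r) +
      F.E (F.Pi1 (F.incl r)) (F.Pi1 (F.incl r)) := by
    have h : F.E (F.Pi1 (F.incl r)) (F.Pi1 (F.incl r)) = F.E (F.Pi1 (F.incl r)) (F.incl r) := by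
      conv_lhs => rw [F.Pi1_apply (F.incl r), map_sub, ← F.Pi1_apply (F.incl r),
        F.E_Pi1 _ (F.Pi0_mem _), sub_zero]
    rw [h, ← form_add_left, Pi1_apply]
    congr 2
    abel
  have e3 : (F.ellipticP S r r).re = (F.D r r).re - (F.E (F.Pi0 (F.incl r)) (F.incl r)).re -
      (F.E (F.Pi1 (F.incl r)) (F.Pi1 (F.incl r))).re + F.nV (S (F.incl r)) ^ 2 := by
    rw [ellipticP_apply, P_apply, ι_self, e2]
    simp only [Complex.add_re, Complex.sub_re, Complex.ofReal_re]
    ring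
  have e4 : F.nH (F.Pi1H r) ^ 2 = (F.D r r).re + F.nV (F.Pi1 (F.incl r)) ^ 2 := by
    rw [nH_sq, incl_Pi1H, D_Pi1H, D_Pi1H_right]
  have h2 := (Complex.re_le_norm _).trans (hB.E_le (F.Pi0 (F.incl r)) (F.incl r))
  have h3 := (Complex.re_le_norm _).trans (hB.E_le (F.Pi1 (F.incl r)) (F.Pi1 (F.incl r)))
  have h4 : B * F.nV (F.Pi0 (F.incl r)) * F.nV (F.incl r) ≤
      B ^ 2 * F.nV (F.Pi0 (F.incl r)) * F.nH r := by
    have := F.nV_nonneg (F.Pi0 (F.incl r))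
    calc _ ≤ B * F.nV (F.Pi0 (F.incl r)) * (B * F.nH r) := by gcongr; exact hB.nV_le r
      _ = _ := by ring
  have h5 : B * (4 * B ^ 4 * F.nV r' ^ 2) = 4 * B ^ 5 * F.nV r' ^ 2 := by ring
  have h6 := mul_le_mul_of_nonneg_left h1' hB0.le
  have h7 : F.nV (F.Pi1 (F.incl r)) ^ 2 ≤ B * F.nV (F.Pi1 (F.incl r)) ^ 2 :=
    le_mul_of_one_le_left (sq_nonneg _) hB1
  have h8 := sq_nonneg (F.nV (S (F.incl r)))
  rw [e3, e4]
  nlinarith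

variable (F) in
/-- The discrete divergence-free bound `‖Π₀ w‖_V ≤ γ ‖w‖_H`. -/
def Gap (Hh : Submodule ℂ H) (γ : ℝ) : Prop :=
  ∀ w ∈ Hh, (∀ v ∈ Hh, F.D v = 0 → F.E (F.incl w) (F.incl v) = 0) →
    F.nV (F.Pi0 (F.incl w)) ≤ γ * F.nH w

lemma gap_top : F.Gap ⊤ 0 := by
  intro w _ hw
  have h : F.Pi0 (F.incl w) = 0 := F.eq_Pi0 F.K.zero_mem fun k hk => by
    obtain ⟨k, hk0, rfl⟩ := F.mem_K.1 hk
    rw [hw k trivial hk0]; simp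
  rw [h]; simp

/-- The projection of `H` onto `H_h ∩ Ker D` for the form of `E`. -/
lemma Bounds.exists_kerGalerkin (hB : F.Bounds B) {Hh : Submodule ℂ H}
    (hHh : IsClosed (Hh : Set H)) :
    ∃ Q : H →L[ℂ] H, ∀ u, Q u ∈ Hh ∧ F.D (Q u) = 0 ∧
      (∀ v ∈ Hh, F.D v = 0 → F.E (F.incl (u - Q u)) (F.incl v) = 0) ∧
      F.nV (F.incl (Q u)) ≤ B ^ 2 * F.nV (F.incl u) := by
  have hB0 := hB.pos
  let Kh : Submodule ℂ H := Hh ⊓ F.D.ker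
  have hKh : IsClosed (Kh : Set H) := hHh.inter F.D.isClosed_ker
  have : CompleteSpace Kh := hKh.completeSpace_coe
  let T : H →L[ℂ] AntiDual Kh := dualMap Kh.subtypeL ∘L dualMap F.incl ∘L F.E ∘L F.incl
  have hinv : (T ∘L Kh.subtypeL).IsInvertible :=
    form_isInvertible_of_coercive _ (c := c₁ / B) (div_pos F.c₁_pos hB0) fun w => by
      have h1 := hB.coer (F.incl w)
      have hw : F.D (w : H) = 0 := w.2.2
      rw [← F.nH_ker hw] at h1
      have h2 := F.c₁_norm_sq_le_nH_sq w
      change c₁ / B * ‖(w : H)‖ ^ 2 ≤ (F.E (F.incl w) (F.incl w)).re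
      rw [div_mul_eq_mul_div, div_le_iff₀ hB0]
      linarith
  refine ⟨Kh.subtypeL ∘L (T ∘L Kh.subtypeL).inverse ∘L T, fun u => ?_⟩
  set q : Kh := (T ∘L Kh.subtypeL).inverse (T u) with hq
  have hTq : T (q : H) = T u := by
    have h : (T ∘L Kh.subtypeL) q = T u := by
      rw [hq]
      obtain ⟨R, hR⟩ := hinv
      rw [← hR]; simp
    exact h
  have horth : ∀ v ∈ Hh, F.D v = 0 → F.E (F.incl (q : H)) (F.incl v) = F.E (F.incl u) (F.incl v) := by
    intro v hv hv0
    exact congrArg (fun φ : AntiDual Kh => φ ⟨v, hv, hv0⟩) hTq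
  change (q : H) ∈ Hh ∧ F.D (q : H) = 0 ∧ (∀ v ∈ Hh, F.D v = 0 →
    F.E (F.incl (u - q)) (F.incl v) = 0) ∧ F.nV (F.incl (q : H)) ≤ B ^ 2 * F.nV (F.incl u)
  refine ⟨q.2.1, q.2.2, fun v hv hv0 => ?_, ?_⟩
  · rw [map_sub, form_sub_left, horth v hv hv0, sub_self]
  · have h1 := hB.coer (F.incl (q : H))
    rw [horth q q.2.1 q.2.2] at h1
    have h2 := (Complex.re_le_norm _).trans (hB.E_le (F.incl u) (F.incl (q : H)))
    have h3 := mul_le_mul_of_nonneg_left h2 hB0.le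
    rcases (F.nV_nonneg (F.incl (q : H))).eq_or_lt with h | h
    · rw [← h]; have := F.nV_nonneg (F.incl u); positivity
    · refine le_of_mul_le_mul_right ?_ h
      linarith

/-- Discrete coercivity of the regularised operator after the test function `w` has been replaced by
`w - q' - q`, where `q` and `q'` are the projections of `w` onto `H_h ∩ Ker D` for the form of `E` in its
first and second argument. The sign of `q` is changed because `P = -E` is negative on `Ker D`. -/
lemma Smoother.discrete_coercive (hS : F.Smoother Z m B σ S) (hB : F.Bounds B) {Hh : Submodule ℂ H}
    {γ : ℝ} (hgap : F.Gap Hh γ) (hγ : γ ≤ 1 / (16 * B ^ 2)) {w q q' : H} (hw : w ∈ Hh)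
    (hq : q ∈ Hh) (hq' : q' ∈ Hh) (hq0 : F.D q = 0) (hq0' : F.D q' = 0)
    (hqE : ∀ v ∈ Hh, F.D v = 0 → F.E (F.incl (w - q)) (F.incl v) = 0)
    (hqE' : ∀ v ∈ Hh, F.D v = 0 → F.E (F.incl v) (F.incl (w - q')) = 0) :
    F.nH w ^ 2 / (8 * B) ≤ (F.ellipticP S w (w - q' - q)).re := by
  have hB1 := hB.one_le
  have hB0 := hB.pos
  set r := w - q with hr
  have key : F.ellipticP S w (w - q' - q) = F.ellipticP S r r + F.E (F.incl q) (F.incl q) := by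
    have e1 : w = r + q := by rw [hr]; abel
    have e2 : w - q' = r + (q - q') := by rw [hr]; abel
    have a1 : F.ellipticP S q (w - q') = 0 := by
      rw [hS.ellipticP_ker_left hq0, hqE' q hq hq0, neg_zero]
    have a2 : F.ellipticP S r (q - q') = 0 := by
      have h0 : F.D (q - q') = 0 := by rw [map_sub, hq0, hq0', sub_zero]
      rw [hS.ellipticP_ker_right h0, hqE _ (Hh.sub_mem hq hq') h0, neg_zero]
    have a3 : F.ellipticP S r q = 0 := by
      rw [hS.ellipticP_ker_right hq0, hqE _ hq hq0, neg_zero]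
    have a4 : F.ellipticP S q q = -F.E (F.incl q) (F.incl q) := hS.ellipticP_ker_left hq0 q
    have a5 : F.ellipticP S r (w - q') = F.ellipticP S r r := by
      rw [e2, map_add, a2, add_zero]
    nth_rewrite 1 [e1]
    rw [form_add_left, map_sub, map_sub (F.ellipticP S q), a1, a3, a4, a5]
    ring
  have hg := hgap r (Hh.sub_mem hw hq) hqE
  have hnr := F.nH_nonneg r
  have hg1 : B ^ 2 * F.nV (F.Pi0 (F.incl r)) ≤ F.nH r / 16 := by
    have h1 := mul_le_mul_of_nonneg_right hγ hnr
    calc B ^ 2 * F.nV (F.Pi0 (F.incl r)) ≤ B ^ 2 * (1 / (16 * B ^ 2) * F.nH r) := by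
          gcongr; exact hg.trans h1
      _ = F.nH r / 16 := by field_simp
  have hg2 : F.nV (F.Pi0 (F.incl r)) ≤ F.nH r / 16 :=
    le_trans (le_mul_of_one_le_left (F.nV_nonneg _) (one_le_pow₀ hB1)) hg1
  have hPi1 : F.nH r - F.nH r / 16 ≤ F.nH (F.Pi1H r) := by
    have h1 := F.nH_add_le (F.Pi1H r) (F.Pi0H r)
    rw [F.nH_ker (F.D_Pi0H r), incl_Pi0H, Pi1H_eq, sub_add_cancel, ← Pi1H_eq] at h1
    linarith
  have he := hS.energy hB r
  have h1 : (F.nH r - F.nH r / 16) ^ 2 ≤ F.nH (F.Pi1H r) ^ 2 :=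
    pow_le_pow_left₀ (by linarith) hPi1 2
  have h2 : 1 / 4 * F.nH r ^ 2 ≤ (F.ellipticP S r r).re := by
    have := mul_le_mul_of_nonneg_right hg1 hnr
    nlinarith
  have h3 := hB.coer (F.incl q)
  rw [← F.nH_ker hq0] at h3
  have h4 : F.nH w ≤ F.nH r + F.nH q := by
    have := F.nH_add_le r q
    rwa [hr, sub_add_cancel, ← hr] at this
  have h5 : F.nH w ^ 2 ≤ 2 * F.nH r ^ 2 + 2 * F.nH q ^ 2 := by
    have := pow_le_pow_left₀ (F.nH_nonneg w) h4 2
    nlinarith [sq_nonneg (F.nH r - F.nH q)]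
  rw [key, Complex.add_re, div_le_iff₀ (by positivity)]
  nlinarith [sq_nonneg (F.nH r), mul_nonneg (sub_nonneg.2 hB1) (sq_nonneg (F.nH r)), sq_nonneg (F.nH q)]

/-- Solvability of the Galerkin equations of the regularised operator. The test space transformation
`w ↦ w - q' - q` is applied to the adjoint operator, which makes it a transformation of the
solution. -/
lemma Smoother.exists_elliptic_galerkin (hS : F.Smoother Z m B σ S) (hB : F.Bounds B)
    {Hh : Submodule ℂ H} (hHh : IsClosed (Hh : Set H)) {γ : ℝ} (hgap : F.adjoint.Gap Hh γ)
    (hγ : γ ≤ 1 / (16 * B ^ 2)) (φ : AntiDual H) {M : ℝ} (hM : 0 ≤ M)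
    (hφ : ∀ v ∈ Hh, ‖φ v‖ ≤ M * F.nH v) :
    ∃ y ∈ Hh, (∀ v ∈ Hh, F.ellipticP S y v = φ v) ∧ F.nH y ≤ 24 * B ^ 4 * M := by
  have hB1 := hB.one_le
  have hB0 := hB.pos
  have : CompleteSpace Hh := hHh.completeSpace_coe
  obtain ⟨Q, hQ⟩ := hB.exists_kerGalerkin hHh
  obtain ⟨Q', hQ'⟩ := hB.adjoint.exists_kerGalerkin hHh
  let T : H →L[ℂ] H := ContinuousLinearMap.id ℂ H - Q - Q'
  have hT : ∀ w, T w = w - Q w - Q' w := fun w => rfl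
  have hco : ∀ w ∈ Hh, F.nH w ^ 2 / (8 * B) ≤ (F.ellipticP S (T w) w).re := by
    intro w hw
    have h := hS.adjoint.discrete_coercive hB.adjoint hgap hγ hw (hQ' w).1 (hQ w).1 (hQ' w).2.1
      (adjoint_D_eq_zero F |>.2 (hQ w).2.1) (hQ' w).2.2.1 (fun v hv hv0 => by
        rw [adjoint_E_apply, adjoint_incl, (hQ w).2.2.1 v hv (adjoint_D_eq_zero F |>.1 hv0), map_zero])
    rwa [adjoint_ellipticP_apply, Complex.conj_re, adjoint_nH, ← hT] at h
  let b : Hh →L[ℂ] AntiDual Hh :=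
    dualMap Hh.subtypeL ∘L F.ellipticP S ∘L T ∘L Hh.subtypeL
  have hinv : b.IsInvertible :=
    form_isInvertible_of_coercive _ (c := c₁ / (8 * B)) (div_pos F.c₁_pos (by positivity)) fun w => by
      refine le_trans ?_ (hco w w.2)
      rw [div_mul_eq_mul_div]
      gcongr
      exact F.c₁_norm_sq_le_nH_sq w
  set w : Hh := b.inverse (dualMap Hh.subtypeL φ) with hw
  have hbw : b w = dualMap Hh.subtypeL φ := by
    rw [hw]
    obtain ⟨R, hR⟩ := hinv
    rw [← hR]; simp
  have hsol : ∀ v ∈ Hh, F.ellipticP S (T w) v = φ v := fun v hv =>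
    congrArg (fun ψ : AntiDual Hh => ψ ⟨v, hv⟩) hbw
  refine ⟨T w, ?_, hsol, ?_⟩
  · rw [hT]
    exact Hh.sub_mem (Hh.sub_mem w.2 (hQ _).1) (hQ' _).1
  · have hnw := F.nH_nonneg (w : H)
    have h1 : F.nH (w : H) ≤ 8 * B * M := by
      have h2 := hco w w.2
      rw [hsol w w.2, div_le_iff₀ (by positivity)] at h2
      have h3 := (Complex.re_le_norm _).trans (hφ w w.2)
      have h4 := mul_le_mul_of_nonneg_right h3 (show 0 ≤ 8 * B by positivity)
      rcases hnw.eq_or_lt with h | h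
      · rw [← h]
        positivity
      · refine le_of_mul_le_mul_right ?_ h
        linarith
    have h2 : F.nH (Q w) ≤ B ^ 3 * F.nH (w : H) := by
      rw [F.nH_ker (hQ w).2.1]
      calc _ ≤ B ^ 2 * F.nV (F.incl (w : H)) := (hQ w).2.2.2
        _ ≤ B ^ 2 * (B * F.nH (w : H)) := by gcongr; exact hB.nV_le w
        _ = _ := by ring
    have h3 : F.nH (Q' w) ≤ B ^ 3 * F.nH (w : H) := by
      rw [F.nH_ker (adjoint_D_eq_zero F |>.1 (hQ' w).2.1)]
      calc _ ≤ B ^ 2 * F.nV (F.incl (w : H)) := (hQ' w).2.2.2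
        _ ≤ B ^ 2 * (B * F.nH (w : H)) := by gcongr; exact hB.nV_le w
        _ = _ := by ring
    have h4 := F.nH_sub_le ((w : H) - Q w) (Q' w)
    have h5 := F.nH_sub_le (w : H) (Q w)
    have h6 : F.nH (w : H) ≤ B ^ 3 * F.nH (w : H) :=
      le_mul_of_one_le_left hnw (one_le_pow₀ hB1)
    rw [hT]
    calc _ ≤ 3 * B ^ 3 * F.nH (w : H) := by linarith
      _ ≤ 3 * B ^ 3 * (8 * B * M) := by gcongr
      _ = _ := by ring

end

end Setting

end AbsGalerkin

/-! ### Duality, quasi-optimality and solvability of the Galerkin equations -/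

namespace AbsGalerkin

namespace Setting

noncomputable section

variable {H : Type u} {V : Type v} [NormedAddCommGroup H] [InnerProductSpace ℂ H] [CompleteSpace H]
  [NormedAddCommGroup V] [InnerProductSpace ℂ V] [CompleteSpace V] {cE c₁ c₂ : ℝ}

variable (F : Setting H V cE c₁ c₂)

/-- `H_h` approximates `Z (m + 1)` in `H` with constant `δ`. -/
def Approx (Z : ℕ → SubNorm V) (m : ℕ) (Hh : Submodule ℂ H) (δ : ℝ) : Prop :=
  ∀ z : H, ∀ a : ℝ, 0 ≤ a → Z (m + 1) (F.incl z) ≤ ENNReal.ofReal a → ∃ zh ∈ Hh, F.nH (z - zh) ≤ δ * a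

/-- The bound `‖(P^*)⁻¹ Π₁^*‖_{V^* → V} ≤ ρ`, in terms of solutions of the adjoint equation. -/
def SolBound (ρ : ℝ) : Prop :=
  ∀ (φ : AntiDual V) (N : ℝ) (z : H), 0 ≤ N → (∀ v, ‖φ v‖ ≤ N * F.nV v) →
    (∀ v, F.adjoint.P z v = φ (F.Pi1 (F.incl v))) → F.nV (F.incl z) ≤ ρ * N

/-- If `⟨P y, ·⟩` vanishes on `Ker D`, then `Π₀ y = 0`. -/
lemma Pi0_eq_zero_of_P {y : H} (hy : ∀ k, F.D k = 0 → F.P y k = 0) : F.Pi0 (F.incl y) = 0 := by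
  refine F.eq_Pi0 F.K.zero_mem fun k hk => ?_
  obtain ⟨k, hk0, rfl⟩ := F.mem_K.1 hk
  have h := hy k hk0
  rw [P_apply, F.D_adj_ker hk0, zero_sub, neg_eq_zero] at h
  rw [h]; simp

lemma Pi1_of_mem_K {k : V} (hk : k ∈ F.K) : F.Pi1 k = 0 := by
  rw [Pi1_apply, F.Pi0_of_mem hk, sub_self]

variable {F}

/-- The operators `(P^*)⁻¹ Π₁^*` and `P⁻¹ (Π₁')^*`, where `Π₁'` is the projection of `P^*`, are adjoint to
each other and so have the same norm. -/
lemma SolBound.adjoint {ρ : ℝ} (h : F.SolBound ρ)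
    (hsurj : ∀ φ : AntiDual H, ∃ z, F.adjoint.P z = φ) : F.adjoint.SolBound ρ := by
  intro φ N y hN hφ hy
  rw [adjoint_adjoint] at hy
  rw [adjoint_nV] at hφ ⊢
  rw [adjoint_incl] at hy ⊢
  have hy0 : F.Pi1 (F.incl y) = F.incl y := by
    rw [Pi1_apply, F.Pi0_eq_zero_of_P fun k hk => ?_, sub_zero]
    rw [hy, F.adjoint.Pi1_of_mem_K (by rw [adjoint_K]; exact F.incl_mem_K hk), map_zero]
  obtain ⟨z, hz⟩ := hsurj (dualMap F.incl (dualMap F.Pi1 (F.ι (F.incl y))))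
  have hz' : ∀ v, F.adjoint.P z v = F.ι (F.incl y) (F.Pi1 (F.incl v)) := fun v => by rw [hz]; rfl
  have hz0 : F.adjoint.Pi1 (F.incl z) = F.incl z := by
    have h0 : F.adjoint.Pi0 (F.incl z) = 0 := F.adjoint.Pi0_eq_zero_of_P fun k hk => by
      rw [hz', F.Pi1_of_mem_K (F.incl_mem_K (F.adjoint_D_eq_zero.1 hk)), map_zero]
    rw [Pi1_apply, h0, sub_zero]
  have h1 := h (F.ι (F.incl y)) (F.nV (F.incl y)) z (F.nV_nonneg _)
    (fun v => F.norm_ι_le _ _) hz'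
  have h2 := hz' y
  rw [hy0, ι_self, adjoint_P_apply, hy, hz0] at h2
  have h3 := congrArg norm h2
  rw [RCLike.norm_conj, Complex.norm_real, Real.norm_eq_abs, abs_of_nonneg (sq_nonneg _)] at h3
  have h4 := hφ (F.incl z)
  rw [h3] at h4
  rcases (F.nV_nonneg (F.incl y)).eq_or_lt with h5 | h5
  · have h6 := h 0 1 0 zero_le_one (fun v => by have := F.nV_nonneg v; simpa using this) (by simp)
    have : 0 ≤ ρ := by simpa using h6
    rw [← h5]
    positivity
  · refine le_of_mul_le_mul_right ?_ h5
    have h6 := mul_le_mul_of_nonneg_left h1 hN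
    nlinarith

/-- The hypotheses on `P` and on the space `H_h`, in terms of real constants and symmetric in `P` and
`P^*`. -/
structure Admissible (F : Setting H V cE c₁ c₂) (Z : ℕ → SubNorm V) (m : ℕ) (B : ℝ)
    (Hh : Submodule ℂ H) (δ ρ : ℝ) : Prop where
  isClosed : IsClosed (Hh : Set H)
  δ_nonneg : 0 ≤ δ
  ρ_nonneg : 0 ≤ ρ
  surj : ∀ φ : AntiDual H, ∃ z, F.P z = φ
  adj_surj : ∀ φ : AntiDual H, ∃ z, F.adjoint.P z = φ
  gap : F.Gap Hh (1 / (16 * B ^ 2))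
  adj_gap : F.adjoint.Gap Hh (1 / (16 * B ^ 2))
  approx : F.Approx Z m Hh δ
  sol : F.SolBound ρ
  adj_sol : F.adjoint.SolBound ρ

variable {B σ C δ ρ : ℝ} {m : ℕ} {Z : ℕ → SubNorm V} {S : V →L[ℂ] V} {Hh : Submodule ℂ H}

lemma Admissible.adjoint (h : F.Admissible Z m B Hh δ ρ) : F.adjoint.Admissible Z m B Hh δ ρ where
  isClosed := h.isClosed
  δ_nonneg := h.δ_nonneg
  ρ_nonneg := h.ρ_nonneg
  surj := h.adj_surj
  adj_surj := by rw [adjoint_adjoint]; exact h.surj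
  gap := h.adj_gap
  adj_gap := by rw [adjoint_adjoint]; exact h.gap
  approx := by
    intro z a ha hz
    rw [adjoint_nH]; exact h.approx z a ha hz
  sol := h.adj_sol
  adj_sol := by rw [adjoint_adjoint]; exact h.sol

lemma Smoother.ι_ker (hS : F.Smoother Z m B σ S) (x : V) {k : V} (hk : k ∈ F.K) :
    F.ι (S x) k = 0 := by rw [hS.symm, hS.ker k hk, map_zero]

lemma Smoother.ι_sq (hS : F.Smoother Z m B σ S) (x : V) :
    F.ι (S (S x)) x = ((F.nV (S x) ^ 2 : ℝ) : ℂ) := by rw [hS.symm, ι_self]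

/-- Regularity for `P y = ι S x`: the right-hand side is smooth and vanishes on `Ker D`. -/
lemma Smoother.Z_sol_le (hS : F.Smoother Z m B σ S) (hR : F.Regularity m Z C) (hB : F.Bounds B)
    (hm : 1 ≤ m) (hC : 0 < C) (hCB : C ≤ B) {y : H} {x : V}
    (hy : ∀ v, F.P y v = F.ι (S x) (F.incl v)) {M : ℝ} (hM : 0 ≤ M) (hyM : F.nV (F.incl y) ≤ M)
    (hxM : B ^ (m + 1) * (σ * F.nV x) ≤ M) :
    Z (m + 1) (F.incl y) ≤ ENNReal.ofReal (regConst B m * M) := by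
  have hB0 := hB.pos
  refine hR.Z_sol_le hB hm hC hCB (g := S x) (g' := 0) hy (fun k hk => ?_) hM hyM (fun j hj => ?_)
    (fun j _ _ => ?_)
  · rw [hS.ι_ker x hk]; simp
  · refine (hR.Z_le hB hCB (show j ≤ m + 1 by omega) le_rfl _).trans ?_
    refine le_trans ?_ (ENNReal.ofReal_le_ofReal hxM)
    rw [ENNReal.ofReal_mul (by positivity), ENNReal.ofReal_pow hB0.le]
    gcongr
    exact hS.reg x
  · simp

lemma one_le_regConst (hB : 1 ≤ B) (m : ℕ) : 1 ≤ regConst B m := by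
  have h1 : 1 ≤ 2 * B ^ 2 := by nlinarith
  have h2 : 1 ≤ 4 * (2 * B ^ 2) ^ 3 := by have := one_le_pow₀ h1 (n := 3); linarith
  have h3 : 1 ≤ 4 * B ^ 3 := by have := one_le_pow₀ hB (n := 3); linarith
  exact one_le_mul_of_one_le_of_one_le (one_le_pow₀ h2) h3

/-- The constant of the duality estimate for the regularised operator. -/
def ellipticDualConst (B σ : ℝ) (m : ℕ) : ℝ :=
  2 * σ ^ 2 * B ^ 2 * (regConst B m * (B ^ (m + 1) * (25 * B ^ 6 * σ ^ 3)))

/-- Aubin--Nitsche duality for the regularised operator, whose inverse is bounded by a constant. -/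
lemma Smoother.elliptic_duality (hS : F.Smoother Z m B σ S) (hR : F.Regularity m Z C)
    (hB : F.Bounds B) (hm : 1 ≤ m) (hC : 0 < C) (hCB : C ≤ B) (happ : F.Approx Z m Hh δ)
    {η : H} (hη : ∀ v ∈ Hh, F.ellipticP S v η = 0) :
    F.nV (S (F.incl η)) ≤ ellipticDualConst B σ m * δ * F.nH η := by
  have hB1 := hB.one_le
  have hB0 := hB.pos
  have hσ := hS.one_le
  set s := F.nV (S (F.incl η)) with hs
  have hs0 : 0 ≤ s := F.nV_nonneg _
  obtain ⟨y, -, hy, hyM⟩ := hS.exists_elliptic_galerkin hB (Hh := ⊤) isClosed_univ gap_top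
    (by positivity) (dualMap F.incl (F.ι (S (S (F.incl η))))) (M := B * (σ * s)) (by positivity)
    (fun v _ => by
      rw [dualMap_apply]
      refine (F.norm_ι_le _ _).trans ?_
      calc _ ≤ (σ * s) * (B * F.nH v) := by
            have := F.nV_nonneg (F.incl v)
            gcongr
            · exact hS.nV_le _
            · exact hB.nV_le v
        _ = _ := by ring)
  have hy' : ∀ v, F.ellipticP S y v = F.ι (S (S (F.incl η))) (F.incl v) := fun v => hy v trivial
  have hyV : F.nV (F.incl y) ≤ 24 * B ^ 6 * σ * s := by
    calc _ ≤ B * F.nH y := hB.nV_le y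
      _ ≤ B * (24 * B ^ 4 * (B * (σ * s))) := by gcongr
      _ = _ := by ring
  have hP : ∀ v, F.P y v = F.ι (S (S (F.incl η) - S (F.incl y))) (F.incl v) := by
    intro v
    have h := hy' v
    rw [ellipticP_apply, ← hS.symm] at h
    rw [map_sub, form_sub_left, ← h]
    ring
  have hx : F.nV (S (F.incl η) - S (F.incl y)) ≤ 25 * B ^ 6 * σ ^ 2 * s := by
    have h1 := (F.nV_sub_le (S (F.incl η)) (S (F.incl y)))
    have h2 := hS.nV_le (F.incl y)
    have h3 : σ * F.nV (F.incl y) ≤ σ * (24 * B ^ 6 * σ * s) := by gcongr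
    have h4 : s ≤ B ^ 6 * σ ^ 2 * s :=
      le_mul_of_one_le_left hs0 (one_le_mul_of_one_le_of_one_le (one_le_pow₀ hB1) (one_le_pow₀ hσ))
    linarith
  have hM1 : 1 ≤ B ^ (m + 1) * σ ^ 2 :=
    one_le_mul_of_one_le_of_one_le (one_le_pow₀ hB1) (one_le_pow₀ hσ)
  have hZ := hS.Z_sol_le hR hB hm hC hCB hP (M := B ^ (m + 1) * (25 * B ^ 6 * σ ^ 3) * s)
    (by positivity)
    (by
      have h : 24 * B ^ 6 * σ * s ≤ (B ^ (m + 1) * σ ^ 2) * (25 * B ^ 6 * σ * s) := by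
        calc 24 * B ^ 6 * σ * s ≤ 1 * (25 * B ^ 6 * σ * s) := by
              have : 0 ≤ B ^ 6 * σ * s := by positivity
              linarith
          _ ≤ _ := by gcongr
      refine hyV.trans (h.trans (le_of_eq ?_))
      ring)
    (by
      calc _ ≤ B ^ (m + 1) * (σ * (25 * B ^ 6 * σ ^ 2 * s)) := by gcongr
        _ = _ := by ring)
  have hreg := one_le_regConst hB1 m
  obtain ⟨yh, hyh, hyd⟩ := happ y _ (by positivity) hZ
  have h1 : ((s ^ 2 : ℝ) : ℂ) = F.ellipticP S (y - yh) η := by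
    rw [form_sub_left, hη yh hyh, sub_zero, hy', hS.ι_sq]
  have h2 := congrArg norm h1
  rw [Complex.norm_real, Real.norm_eq_abs, abs_of_nonneg (sq_nonneg _)] at h2
  have h3 := hS.norm_ellipticP_le hB (y - yh) η
  rw [← h2] at h3
  have hnη := F.nH_nonneg η
  have h4 : s ^ 2 ≤ ellipticDualConst B σ m * δ * F.nH η * s := by
    calc s ^ 2 ≤ 2 * σ ^ 2 * B ^ 2 * F.nH (y - yh) * F.nH η := h3
      _ ≤ 2 * σ ^ 2 * B ^ 2 *
          (δ * (regConst B m * (B ^ (m + 1) * (25 * B ^ 6 * σ ^ 3) * s))) * F.nH η := by gcongr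
      _ = _ := by rw [ellipticDualConst]; ring
  rcases hs0.eq_or_lt with h | h
  · have hδ : 0 ≤ δ * F.nH η := by
      obtain ⟨z, -, hz⟩ := happ 0 1 zero_le_one (by simp)
      have := F.nH_nonneg (0 - z)
      have : 0 ≤ δ := by linarith
      positivity
    rw [← h, mul_assoc]
    unfold ellipticDualConst
    positivity
  · refine le_of_mul_le_mul_right ?_ h
    linarith

/-- The constant of the estimate of the elliptic projection of the solution of the dual problem. -/
def dualConst (B σ : ℝ) (m : ℕ) : ℝ :=
  49 * B ^ 6 * σ ^ 2 * (regConst B m * (B ^ (m + 1) * σ))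

/-- Duality for `P`. The dual solution `z` is approximated by its Galerkin projection for the
regularised operator, so that only `⟨P e, z - z_h⟩ = ⟨P^# (u - v_h), z - z_h⟩ - (S e, S (z - z_h))_V`
has to be estimated; in the last term a second duality argument gains the additional factor `δ`. -/
lemma Smoother.duality (hS : F.Smoother Z m B σ S) (hR : F.Regularity m Z C)
    (hR' : F.adjoint.Regularity m Z C) (hB : F.Bounds B) (hm : 1 ≤ m) (hC : 0 < C) (hCB : C ≤ B)
    (hA : F.Admissible Z m B Hh δ ρ)
    (hδρ : dualConst B σ m * ellipticDualConst B σ m * (δ ^ 2 * (1 + ρ)) ≤ 1 / 2) {e x : H}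
    (hex : e - x ∈ Hh) (he : ∀ v ∈ Hh, F.P e v = 0) :
    F.nV (S (F.incl e)) ≤ 4 * σ ^ 2 * B ^ 2 * dualConst B σ m * (δ * (1 + ρ)) * F.nH x := by
  have hB1 := hB.one_le
  have hB0 := hB.pos
  have hσ := hS.one_le
  have hδ := hA.δ_nonneg
  have hρ := hA.ρ_nonneg
  have hreg := one_le_regConst hB1 m
  set s := F.nV (S (F.incl e)) with hs
  have hs0 : 0 ≤ s := F.nV_nonneg _
  set φ := F.ι (S (S (F.incl e))) with hφ
  obtain ⟨z, hz⟩ := hA.adj_surj (dualMap F.incl φ)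
  have hz' : ∀ v, F.adjoint.P z v = φ (F.incl v) := fun v => by rw [hz]; rfl
  have hzV : F.nV (F.incl z) ≤ ρ * (σ * s) := by
    refine hA.sol φ (σ * s) z (by positivity) (fun v => ?_) (fun v => ?_)
    · refine (F.norm_ι_le _ _).trans ?_
      have := F.nV_nonneg v
      gcongr
      exact hS.nV_le _
    · rw [hz', Pi1_apply, map_sub, hφ, hS.ι_ker _ (F.Pi0_mem _), sub_zero]
  have hZ := hS.adjoint.Z_sol_le hR' hB.adjoint hm hC hCB hz'
    (M := B ^ (m + 1) * σ * (1 + ρ) * s) (by positivity)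
    (by
      rw [adjoint_nV, adjoint_incl]
      calc _ ≤ ρ * (σ * s) := hzV
        _ ≤ (1 + ρ) * (σ * s) := by gcongr; linarith
        _ ≤ B ^ (m + 1) * ((1 + ρ) * (σ * s)) :=
          le_mul_of_one_le_left (by positivity) (one_le_pow₀ hB1)
        _ = _ := by ring)
    (by
      rw [adjoint_nV]
      calc B ^ (m + 1) * (σ * s) ≤ B ^ (m + 1) * (σ * s) * (1 + ρ) :=
            le_mul_of_one_le_right (by positivity) (by linarith)
        _ = _ := by ring)
  obtain ⟨z₀, hz₀, hzd⟩ := hA.approx z _ (by positivity) hZ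
  obtain ⟨t, ht, htsol, htn⟩ := hS.adjoint.exists_elliptic_galerkin hB.adjoint hA.isClosed
    (by rw [adjoint_adjoint]; exact hA.gap) le_rfl (F.adjoint.ellipticP S (z - z₀))
    (M := 2 * σ ^ 2 * B ^ 2 * F.nH (z - z₀)) (by have := F.nH_nonneg (z - z₀); positivity)
    (fun v _ => by
      have := hS.adjoint.norm_ellipticP_le hB.adjoint (z - z₀) v
      rwa [adjoint_nH] at this ⊢)
  rw [adjoint_nH] at htn
  set η := z - z₀ - t with hη
  have hηP : ∀ v ∈ Hh, F.ellipticP S v η = 0 := by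
    intro v hv
    have h : F.adjoint.ellipticP S η v = 0 := by rw [hη, form_sub_left, htsol v hv, sub_self]
    rw [adjoint_ellipticP_apply] at h
    simpa using h
  have hηn : F.nH η ≤ dualConst B σ m * (δ * (1 + ρ)) * s := by
    have h1 := F.nH_sub_le (z - z₀) t
    have h2 := F.nH_nonneg (z - z₀)
    have h3 : F.nH (z - z₀) ≤ B ^ 6 * σ ^ 2 * F.nH (z - z₀) :=
      le_mul_of_one_le_left h2 (one_le_mul_of_one_le_of_one_le (one_le_pow₀ hB1) (one_le_pow₀ hσ))
    calc F.nH η ≤ 49 * B ^ 6 * σ ^ 2 * F.nH (z - z₀) := by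
          have : 24 * B ^ 4 * (2 * σ ^ 2 * B ^ 2 * F.nH (z - z₀)) =
            48 * (B ^ 6 * σ ^ 2 * F.nH (z - z₀)) := by ring
          linarith
      _ ≤ 49 * B ^ 6 * σ ^ 2 * (δ * (regConst B m * (B ^ (m + 1) * σ * (1 + ρ) * s))) := by gcongr
      _ = _ := by rw [dualConst]; ring
  have hSη := hS.elliptic_duality hR hB hm hC hCB hA.approx hηP
  have hid : ((s ^ 2 : ℝ) : ℂ) = F.ellipticP S x η - F.ι (S (F.incl e)) (S (F.incl η)) := by
    have h1 : ((s ^ 2 : ℝ) : ℂ) = F.P e z := by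
      have h := hz' e
      rw [adjoint_P_apply, hφ, hS.ι_sq] at h
      have h' := congrArg (starRingEnd ℂ) h
      rw [Complex.conj_conj, Complex.conj_ofReal] at h'
      exact h'.symm
    have h2 : F.P e z = F.P e η := by
      rw [hη, map_sub, map_sub, he _ hz₀, he _ ht, sub_zero, sub_zero]
    have h3 : F.ellipticP S e η = F.ellipticP S x η := by
      have h := hηP _ hex
      rw [form_sub_left] at h
      exact sub_eq_zero.1 h
    rw [h1, h2, ← h3, ellipticP_apply]
    ring
  have hn := congrArg norm hid
  rw [Complex.norm_real, Real.norm_eq_abs, abs_of_nonneg (sq_nonneg _)] at hn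
  have hx := F.nH_nonneg x
  have hd0 : 0 ≤ dualConst B σ m := by unfold dualConst; positivity
  have hd0' : 0 ≤ ellipticDualConst B σ m := by unfold ellipticDualConst; positivity
  have h1 : s ^ 2 ≤ 2 * σ ^ 2 * B ^ 2 * F.nH x * F.nH η + s * F.nV (S (F.incl η)) := by
    rw [hn]
    exact (norm_sub_le _ _).trans (add_le_add (hS.norm_ellipticP_le hB x η) (F.norm_ι_le _ _))
  have h2 : s ^ 2 ≤ 2 * σ ^ 2 * B ^ 2 * dualConst B σ m * (δ * (1 + ρ)) * F.nH x * s +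
      dualConst B σ m * ellipticDualConst B σ m * (δ ^ 2 * (1 + ρ)) * s ^ 2 := by
    calc s ^ 2 ≤ 2 * σ ^ 2 * B ^ 2 * F.nH x * (dualConst B σ m * (δ * (1 + ρ)) * s) +
          s * (ellipticDualConst B σ m * δ * (dualConst B σ m * (δ * (1 + ρ)) * s)) := by
          refine h1.trans ?_
          gcongr
          exact hSη.trans (by gcongr)
      _ = _ := by ring
  have h3 := mul_le_mul_of_nonneg_right hδρ (sq_nonneg s)
  rcases hs0.eq_or_lt with h | h
  · rw [← h]; positivity
  · refine le_of_mul_le_mul_right ?_ h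
    nlinarith

/-- The `Ker D`-part of the Galerkin error. -/
lemma Bounds.nV_Pi0_error_le (hB : F.Bounds B) (hHh : IsClosed (Hh : Set H)) {γ : ℝ}
    (hgap : F.Gap Hh γ) (hγ : 0 ≤ γ) (hγ1 : γ ≤ 1) {e x : H} (hex : e - x ∈ Hh)
    (he : ∀ v ∈ Hh, F.P e v = 0) :
    F.nV (F.Pi0 (F.incl e)) ≤ 4 * B ^ 5 * F.nH x + γ * F.nH e := by
  have hB1 := hB.one_le
  have hB0 := hB.pos
  have hx := F.nH_nonneg x
  obtain ⟨Q, hQ⟩ := hB.exists_kerGalerkin hHh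
  obtain ⟨hq, hq0, hqE, hqn⟩ := hQ x
  set q := Q x
  have hqn' : F.nV (F.incl q) ≤ B ^ 3 * F.nH x := by
    calc _ ≤ B ^ 2 * F.nV (F.incl x) := hqn
      _ ≤ B ^ 2 * (B * F.nH x) := by gcongr; exact hB.nV_le x
      _ = _ := by ring
  have h1 := hgap (e - x + q) (Hh.add_mem hex hq) (fun v hv hv0 => by
    have h := he v hv
    rw [P_apply, F.D_adj_ker hv0, zero_sub, neg_eq_zero] at h
    have h' := hqE v hv hv0
    rw [show e - x + q = e - (x - q) by abel, map_sub, form_sub_left, h, h', sub_zero])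
  have h2 : F.Pi0 (F.incl e) = F.Pi0 (F.incl x - F.incl q) + F.Pi0 (F.incl (e - x + q)) := by
    rw [← map_add, ← map_sub, ← map_add]
    congr 2
    abel
  have h3 : F.nV (F.Pi0 (F.incl x - F.incl q)) ≤ 2 * B ^ 5 * F.nH x := by
    have h4 : B ≤ B ^ 3 := le_self_pow₀ hB1 (by norm_num)
    calc _ ≤ B ^ 2 * F.nV (F.incl x - F.incl q) := hB.nV_Pi0_le _
      _ ≤ B ^ 2 * (B ^ 3 * F.nH x + B ^ 3 * F.nH x) := by
        gcongr
        refine (F.nV_sub_le _ _).trans (add_le_add ((hB.nV_le x).trans ?_) hqn')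
        gcongr
      _ = _ := by ring
  have h5 : F.nH (e - x + q) ≤ F.nH e + 2 * B ^ 5 * F.nH x := by
    have h6 := F.nH_add_le (e - x) q
    have h7 := F.nH_sub_le e x
    rw [F.nH_ker hq0] at h6
    have h8 : B ^ 3 * F.nH x ≤ B ^ 5 * F.nH x := by gcongr; norm_num
    have h9 : F.nH x ≤ B ^ 5 * F.nH x := le_mul_of_one_le_left hx (one_le_pow₀ hB1)
    linarith
  rw [h2]
  refine (F.nV_add_le _ _).trans ?_
  have h6 := mul_le_mul_of_nonneg_left h5 hγ
  have h7 : γ * (2 * B ^ 5 * F.nH x) ≤ 1 * (2 * B ^ 5 * F.nH x) := by gcongr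
  linarith

/-- The Galerkin error is controlled by the approximation error and by the smoothed error `S e`. -/
lemma Smoother.nH_error_le (hS : F.Smoother Z m B σ S) (hB : F.Bounds B)
    (hHh : IsClosed (Hh : Set H)) (hgap : F.Gap Hh (1 / (16 * B ^ 2))) {e x : H}
    (hex : e - x ∈ Hh) (he : ∀ v ∈ Hh, F.P e v = 0) :
    F.nH e ≤ 31 * B ^ 7 * F.nH x + 3 * F.nV (S (F.incl e)) := by
  have hB1 := hB.one_le
  have hB0 := hB.pos
  have hx := F.nH_nonneg x
  have hA := F.nH_nonneg e
  have hs := F.nV_nonneg (S (F.incl e))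
  have hp0 := F.nV_nonneg (F.Pi0 (F.incl e))
  have hγ1 : 1 / (16 * B ^ 2) ≤ 1 / 16 := by
    apply one_div_le_one_div_of_le (by norm_num)
    nlinarith
  have hγB : 1 / (16 * B ^ 2) * B ^ 2 = 1 / 16 := by field_simp
  have hp := hB.nV_Pi0_error_le hHh hgap (by positivity) (hγ1.trans (by norm_num)) hex he
  have hen := hS.energy hB e
  have hPe : F.P e e = F.P e x := by
    have h := he _ hex
    rw [map_sub] at h
    exact sub_eq_zero.1 h
  rw [ellipticP_apply, hPe, ι_self, Complex.add_re, Complex.ofReal_re] at hen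
  have h1 := (Complex.re_le_norm _).trans (hB.P_le e x)
  have h2 : F.nH e ≤ F.nH (F.Pi1H e) + F.nV (F.Pi0 (F.incl e)) := by
    have h := F.nH_add_le (F.Pi1H e) (F.Pi0H e)
    rwa [F.nH_ker (F.D_Pi0H e), incl_Pi0H, Pi1H_eq, sub_add_cancel, ← Pi1H_eq] at h
  set γ := 1 / (16 * B ^ 2)
  set A := F.nH e
  set X := F.nH x
  set s := F.nV (S (F.incl e))
  set p := F.nV (F.Pi0 (F.incl e))
  set a := F.nH (F.Pi1H e)
  have h3 : A ^ 2 ≤ 2 * a ^ 2 + 2 * p ^ 2 := by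
    have := pow_le_pow_left₀ hA h2 2
    nlinarith [sq_nonneg (a - p)]
  have h4 : B ^ 2 * p ≤ 4 * B ^ 7 * X + A / 16 := by
    calc B ^ 2 * p ≤ B ^ 2 * (4 * B ^ 5 * X + γ * A) := by gcongr
      _ = 4 * B ^ 7 * X + (γ * B ^ 2) * A := by ring
      _ = _ := by rw [hγB]; ring
  have h5 : p ≤ 4 * B ^ 7 * X + A / 16 := le_trans (le_mul_of_one_le_left hp0 (one_le_pow₀ hB1)) h4
  have h6 : B * X ≤ B ^ 7 * X := by
    gcongr
    exact le_self_pow₀ hB1 (by norm_num)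
  have h7 := mul_le_mul_of_nonneg_right h4 hA
  have h8 := pow_le_pow_left₀ hp0 h5 2
  have h9 := mul_le_mul_of_nonneg_right h6 hA
  have hY : 0 ≤ B ^ 7 * X := by positivity
  have h10 : B * A * X = B * X * A := by ring
  have e7 : 4 * B ^ 7 * X = 4 * (B ^ 7 * X) := by ring
  have e31 : 31 * B ^ 7 * X = 31 * (B ^ 7 * X) := by ring
  rw [e7] at h7 h8
  rw [e31]
  generalize B ^ 7 * X = Y at *
  rw [h10] at h1
  refine (sq_le_sq₀ hA (by positivity)).1 ?_
  nlinarith [sq_nonneg (A / 2 - 20 * Y), mul_nonneg hY hs, sq_nonneg (A - 4 * Y), sq_nonneg Y, sq_nonneg s]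

/-- The quasi-optimality constant. -/
def quasiOptConst (B σ : ℝ) (m : ℕ) : ℝ :=
  31 * B ^ 7 + 12 * σ ^ 2 * B ^ 2 * dualConst B σ m

lemma Smoother.quasi_optimal (hS : F.Smoother Z m B σ S) (hR : F.Regularity m Z C)
    (hR' : F.adjoint.Regularity m Z C) (hB : F.Bounds B) (hm : 1 ≤ m) (hC : 0 < C) (hCB : C ≤ B)
    (hA : F.Admissible Z m B Hh δ ρ)
    (hδρ : dualConst B σ m * ellipticDualConst B σ m * (δ ^ 2 * (1 + ρ)) ≤ 1 / 2) {e x : H}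
    (hex : e - x ∈ Hh) (he : ∀ v ∈ Hh, F.P e v = 0) :
    F.nH e ≤ quasiOptConst B σ m * (1 + δ * (1 + ρ)) * F.nH x := by
  have h1 := hS.nH_error_le hB hA.isClosed hA.gap hex he
  have h2 := hS.duality hR hR' hB hm hC hCB hA hδρ hex he
  have hB0 := hB.pos
  have hδ := hA.δ_nonneg
  have hρ := hA.ρ_nonneg
  have hx := F.nH_nonneg x
  have hreg := one_le_regConst hB.one_le m
  have hσ := hS.one_le
  have hd0 : 0 ≤ dualConst B σ m := by unfold dualConst; positivity
  have h3 : 0 ≤ 12 * σ ^ 2 * B ^ 2 * dualConst B σ m * F.nH x := by positivity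
  have h4 : 0 ≤ 31 * B ^ 7 * (δ * (1 + ρ)) * F.nH x := by positivity
  rw [quasiOptConst]
  nlinarith

/-- Existence of the Galerkin solution: the quasi-optimality estimate for `P` bounds the discrete
operator from below, and the one for `P^*` shows that its adjoint is injective. -/
lemma Smoother.exists_galerkin (hS : F.Smoother Z m B σ S) (hR : F.Regularity m Z C)
    (hR' : F.adjoint.Regularity m Z C) (hB : F.Bounds B) (hm : 1 ≤ m) (hC : 0 < C) (hCB : C ≤ B)
    (hinj : Function.Injective F.P) (hA : F.Admissible Z m B Hh δ ρ)
    (hδρ : dualConst B σ m * ellipticDualConst B σ m * (δ ^ 2 * (1 + ρ)) ≤ 1 / 2) (u : H) :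
    ∃ uh, F.IsGalerkin Hh u uh := by
  have : CompleteSpace Hh := hA.isClosed.completeSpace_coe
  let A : Hh →L[ℂ] AntiDual Hh := dualMap Hh.subtypeL ∘L F.P ∘L Hh.subtypeL
  let R : H ≃L[ℂ] AntiDual H := ContinuousLinearEquiv.ofBijective F.P (LinearMap.ker_eq_bot.2 hinj)
    (LinearMap.range_eq_top.2 hA.surj)
  have hRa : ∀ φ, F.P (R.symm φ) = φ := fun φ => R.apply_symm_apply φ
  obtain ⟨c, hc, hcH⟩ := F.exists_nH_le
  set κ := quasiOptConst B σ m * (1 + δ * (1 + ρ)) with hκ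
  have hκ0 : 0 ≤ κ := by
    have hB0 := hB.pos
    have hδ := hA.δ_nonneg
    have hρ := hA.ρ_nonneg
    have hreg := one_le_regConst hB.one_le m
    have hσ := hS.one_le
    rw [hκ]; unfold quasiOptConst dualConst
    positivity
  have hbelow : ∀ w : Hh, √c₁ * ‖w‖ ≤ ((κ + 1) * c * ‖(R.symm : AntiDual H →L[ℂ] H)‖) * ‖A w‖ := by
    intro w
    let φ : AntiDual H := dualMap Hh.orthogonalProjectionOnto (A w)
    have hφ : ‖φ‖ ≤ ‖A w‖ := by
      refine ContinuousLinearMap.opNorm_le_bound _ (norm_nonneg _) fun v => ?_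
      refine ((A w).le_opNorm _).trans ?_
      gcongr
      exact Hh.norm_orthogonalProjectionOnto_apply_le v
    have hsol : ∀ v ∈ Hh, F.P (R.symm φ - w) v = 0 := by
      intro v hv
      rw [form_sub_left, hRa]
      change A w (Hh.orthogonalProjectionOnto ((⟨v, hv⟩ : Hh) : H)) - A w ⟨v, hv⟩ = 0
      rw [Submodule.orthogonalProjectionOnto_mem_subspace_eq_self, sub_self]
    have h1 := hS.quasi_optimal hR hR' hB hm hC hCB hA hδρ (x := R.symm φ)
      (by simp) hsol
    have h2 : F.nH (w : H) ≤ (κ + 1) * F.nH (R.symm φ) := by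
      have h3 := F.nH_sub_le (R.symm φ) (R.symm φ - w)
      rw [sub_sub_cancel] at h3
      linarith
    have h4 : ‖R.symm φ‖ ≤ ‖(R.symm : AntiDual H →L[ℂ] H)‖ * ‖A w‖ :=
      ((R.symm : AntiDual H →L[ℂ] H).le_opNorm φ).trans (by gcongr)
    calc √c₁ * ‖w‖ ≤ F.nH (w : H) := F.norm_le_nH w
      _ ≤ (κ + 1) * F.nH (R.symm φ) := h2
      _ ≤ (κ + 1) * (c * (‖(R.symm : AntiDual H →L[ℂ] H)‖ * ‖A w‖)) := by
        gcongr
        exact (hcH _).trans (by gcongr)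
      _ = _ := by ring
  set D := (κ + 1) * c * ‖(R.symm : AntiDual H →L[ℂ] H)‖ with hD
  have hD0 : 0 ≤ D := by positivity
  have hc₁ := Real.sqrt_pos.2 F.c₁_pos
  obtain ⟨uh, huh⟩ := form_surjective A (c := √c₁ / (D + 1)) (by positivity)
    (fun w => by
      rw [div_mul_eq_mul_div, div_le_iff₀ (by positivity)]
      refine (hbelow w).trans ?_
      nlinarith [norm_nonneg (A w)])
    (fun v hv => by
      have h1 := hS.adjoint.quasi_optimal hR' (by rw [adjoint_adjoint]; exact hR) hB.adjoint hm hC hCB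
        hA.adjoint hδρ (e := (v : H)) (x := 0) (by simp) (fun w hw => by
          rw [adjoint_P_apply]
          have : F.P w v = 0 := hv ⟨w, hw⟩
          rw [this, map_zero])
      rw [nH_zero, mul_zero, adjoint_nH] at h1
      exact Subtype.ext (F.eq_zero_of_nH _ (le_antisymm h1 (F.nH_nonneg _))))
    (dualMap Hh.subtypeL (F.P u))
  refine ⟨uh, uh.2, fun v hv => ?_⟩
  rw [form_sub_left, sub_eq_zero]
  exact (congrArg (fun φ : AntiDual Hh => φ ⟨v, hv⟩) huh).symm

end

end Setting

end AbsGalerkin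

/-! ### From extended norms to real constants -/

namespace AbsGalerkin

namespace Setting

noncomputable section

variable {H : Type u} {V : Type v} [NormedAddCommGroup H] [InnerProductSpace ℂ H] [CompleteSpace H]
  [NormedAddCommGroup V] [InnerProductSpace ℂ V] [CompleteSpace V] {cE c₁ c₂ : ℝ}

/-- A constant that dominates all the constants of the setting. -/
def boundConst (MP ME cE c₂ C : ℝ) : ℝ := 1 + |C| + |ME| + |MP| + |c₂ / cE|

lemma bounds_of_norm_le (F : Setting H V cE c₁ c₂) {MP ME : ℝ} (C : ℝ)
    (hP : F.normP ≤ ENNReal.ofReal MP) (hE : F.normE ≤ ENNReal.ofReal ME) :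
    F.Bounds (boundConst MP ME cE c₂ C) := by
  have hP' := norm_form_le_of_opENorm_le (N := F.nH) F.nH_smul F.eq_zero_of_nH F.nH_nonneg
    (abs_nonneg MP) (hP.trans (ENNReal.ofReal_le_ofReal (le_abs_self MP)))
  have hE' := norm_form_le_of_opENorm_le (N := F.nV) F.nV_smul F.eq_zero_of_nV F.nV_nonneg
    (abs_nonneg ME) (hE.trans (ENNReal.ofReal_le_ofReal (le_abs_self ME)))
  have a1 := abs_nonneg C
  have a2 := abs_nonneg ME
  have a3 := abs_nonneg MP
  have a4 := abs_nonneg (c₂ / cE)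
  have hEpos : ∀ v, 0 ≤ (F.E v v).re := fun v => by
    have := F.coercive v
    have := F.cE_pos
    nlinarith [sq_nonneg ‖v‖]
  unfold boundConst
  refine ⟨by linarith, fun v => ?_, fun u v => ?_, fun u v => ?_, fun v => ?_⟩
  · -- `Re D = Re P + Re E ≥ Re P` bounds `‖v‖_V² = ‖v‖_H² - Re ⟨D v, v⟩`.
    have h1 := F.nH_sq v
    have h2 := (neg_le_of_abs_le (Complex.abs_re_le_norm _)).trans' (neg_le_neg (hP' v v))
    rw [P_apply, Complex.sub_re] at h2
    have h3 := hEpos (F.incl v)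
    have hn := F.nH_nonneg v
    have h4 : F.nV (F.incl v) ^ 2 ≤ ((1 + |MP|) * F.nH v) ^ 2 := by
      nlinarith [mul_nonneg a3 (sq_nonneg (F.nH v)), mul_nonneg (mul_nonneg a3 a3) (sq_nonneg (F.nH v))]
    have h5 := (sq_le_sq₀ (F.nV_nonneg _) (by positivity)).1 h4
    refine h5.trans (mul_le_mul_of_nonneg_right ?_ hn)
    linarith
  · refine (hE' u v).trans ?_
    have := F.nV_nonneg u
    have := F.nV_nonneg v
    gcongr
    linarith
  · refine (hP' u v).trans ?_
    have := F.nH_nonneg u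
    have := F.nH_nonneg v
    gcongr
    linarith
  · have h1 := F.coercive v
    have h2 := hEpos v
    have h3 := F.cE_pos
    have h4 := F.c₂_pos
    calc F.nV v ^ 2 = c₂ / cE * (cE * ‖v‖ ^ 2) := by rw [nV_sq]; field_simp
      _ ≤ c₂ / cE * (F.E v v).re := by gcongr
      _ ≤ _ := by
        gcongr
        linarith [le_abs_self (c₂ / cE)]

variable {F : Setting H V cE c₁ c₂}

lemma gap_of_gammaDv_le {Hh : Submodule ℂ H} {γ : ℝ} (hγ : 0 ≤ γ)
    (h : F.gammaDv Hh ≤ ENNReal.ofReal γ) : F.Gap Hh γ := by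
  intro w hw hwE
  rcases (F.nH_nonneg w).eq_or_lt with h0 | h0
  · rw [F.eq_zero_of_nH w h0.symm]; simp
  have h1 : F.normV (F.Pi0 (F.incl w)) / F.normH w ≤ ENNReal.ofReal γ := by
    refine le_trans ?_ h
    unfold gammaDv
    exact le_iSup₂_of_le w ⟨hw, fun v hv => hwE v hv.1 hv.2⟩ le_rfl
  rw [normV_eq, normH_eq, ← ENNReal.ofReal_div_of_pos h0, ENNReal.ofReal_le_ofReal_iff hγ,
    div_le_iff₀ h0] at h1
  exact h1

lemma projH_error_le {Z : SubNorm V} {Hh : Submodule ℂ H} (hδ : F.projErr Hh Z ≠ ∞) {z : H} {a : ℝ}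
    (ha : 0 ≤ a) (hz : Z (F.incl z) ≤ ENNReal.ofReal a) :
    F.nH (z - F.projH Hh z) ≤ (F.projErr Hh Z).toReal * a := by
  have h1 := le_opENorm_mul (N := fun v : H => Z (F.incl v)) (M := F.normH)
    (T := fun v => v - (F.projH Hh v : H)) (x := z)
    (fun a x => by rw [_root_.map_smul, Z.smul'])
    (fun a x => by
      have : a • x - (F.projH Hh (a • x) : H) = a • (x - (F.projH Hh x : H)) := by
        rw [_root_.map_smul, smul_sub]; rfl
      rw [this, normH_eq, normH_eq, nH_smul, ENNReal.ofReal_mul (norm_nonneg _), ofReal_norm])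
    (fun h0 => by
      have hz0 : z = 0 := F.incl_injective (by rw [(Z.eq_zero_iff' _).1 h0, map_zero])
      rw [hz0, map_zero, ZeroMemClass.coe_zero, sub_zero, normH_eq, nH_zero, ENNReal.ofReal_zero])
    (ne_top_of_le_ne_top ENNReal.ofReal_ne_top hz)
  change F.normH (z - (F.projH Hh z : H)) ≤ F.projErr Hh Z * Z (F.incl z) at h1
  rw [← ENNReal.ofReal_le_ofReal_iff (by positivity), ENNReal.ofReal_mul ENNReal.toReal_nonneg,
    ENNReal.ofReal_toReal hδ]
  exact h1.trans (by gcongr)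

lemma approx_projErr {Z : ℕ → SubNorm V} {m : ℕ} {Hh : Submodule ℂ H}
    (hδ : F.projErr Hh (Z (m + 1)) ≠ ∞) : F.Approx Z m Hh (F.projErr Hh (Z (m + 1))).toReal :=
  fun z _ ha hz => ⟨F.projH Hh z, (F.projH Hh z).2, projH_error_le hδ ha hz⟩

lemma norm_le_dualENorm_mul (φ : AntiDual V) (v : V) :
    ‖φ v‖ₑ ≤ dualENorm F.normV φ * F.normV v :=
  le_opENorm_mul (N := F.normV) (M := fun a : ℂ => ‖a‖ₑ) (T := φ) (x := v)
    (fun a x => by rw [normV_eq, normV_eq, nV_smul, ENNReal.ofReal_mul (norm_nonneg _), ofReal_norm])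
    (fun a x => by
      rw [ContinuousLinearMap.map_smulₛₗ, smul_eq_mul, enorm_mul, ← ofReal_norm, RCLike.norm_conj,
        ofReal_norm])
    (fun h0 => by
      rw [normV_eq, ENNReal.ofReal_eq_zero] at h0
      rw [F.eq_zero_of_nV v (le_antisymm h0 (F.nV_nonneg v))]; simp)
    ENNReal.ofReal_ne_top

variable (F) in
/-- The operator `(P^*)⁻¹ Π₁^* : V^* → V` whose norm is `F.solNorm`. -/
def solOp : AntiDual V →L[ℂ] V :=
  F.incl ∘L F.adjoint.P.inverse ∘L dualMap F.incl ∘L dualMap F.Pi1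

lemma solNorm_ne_top : F.solNorm ≠ ∞ := by
  have hc : 0 < √c₂ := Real.sqrt_pos.2 F.c₂_pos
  refine ne_top_of_le_ne_top (b := ENNReal.ofReal (√c₂ * (‖F.solOp‖ * √c₂))) ENNReal.ofReal_ne_top ?_
  unfold solNorm opENorm
  refine iSup₂_le fun φ hφ => ?_
  change F.normV (F.solOp φ) ≤ _
  refine ENNReal.ofReal_le_ofReal ?_
  gcongr
  refine (F.solOp.le_opNorm φ).trans ?_
  gcongr
  refine ContinuousLinearMap.opNorm_le_bound _ hc.le fun v => ?_
  have h : ‖φ v‖ₑ ≤ F.normV v :=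
    (norm_le_dualENorm_mul φ v).trans (by simpa using mul_le_mul_left hφ (F.normV v))
  rw [← ofReal_norm] at h
  exact (ENNReal.ofReal_le_ofReal_iff (F.nV_nonneg v)).1 h

lemma solBound_solNorm (hinv : F.adjoint.P.IsInvertible) : F.SolBound F.solNorm.toReal := by
  intro φ N z hN hφ hz
  have hz' : F.solOp φ = F.incl z := by
    have h : dualMap F.incl (dualMap F.Pi1 φ) = F.adjoint.P z := by ext v; exact (hz v).symm
    change F.incl (F.adjoint.P.inverse (dualMap F.incl (dualMap F.Pi1 φ))) = F.incl z
    rw [h]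
    obtain ⟨R, hR⟩ := hinv
    rw [← hR]; simp
  have hdual : dualENorm F.normV φ ≤ ENNReal.ofReal N := by
    unfold dualENorm opENorm
    refine iSup₂_le fun v hv => ?_
    have h1 : F.nV v ≤ 1 := ENNReal.ofReal_le_one.1 hv
    change ‖φ v‖ₑ ≤ _
    rw [← ofReal_norm]
    exact ENNReal.ofReal_le_ofReal ((hφ v).trans (mul_le_of_le_one_right hN h1))
  have h1 := le_opENorm_mul (N := fun φ : AntiDual V => dualENorm F.normV φ) (M := F.normV)
    (T := F.solOp) (x := φ)
    (fun a ψ => by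
      unfold dualENorm opENorm
      simp only [ENNReal.mul_iSup, smul_apply, smul_eq_mul, enorm_mul])
    (fun a ψ => by
      rw [_root_.map_smul, normV_eq, normV_eq, nV_smul, ENNReal.ofReal_mul (norm_nonneg _), ofReal_norm])
    (fun h0 => by
      have hφ0 : φ = 0 := by
        ext v
        have h := norm_le_dualENorm_mul (F := F) φ v
        rw [h0, zero_mul] at h
        simpa using h
      rw [hφ0, map_zero, normV_eq, nV_zero, ENNReal.ofReal_zero])
    (ne_top_of_le_ne_top ENNReal.ofReal_ne_top hdual)
  rw [hz'] at h1
  change F.normV (F.incl z) ≤ F.solNorm * _ at h1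
  rw [← ENNReal.ofReal_le_ofReal_iff (by positivity), ENNReal.ofReal_mul ENNReal.toReal_nonneg,
    ENNReal.ofReal_toReal solNorm_ne_top]
  exact h1.trans (by gcongr)

lemma adjoint_P_injective (hsurj : ∀ φ : AntiDual H, ∃ u, F.P u = φ) :
    Function.Injective F.adjoint.P := by
  rw [injective_iff_map_eq_zero]
  intro v hv
  obtain ⟨u, hu⟩ := hsurj (riesz₀ H v)
  have h1 : F.P u v = 0 := by
    have h := F.adjoint_P_apply v u
    rw [hv] at h
    simpa using h.symm
  rw [hu] at h1
  simpa using h1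

lemma adjoint_P_surjective (hbij : Function.Bijective F.P) (φ : AntiDual H) :
    ∃ z, F.adjoint.P z = φ := by
  let R : H ≃L[ℂ] AntiDual H := ContinuousLinearEquiv.ofBijective F.P
    (LinearMap.ker_eq_bot.2 hbij.1) (LinearMap.range_eq_top.2 hbij.2)
  have hRa : ∀ φ, F.P (R.symm φ) = φ := fun φ => R.apply_symm_apply φ
  let T : H →L[ℂ] H := (R.symm : AntiDual H →L[ℂ] H) ∘L riesz₀ H
  have hT : ∀ v, F.P (T v) = riesz₀ H v := fun v => hRa _
  refine form_surjective F.adjoint.P (c := 1 / (‖T‖ + 1)) (by positivity) (fun v => ?_)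
    (fun v hv => ?_) φ
  · rw [div_mul_eq_mul_div, one_mul, div_le_iff₀ (by positivity)]
    have h1 := F.adjoint_P_apply v (T v)
    rw [hT, riesz₀_apply, inner_self_eq_norm_sq_to_K] at h1
    have h2 := F.adjoint.P.le_opNorm v
    have h3 := (F.adjoint.P v).le_opNorm (T v)
    have h4 := congrArg norm h1
    have h5 : ‖F.adjoint.P v (T v)‖ = ‖v‖ ^ 2 := by
      rw [h4, RCLike.norm_conj, norm_pow]; simp
    rw [h5] at h3
    have h6 := T.le_opNorm v
    have h7 := mul_le_mul_of_nonneg_left h6 (norm_nonneg (F.adjoint.P v))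
    rcases (norm_nonneg v).eq_or_lt with h | h
    · rw [← h]; positivity
    · refine le_of_mul_le_mul_right ?_ h
      nlinarith [mul_nonneg (norm_nonneg (F.adjoint.P v)) h.le]
  · refine hbij.1 ?_
    rw [map_zero]
    ext w
    have h := hv w
    rw [adjoint_P_apply] at h
    simpa using h

lemma adjoint_P_isInvertible (hbij : Function.Bijective F.P) : F.adjoint.P.IsInvertible :=
  ⟨ContinuousLinearEquiv.ofBijective F.adjoint.P
    (LinearMap.ker_eq_bot.2 (adjoint_P_injective hbij.2))
    (LinearMap.range_eq_top.2 (adjoint_P_surjective hbij)), rfl⟩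

lemma admissible_of_projErr {Z : ℕ → SubNorm V} {m : ℕ} {B : ℝ} {Hh : Submodule ℂ H}
    (hbij : Function.Bijective F.P) (hHh : IsClosed (Hh : Set H))
    (hgap : max (F.gammaDv Hh) (F.adjoint.gammaDv Hh) ≤ ENNReal.ofReal (1 / (16 * B ^ 2)))
    (hδ : F.projErr Hh (Z (m + 1)) ≠ ∞) :
    F.Admissible Z m B Hh (F.projErr Hh (Z (m + 1))).toReal F.solNorm.toReal where
  isClosed := hHh
  δ_nonneg := ENNReal.toReal_nonneg
  ρ_nonneg := ENNReal.toReal_nonneg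
  surj := hbij.2
  adj_surj := adjoint_P_surjective hbij
  gap := gap_of_gammaDv_le (by positivity) ((le_max_left _ _).trans hgap)
  adj_gap := gap_of_gammaDv_le (by positivity) ((le_max_right _ _).trans hgap)
  approx := approx_projErr hδ
  sol := solBound_solNorm (adjoint_P_isInvertible hbij)
  adj_sol := (solBound_solNorm (adjoint_P_isInvertible hbij)).adjoint (adjoint_P_surjective hbij)

lemma Bounds.dualENorm_P_le {B : ℝ} (hB : F.Bounds B) (u : H) :
    dualENorm F.normH (F.P u) ≤ ENNReal.ofReal (B * F.nH u) := by
  unfold dualENorm opENorm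
  refine iSup₂_le fun v hv => ?_
  have h1 : F.nH v ≤ 1 := ENNReal.ofReal_le_one.1 hv
  change ‖F.P u v‖ₑ ≤ _
  rw [← ofReal_norm]
  refine ENNReal.ofReal_le_ofReal ((hB.P_le u v).trans (mul_le_of_le_one_right ?_ h1))
  have := hB.pos
  have := F.nH_nonneg u
  positivity

/-- Regularity of the solution with oscillatory data: for `P u = ι g` the norm of `u` in `Z (m + 1)` is
controlled by its norm in `H`. -/
lemma Regularity.Z_osc_le {Z : ℕ → SubNorm V} {m : ℕ} {B C : ℝ} (hR : F.Regularity m Z C)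
    (hB : F.Bounds B) (hm : 1 ≤ m) (hC : 0 < C) (hCB : C ≤ B) {u : H} {g g' : V}
    (hu : F.P u = dualMap F.incl (F.ι g)) (hg' : ∀ k ∈ F.K, F.ι g k = F.ι g' k) {a a' : ℝ}
    (ha : 0 ≤ a) (ha' : 0 ≤ a') (hg : Z (m - 1) g ≤ ENNReal.ofReal (a * F.nH u))
    (hg1 : Z (m + 1) g' ≤ ENNReal.ofReal (a' * F.nH u)) :
    Z (m + 1) (F.incl u) ≤
      ENNReal.ofReal (regConst B m * (B ^ (m + 1) * (1 + a + a')) * F.nH u) := by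
  have hB0 := hB.pos
  have hB1 := hB.one_le
  have hu0 := F.nH_nonneg u
  have hpow : ENNReal.ofReal B ^ (m + 1) = ENNReal.ofReal (B ^ (m + 1)) := by
    rw [ENNReal.ofReal_pow hB0.le]
  rw [mul_assoc (regConst B m)]
  refine hR.Z_sol_le hB hm hC hCB (y := u) (g := g) (g' := g') (fun v => by rw [hu]; rfl) hg'
    (by positivity) ?_ (fun j hj => ?_) (fun j _ hj => ?_)
  · have h : B ≤ B ^ (m + 1) := le_self_pow₀ hB1 (by omega)
    calc _ ≤ B * F.nH u := hB.nV_le u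
      _ ≤ B ^ (m + 1) * 1 * F.nH u := by rw [mul_one]; gcongr
      _ ≤ _ := by gcongr; linarith
  · refine (hR.Z_le hB hCB (show j ≤ m - 1 by omega) (by omega) g).trans ?_
    calc _ ≤ ENNReal.ofReal (B ^ (m + 1)) * ENNReal.ofReal (a * F.nH u) := by rw [hpow]; gcongr
      _ = ENNReal.ofReal (B ^ (m + 1) * a * F.nH u) := by
        rw [← ENNReal.ofReal_mul (by positivity), mul_assoc]
      _ ≤ _ := by gcongr; linarith
  · refine (hR.Z_le hB hCB hj le_rfl g').trans ?_
    calc _ ≤ ENNReal.ofReal (B ^ (m + 1)) * ENNReal.ofReal (a' * F.nH u) := by rw [hpow]; gcongr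
      _ = ENNReal.ofReal (B ^ (m + 1) * a' * F.nH u) := by
        rw [← ENNReal.ofReal_mul (by positivity), mul_assoc]
      _ ≤ _ := by gcongr; linarith

lemma relative_error_le {Z : SubNorm V} {Hh : Submodule ℂ H} (hδ : F.projErr Hh Z ≠ ∞) {u uh : H}
    {c k : ℝ} (hc : 0 ≤ c) (hk : 0 ≤ k) {q : ℝ≥0∞}
    (hq : F.normH (u - uh) ≤ ENNReal.ofReal c * q * F.normH (u - F.projH Hh u))
    (hu : Z (F.incl u) ≤ ENNReal.ofReal (k * F.nH u)) :
    F.normH (u - uh) / F.normH u ≤ ENNReal.ofReal (c * k) * q * F.projErr Hh Z := by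
  have hu0 := F.nH_nonneg u
  have h1 := projH_error_le hδ (by positivity) hu
  have h2 : F.normH (u - F.projH Hh u) ≤
      F.projErr Hh Z * (ENNReal.ofReal k * F.normH u) := by
    rw [normH_eq, normH_eq, ← ENNReal.ofReal_mul hk]
    rw [← ENNReal.ofReal_toReal hδ]
    rw [← ENNReal.ofReal_mul ENNReal.toReal_nonneg]
    exact ENNReal.ofReal_le_ofReal h1
  refine ENNReal.div_le_of_le_mul (hq.trans ?_)
  calc _ ≤ ENNReal.ofReal c * q * (F.projErr Hh Z * (ENNReal.ofReal k * F.normH u)) := by gcongr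
    _ = _ := by rw [ENNReal.ofReal_mul hc]; ring

lemma Smoother.existsUnique_galerkin {B σ C δ ρ : ℝ} {m : ℕ} {Z : ℕ → SubNorm V} {S : V →L[ℂ] V}
    {Hh : Submodule ℂ H} (hS : F.Smoother Z m B σ S) (hR : F.Regularity m Z C)
    (hR' : F.adjoint.Regularity m Z C) (hB : F.Bounds B) (hm : 1 ≤ m) (hC : 0 < C) (hCB : C ≤ B)
    (hinj : Function.Injective F.P) (hA : F.Admissible Z m B Hh δ ρ)
    (hδρ : dualConst B σ m * ellipticDualConst B σ m * (δ ^ 2 * (1 + ρ)) ≤ 1 / 2) (u : H) :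
    ∃ uh, F.IsGalerkin Hh u uh ∧ (∀ wh, F.IsGalerkin Hh u wh → wh = uh) ∧
      F.nH (u - uh) ≤ quasiOptConst B σ m * (1 + δ * (1 + ρ)) * F.nH (u - F.projH Hh u) := by
  obtain ⟨uh, huh⟩ := hS.exists_galerkin hR hR' hB hm hC hCB hinj hA hδρ u
  refine ⟨uh, huh, fun wh hwh => ?_, ?_⟩
  · have h := hS.quasi_optimal hR hR' hB hm hC hCB hA hδρ (e := wh - uh) (x := 0)
      (by simpa using Hh.sub_mem hwh.1 huh.1) (fun v hv => by
        rw [show wh - uh = (u - uh) - (u - wh) by abel, form_sub_left, huh.2 v hv, hwh.2 v hv,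
          sub_zero])
    rw [nH_zero, mul_zero] at h
    exact sub_eq_zero.1 (F.eq_zero_of_nH _ (le_antisymm h (F.nH_nonneg _)))
  · refine hS.quasi_optimal hR hR' hB hm hC hCB hA hδρ ?_ huh.2
    rw [sub_sub_sub_cancel_left]
    exact Hh.sub_mem (F.projH Hh u).2 huh.1

lemma smoothConst_pos {B : ℝ} (hB : 1 ≤ B) (m : ℕ) : 0 < smoothConst B m := by
  have h := one_le_stepConst hB m
  have h0 : 0 < stepConst B m := by nlinarith
  have h1 : 0 < smoothFactor B m := by unfold smoothFactor; positivity
  exact mul_pos (Real.sqrt_pos.2 h1) (pow_pos h0 _)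

end

end Setting

end AbsGalerkin


/-- The constants depend only on `m`, on bounds for `‖P‖_{H → H^*}` and `‖E‖_{V → V^*}`, on the
coercivity and Gårding constants, and on the constant `C` of the regularity assumptions; `C₄` also
depends on `C_osc`, and `C₅` (the same constant under the relaxed oscillation condition) on `C_osc` and
on the bound for `ι⁻¹ Π̃₀^* ι`. -/
theorem theorem2p7 (m : ℕ) (hm : 1 ≤ m) (MP ME cE c₁ c₂ C : ℝ) (hC : 0 < C) :
    ∃ C₁ C₂ C₃ : ℝ, 0 < C₁ ∧ 0 < C₂ ∧ 0 < C₃ ∧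
    ∃ C₄ : ℝ → ℝ, ∃ C₅ : ℝ → ℝ → ℝ,
      (∀ Cosc, 0 < Cosc → 0 < C₄ Cosc) ∧
      (∀ Cosc Ct, 0 < Cosc → 0 < Ct → 0 < C₅ Cosc Ct) ∧
      ∀ (H : Type u) (V : Type v)
        [NormedAddCommGroup H] [InnerProductSpace ℂ H] [CompleteSpace H]
        [NormedAddCommGroup V] [InnerProductSpace ℂ V] [CompleteSpace V]
        (F : AbsGalerkin.Setting H V cE c₁ c₂) (Z : ℕ → AbsGalerkin.SubNorm V),
        F.normP ≤ ENNReal.ofReal MP → F.normE ≤ ENNReal.ofReal ME →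
        F.Regularity m Z C → F.adjoint.Regularity m Z C →
        (∀ f : AbsGalerkin.AntiDual H, ∃! u : H, F.P u = f) →
        ∀ Hh : Submodule ℂ H, IsClosed (Hh : Set H) →
          max (F.gammaDv Hh) (F.adjoint.gammaDv Hh) ≤ ENNReal.ofReal C₁ →
          F.projErr Hh (Z (m + 1)) ^ 2 * (1 + F.solNorm) ≤ ENNReal.ofReal C₂ →
          ∀ (f : AbsGalerkin.AntiDual H) (u : H), F.P u = f →
            ∃ uh : H, F.IsGalerkin Hh u uh ∧
              (∀ wh : H, F.IsGalerkin Hh u wh → wh = uh) ∧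
              -- quasi-optimality
              F.normH (u - uh) ≤
                ENNReal.ofReal C₃ * (1 + F.projErr Hh (Z (m + 1)) * (1 + F.solNorm)) *
                  F.normH (u - F.projH Hh u) ∧
              -- relative error for oscillatory data
              (∀ Cosc : ℝ, 0 < Cosc → ∀ g : V,
                AbsGalerkin.dualMap F.incl (F.ι g) = f →
                Z (m + 1) g ≤ ENNReal.ofReal Cosc * AbsGalerkin.dualENorm F.normH f →
                F.normH (u - uh) / F.normH u ≤
                  ENNReal.ofReal (C₄ Cosc) *
                    (1 + F.projErr Hh (Z (m + 1)) * (1 + F.solNorm)) *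
                      F.projErr Hh (Z (m + 1))) ∧
              -- relative error under the relaxed oscillation condition
              (∀ Cosc Ct : ℝ, 0 < Cosc → 0 < Ct → ∀ (g : V) (Pt : V →L[ℂ] V),
                AbsGalerkin.dualMap F.incl (F.ι g) = f →
                F.Pi0 ∘L Pt = Pt →
                AbsGalerkin.dualMap F.Pi0 (F.ι g) = AbsGalerkin.dualMap Pt (F.ι g) →
                AbsGalerkin.opENorm (Z (m - 1)) (Z (m + 1))
                  (F.ιInv (AbsGalerkin.dualMap Pt ∘L F.ι)) ≤ ENNReal.ofReal Ct →
                Z (m - 1) g ≤ ENNReal.ofReal Cosc * AbsGalerkin.dualENorm F.normH f →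
                F.normH (u - uh) / F.normH u ≤
                  ENNReal.ofReal (C₅ Cosc Ct) *
                    (1 + F.projErr Hh (Z (m + 1)) * (1 + F.solNorm)) *
                      F.projErr Hh (Z (m + 1))) := by
  set B := AbsGalerkin.Setting.boundConst MP ME cE c₂ C with hBdef
  set σ := AbsGalerkin.Setting.smoothConst B m
  set K := AbsGalerkin.Setting.dualConst B σ m * AbsGalerkin.Setting.ellipticDualConst B σ m with hK
  set c₃ := AbsGalerkin.Setting.quasiOptConst B σ m
  set r := AbsGalerkin.Setting.regConst B m
  have hCB : C ≤ B := by
    rw [hBdef, AbsGalerkin.Setting.boundConst]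
    linarith [le_abs_self C, abs_nonneg ME, abs_nonneg MP, abs_nonneg (c₂ / cE)]
  have hB1 : 1 ≤ B := by
    rw [hBdef, AbsGalerkin.Setting.boundConst]
    linarith [abs_nonneg C, abs_nonneg ME, abs_nonneg MP, abs_nonneg (c₂ / cE)]
  have hB0 : 0 < B := zero_lt_one.trans_le hB1
  have hσ : 0 < σ := AbsGalerkin.Setting.smoothConst_pos hB1 m
  have hr : 0 < r := zero_lt_one.trans_le (AbsGalerkin.Setting.one_le_regConst hB1 m)
  have hd : 0 < AbsGalerkin.Setting.dualConst B σ m := by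
    unfold AbsGalerkin.Setting.dualConst; positivity
  have hK0 : 0 < K := by
    refine mul_pos hd ?_
    unfold AbsGalerkin.Setting.ellipticDualConst; positivity
  have hc₃ : 0 < c₃ := by
    change 0 < AbsGalerkin.Setting.quasiOptConst B σ m
    unfold AbsGalerkin.Setting.quasiOptConst; positivity
  refine ⟨1 / (16 * B ^ 2), 1 / (2 * K), c₃, by positivity, by positivity, hc₃,
    fun Cosc => c₃ * (r * (B ^ (m + 1) * (1 + B ^ (m + 1) * (Cosc * B) + Cosc * B))),
    fun Cosc Ct => c₃ * (r * (B ^ (m + 1) * (1 + Cosc * B + Ct * (Cosc * B)))),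
    fun Cosc h => by positivity, fun Cosc Ct h h' => by positivity, ?_⟩
  intro H V _ _ _ _ _ _ F Z hP hE hR hR' huniq Hh hHh hgap hδρ f u huf
  have hB : F.Bounds B := F.bounds_of_norm_le C hP hE
  have hbij : Function.Bijective F.P := Function.bijective_iff_existsUnique _ |>.2 huniq
  have hδ : F.projErr Hh (Z (m + 1)) ≠ ∞ := by
    intro h
    rw [h, ENNReal.top_pow two_ne_zero, ENNReal.top_mul (by simp)] at hδρ
    exact ENNReal.ofReal_ne_top (top_le_iff.1 hδρ)
  have hρ : F.solNorm ≠ ∞ := AbsGalerkin.Setting.solNorm_ne_top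
  have hA := AbsGalerkin.Setting.admissible_of_projErr (Z := Z) (m := m) hbij hHh hgap hδ
  obtain ⟨S, hS⟩ := hR.exists_smoother hB hC hCB
  set δ := (F.projErr Hh (Z (m + 1))).toReal
  set ρ := F.solNorm.toReal
  have hδ0 : 0 ≤ δ := hA.δ_nonneg
  have hρ0 : 0 ≤ ρ := hA.ρ_nonneg
  have hδe : F.projErr Hh (Z (m + 1)) = ENNReal.ofReal δ := (ENNReal.ofReal_toReal hδ).symm
  have h1ρ : 1 + F.solNorm = ENNReal.ofReal (1 + ρ) := by
    rw [ENNReal.ofReal_add zero_le_one hρ0, ENNReal.ofReal_one, ENNReal.ofReal_toReal hρ]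
  have hsmall : K * (δ ^ 2 * (1 + ρ)) ≤ 1 / 2 := by
    rw [hδe, h1ρ, ← ENNReal.ofReal_pow hδ0, ← ENNReal.ofReal_mul (by positivity),
      ENNReal.ofReal_le_ofReal_iff (by positivity), le_div_iff₀ (by positivity)] at hδρ
    linarith
  have hfac : 1 + F.projErr Hh (Z (m + 1)) * (1 + F.solNorm) =
      ENNReal.ofReal (1 + δ * (1 + ρ)) := by
    rw [hδe, h1ρ, ← ENNReal.ofReal_mul hδ0, ENNReal.ofReal_add zero_le_one (by positivity),
      ENNReal.ofReal_one]
  obtain ⟨uh, huh, huniq', hopt⟩ := hS.existsUnique_galerkin hR hR' hB hm hC hCB hbij.1 hA hsmall u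
  have hq : F.normH (u - uh) ≤
      ENNReal.ofReal c₃ * (1 + F.projErr Hh (Z (m + 1)) * (1 + F.solNorm)) *
        F.normH (u - F.projH Hh u) := by
    rw [hfac, F.normH_eq, F.normH_eq, ← ENNReal.ofReal_mul hc₃.le,
      ← ENNReal.ofReal_mul (by positivity)]
    exact ENNReal.ofReal_le_ofReal hopt
  have hu0 := F.nH_nonneg u
  -- The oscillation condition bounds the data by `‖u‖_H`.
  have hosc : ∀ c : ℝ, 0 < c → ∀ t : ℝ≥0∞, t ≤ ENNReal.ofReal c * AbsGalerkin.dualENorm F.normH f →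
      t ≤ ENNReal.ofReal (c * B * F.nH u) := by
    intro c hc t ht
    rw [← huf] at ht
    refine ht.trans ?_
    rw [mul_assoc, ENNReal.ofReal_mul hc.le]
    gcongr
    exact hB.dualENorm_P_le u
  refine ⟨uh, huh, huniq', hq, fun Cosc hCosc g hg hgZ => ?_,
    fun Cosc Ct hCosc hCt g Pt hg _ hPt hPtZ hgZ => ?_⟩
  · have h1 := hosc Cosc hCosc _ hgZ
    have h2 : Z (m - 1) g ≤ ENNReal.ofReal (B ^ (m + 1) * (Cosc * B) * F.nH u) := by
      refine (hR.Z_le hB hCB (show m - 1 ≤ m + 1 by omega) le_rfl g).trans ?_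
      rw [mul_assoc (B ^ (m + 1)), ENNReal.ofReal_mul (by positivity), ENNReal.ofReal_pow hB0.le]
      gcongr
    exact AbsGalerkin.Setting.relative_error_le hδ hc₃.le (by positivity) hq
      (hR.Z_osc_le hB hm hC hCB (huf.trans hg.symm) (fun _ _ => rfl) (by positivity) (by positivity)
        h2 h1)
  · have h1 := hosc Cosc hCosc _ hgZ
    -- On `Ker D` the data `g` acts as its smooth part `ι⁻¹ Pt^* ι g`.
    have h2 : ∀ k ∈ F.K, F.ι g k = F.ι (F.ιInv (AbsGalerkin.dualMap Pt ∘L F.ι) g) k := by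
      intro k hk
      have h := congrArg (fun φ : AbsGalerkin.AntiDual V => φ k) hPt
      simp only [AbsGalerkin.dualMap_apply, F.Pi0_of_mem hk] at h
      rw [F.ι_ιInv, h]
      rfl
    have h3 : Z (m + 1) (F.ιInv (AbsGalerkin.dualMap Pt ∘L F.ι) g) ≤
        ENNReal.ofReal (Ct * (Cosc * B) * F.nH u) := by
      refine (AbsGalerkin.SubNorm.le_of_opENorm_le
        (T := (F.ιInv (AbsGalerkin.dualMap Pt ∘L F.ι) : V →ₗ[ℂ] V)) hCt hPtZ g).trans ?_
      rw [mul_assoc Ct, ENNReal.ofReal_mul hCt.le]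
      gcongr
    exact AbsGalerkin.Setting.relative_error_le hδ hc₃.le (by positivity) hq
      (hR.Z_osc_le hB hm hC hCB (huf.trans hg.symm) h2 (by positivity) (by positivity) h1 h3)
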